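/- Let $0\le r\le n$ be integers, let $G_1,G_2,f:\mathbb R^n\to\mathbb R^n$ be smooth, and assume that the first $r$ components of $f$ vanish identically. Let $K\in\mathcal M_{2,2}(\mathbb R)$ be invertible, $c\in\mathbb R^2$, and write $(K\nabla)_m=\sum_j K_{mj}\partial_j$. Let $U:\mathbb R^2\to\mathbb R^n$ be a $\mathbb Z^2$-periodic function of class $C^2$ such that $\partial_1U,\partial_2U$ are linearly independent and $$0=\sum_{m=1}^2 (K\nabla)_m(K\nabla)_mU+\sum_{m=1}^2 (K\nabla)_m\big(G_m(U)\big)+(K^{T}c\cdot\nabla)U+f(U),$$ so that $U(K^T(x-tc))$ is a two-dimensional periodic traveling wave of $W_t=\Delta W+\operatorname{div}G(W)+f(W)$. For $\xi\in\mathbb R^2$ let $L_\xi$ be the operator on $L^2(\mathbb R^2/\mathbb Z^2;\mathbb C^n)$ with domain $H^2(\mathbb R^2/\mathbb Z^2;\mathbb C^n)$ given by $$L_\xi V=\sum_m (K(\nabla+i\xi))_m^2V+\sum_m (K(\nabla+i\xi))_m\big(DG_m(U)V\big)+(K^Tc\cdot(\nabla+i\xi))V+Df(U)V .$$ Assume (D1):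 the spectrum of $L_0$ meets $i\mathbb R$ only at $0$, and $0$ is an eigenvalue of $L_0$ of algebraic multiplicity $r+2$. For $\delta,\xi_0>0$, call *critical basis* (on $\|\xi\|<\xi_0$, for eigenvalues in $|\lambda|<\delta$) any families $(Q_1^\xi,\dots,Q_{r+2}^\xi)$ and $(\tilde Q_1^\xi,\dots,\tilde Q_{r+2}^\xi)$ in $L^2(\mathbb R^2/\mathbb Z^2;\mathbb C^n)$, defined for $\|\xi\|<\xi_0$, such that * $\xi\mapsto Q_j^\xi$ and $\xi\mapsto\tilde Q_j^\xi$ are smooth on $\|\xi\|<\xi_0$ with values in $L^2$; * for $\|\xi\|<\xi_0$, $(Q_j^\xi)_j$ is a basis of the sum of the generalized eigenspaces of $L_\xi$ associated with its eigenvalues $\lambda$ with $|\lambda|<\delta$, $(\tilde Q_j^\xi)_j$ is a basis of the analogous space for the adjoint $L_\xi^*$, and $\langle\tilde Q_j^\xi;Q_\ell^\xi\rangle_{L^2}=\delta_{j\ell}$; * $Q_1^0=\partial_1U$, $Q_2^0=\partial_2U$, and $\tilde Q_{2+j}^0$ is the constant function $\mathbf e_j$ for $1\le j\le r$. Given a critical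 basis, set $D_\xi=(\langle\tilde Q_j^\xi;L_\xi Q_\ell^\xi\rangle_{L^2})_{1\le j,\ell\le r+2}$ and $$\Delta_\xi=\begin{pmatrix}\|\xi\|\,I_2&0\\0&I_r\end{pmatrix}D_\xi\begin{pmatrix}\|\xi\|\,I_2&0\\0&I_r\end{pmatrix}^{-1}\quad(0<\|\xi\|<\xi_0),\qquad \Delta_0=0 .$$ Then critical bases exist for some $\delta,\xi_0>0$; and for every $\delta,\xi_0>0$ and every critical basis, $\xi\mapsto\Delta_\xi$ is smooth in polar coordinates, that is, the map $(\rho,\theta)\mapsto\Delta_{\rho(\cos\theta,\sin\theta)}$ is $C^\infty$ on $[0,\xi_0)\times\mathbb R$, including up to the boundary $\rho=0$. -/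

import Mathlib

open MeasureTheory Set
open scoped ContDiff

noncomputable section

namespace BlochWave

/-- The torus `ℝ²/ℤ²`; a function on it is a `ℤ²`-periodic function on `ℝ²`. -/
abbrev Torus : Type := UnitAddTorus (Fin 2)

/-- Lebesgue measure on `ℝ²/ℤ²` (total mass one). -/
abbrev torusMeasure : Measure Torus := Measure.pi fun _ => AddCircle.haarAddCircle

/-- `L²(ℝ²/ℤ²; ℂⁿ)`. -/
abbrev L2 (n : ℕ) : Type := Lp (EuclideanSpace ℂ (Fin n)) 2 torusMeasure

/-! ### Classical calculus for periodic functions -/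

/-- The periodic function on `ℝ²` associated with a function on the torus. -/
def lift {F : Type*} (φ : Torus → F) (y : EuclideanSpace ℝ (Fin 2)) : F :=
  φ fun i => ((y i : ℝ) : UnitAddCircle)

/-- The classical partial derivative `∂ⱼ φ` of a function on the torus. -/
def pd {F : Type*} [NormedAddCommGroup F] [NormedSpace ℝ F] (j : Fin 2) (φ : Torus → F) :
    Torus → F :=
  fun x => deriv (fun t : ℝ => φ (x + Pi.single j (t : UnitAddCircle))) 0

/-- The `m`-th component of `K∇` acting on a function on the torus. -/
def gradK {F : Type*} [NormedAddCommGroup F] [NormedSpace ℝ F] (K : Matrix (Fin 2) (Fin 2) ℝ)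
    (m : Fin 2) (φ : Torus → F) : Torus → F :=
  fun x => ∑ j, K m j • pd j φ x

/-- The inclusion of `ℝⁿ` in `ℂⁿ`. -/
def toC {n : ℕ} (u : EuclideanSpace ℝ (Fin n)) : EuclideanSpace ℂ (Fin n) :=
  WithLp.toLp 2 fun a => (u a : ℂ)

/-- The complexification `ℂⁿ → ℂⁿ` of the differential at `u` of a map `F : ℝⁿ → ℝⁿ`,
applied to `v`. -/
def dC {n : ℕ} (F : EuclideanSpace ℝ (Fin n) → EuclideanSpace ℝ (Fin n))
    (u : EuclideanSpace ℝ (Fin n)) (v : EuclideanSpace ℂ (Fin n)) : EuclideanSpace ℂ (Fin n) :=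
  WithLp.toLp 2 fun a => ∑ b, ((fderiv ℝ F u (EuclideanSpace.single b 1) a : ℝ) : ℂ) * v b

/-- A two-dimensional periodic traveling wave of `W_t = ΔW + div G(W) + f(W)`, whose first `r`
equations are conservation laws. The wave is `W(t,x) = U(Kᵀ(x - t c))`. -/
structure PeriodicWave (n r : ℕ) where
  /-- The flux: `G m` is the flux in the `m`-th spatial direction. -/
  G : Fin 2 → EuclideanSpace ℝ (Fin n) → EuclideanSpace ℝ (Fin n)
  /-- The reaction rate. -/
  f : EuclideanSpace ℝ (Fin n) → EuclideanSpace ℝ (Fin n)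
  /-- The matrix of wave vectors. -/
  K : Matrix (Fin 2) (Fin 2) ℝ
  /-- The wave speed. -/
  c : Fin 2 → ℝ
  /-- The scaled wave profile. -/
  U : Torus → EuclideanSpace ℝ (Fin n)
  r_le : r ≤ n
  smooth_G : ∀ m, ContDiff ℝ ∞ (G m)
  smooth_f : ContDiff ℝ ∞ f
  /-- The first `r` components of the reaction rate vanish identically. -/
  conservative : ∀ u (a : Fin n), (a : ℕ) < r → f u a = 0
  /-- The two columns of `K` form a basis of `ℝ²`. -/
  det_K : K.det ≠ 0
  /-- The profile is a classical function. -/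
  contDiff_U : ContDiff ℝ 2 (lift U)
  /-- The profile equation
  `0 = (K∇)ᵀ(K∇)U + (K∇)ᵀ G(U) + (Kᵀc · ∇)U + f(U)`; note that `Kᵀc · ∇ = c · K∇`. -/
  profile : ∀ x, (∑ m, gradK K m (gradK K m U) x) + (∑ m, gradK K m (fun y => G m (U y)) x)
    + (∑ m, c m • gradK K m U x) + f (U x) = 0
  /-- The profile genuinely depends on two variables: `∂₁U` and `∂₂U` are independent. -/
  genuinely_two_dim : LinearIndependent ℝ fun j : Fin 2 => pd j U

/-! ### Basic facts on Fourier coefficients -/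

open UnitAddTorus

theorem integrable_mFourier {n : ℕ} {φ : Torus → EuclideanSpace ℂ (Fin n)}
    (h : Integrable φ torusMeasure) (k : Fin 2 → ℤ) :
    Integrable (fun x => mFourier (-k) x • φ x) torusMeasure := by
  refine h.bdd_smul 1 (mFourier (-k)).continuous.aestronglyMeasurable ?_
  refine Filter.Eventually.of_forall fun x => ?_
  exact ((mFourier (-k)).norm_coe_le_norm x).trans mFourier_norm.le

theorem integrable_L2 {n : ℕ} (V : L2 n) : Integrable V torusMeasure :=
  (Lp.memLp V).integrable (by norm_num)

theorem coeff_add {n : ℕ} {φ ψ : Torus → EuclideanSpace ℂ (Fin n)}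
    (hφ : Integrable φ torusMeasure) (hψ : Integrable ψ torusMeasure) (k : Fin 2 → ℤ) :
    mFourierCoeff (fun x => φ x + ψ x) k = mFourierCoeff φ k + mFourierCoeff ψ k := by
  unfold mFourierCoeff
  simp only [smul_add]
  exact integral_add (integrable_mFourier hφ k) (integrable_mFourier hψ k)

theorem coeff_smul {n : ℕ} (a : ℂ) (φ : Torus → EuclideanSpace ℂ (Fin n)) (k : Fin 2 → ℤ) :
    mFourierCoeff (fun x => a • φ x) k = a • mFourierCoeff φ k := by
  unfold mFourierCoeff
  simp only [smul_comm _ a]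
  exact integral_smul a _

theorem coeff_congr {n : ℕ} {φ ψ : Torus → EuclideanSpace ℂ (Fin n)}
    (h : φ =ᵐ[torusMeasure] ψ) (k : Fin 2 → ℤ) : mFourierCoeff φ k = mFourierCoeff ψ k := by
  unfold mFourierCoeff
  refine integral_congr_ae ?_
  filter_upwards [h] with x hx
  rw [hx]

theorem coeff_coe_add {n : ℕ} (V W : L2 n) (k : Fin 2 → ℤ) :
    mFourierCoeff (V + W : L2 n) k = mFourierCoeff V k + mFourierCoeff W k := by
  rw [coeff_congr (Lp.coeFn_add V W)]
  exact coeff_add (integrable_L2 V) (integrable_L2 W) k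

theorem coeff_coe_smul {n : ℕ} (a : ℂ) (V : L2 n) (k : Fin 2 → ℤ) :
    mFourierCoeff (a • V : L2 n) k = a • mFourierCoeff V k := by
  rw [coeff_congr (Lp.coeFn_smul a V)]
  exact coeff_smul a _ k

theorem coeff_coe_zero {n : ℕ} (k : Fin 2 → ℤ) : mFourierCoeff (0 : L2 n) k = 0 := by
  simpa using coeff_coe_smul (0 : ℂ) (0 : L2 n) k

/-- An element of `L²` with vanishing Fourier coefficients vanishes. -/
theorem eq_zero_of_coeff {n : ℕ} (V : L2 n) (h : ∀ k, mFourierCoeff V k = 0) : V = 0 := by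
  have key : ∀ i : Fin n, (fun x => V x i) =ᵐ[torusMeasure] 0 := by
    intro i
    let p : EuclideanSpace ℂ (Fin n) →L[ℂ] ℂ := EuclideanSpace.proj i
    have hc : (p.compLp V : Torus → ℂ) =ᵐ[torusMeasure] fun x => V x i :=
      ContinuousLinearMap.coeFn_compLp p V
    have hz : p.compLp V = 0 := by
      apply (mFourierBasis (d := Fin 2)).repr.injective
      ext k
      rw [map_zero]
      refine (mFourierBasis_repr (p.compLp V) k).trans ?_
      have h1 : mFourierCoeff (p.compLp V) k = p (mFourierCoeff V k) := by
        unfold mFourierCoeff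
        refine Eq.trans ?_ (p.integral_comp_comm (integrable_mFourier (integrable_L2 V) k))
        refine integral_congr_ae ?_
        filter_upwards [hc] with x hx
        rw [hx]
        simp [p]
      rw [h1, h k]
      simp
    rw [hz] at hc
    filter_upwards [hc, Lp.coeFn_zero (E := ℂ) (p := 2) (μ := torusMeasure)] with x h1 h2
    rw [← h1, h2]
  rw [Lp.eq_zero_iff_ae_eq_zero]
  filter_upwards [ae_all_iff.2 key] with x hx
  ext i
  simpa using hx i

/-- `H²(ℝ²/ℤ²; ℂⁿ)`, that is, the elements of `L²` with `∑ₖ (1 + |k|²)² |V̂(k)|² < ∞`. -/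
def IsH2 {n : ℕ} (V : L2 n) : Prop :=
  Summable fun k : Fin 2 → ℤ => (1 + ∑ j, (k j : ℝ) ^ 2) ^ 2 * ‖mFourierCoeff V k‖ ^ 2

theorem IsH2.zero {n : ℕ} : IsH2 (0 : L2 n) := by
  have : (fun k : Fin 2 → ℤ => (1 + ∑ j, (k j : ℝ) ^ 2) ^ 2 * ‖mFourierCoeff (0 : L2 n) k‖ ^ 2)
      = fun _ => 0 := by
    funext k
    rw [coeff_coe_zero]
    simp
  unfold IsH2
  rw [this]
  exact summable_zero

theorem IsH2.add {n : ℕ} {V W : L2 n} (hV : IsH2 V) (hW : IsH2 W) : IsH2 (V + W) := by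
  refine Summable.of_nonneg_of_le (fun k => by positivity) (fun k => ?_)
    ((hV.mul_left 2).add (hW.mul_left 2))
  rw [coeff_coe_add]
  have h1 := norm_add_le (mFourierCoeff V k) (mFourierCoeff W k)
  have h2 : ‖mFourierCoeff V k + mFourierCoeff W k‖ ^ 2
      ≤ 2 * ‖mFourierCoeff V k‖ ^ 2 + 2 * ‖mFourierCoeff W k‖ ^ 2 := by
    have h3 := pow_le_pow_left₀ (norm_nonneg _) h1 2
    nlinarith [sq_nonneg (‖mFourierCoeff V k‖ - ‖mFourierCoeff W k‖)]
  have h4 : (0 : ℝ) ≤ (1 + ∑ j, (k j : ℝ) ^ 2) ^ 2 := by positivity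
  nlinarith [mul_le_mul_of_nonneg_left h2 h4]

theorem IsH2.smul {n : ℕ} (a : ℂ) {V : L2 n} (hV : IsH2 V) : IsH2 (a • V) := by
  refine (hV.mul_left (‖a‖ ^ 2)).congr fun k => ?_
  rw [coeff_coe_smul, norm_smul]
  ring

/-! ### Bloch symbols -/

section Bloch

variable {n r : ℕ} (P : PeriodicWave n r)

theorem PeriodicWave.continuous_U : Continuous P.U := by
  have hq : IsOpenQuotientMap
      (fun (y : Fin 2 → ℝ) (i : Fin 2) => ((y i : ℝ) : UnitAddCircle)) :=
    IsOpenQuotientMap.piMap fun _ => QuotientAddGroup.isOpenQuotientMap_mk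
  rw [hq.isQuotientMap.continuous_iff]
  exact P.contDiff_U.continuous.comp (PiLp.continuous_toLp 2 fun _ : Fin 2 => ℝ)

theorem integrable_dC {F : EuclideanSpace ℝ (Fin n) → EuclideanSpace ℝ (Fin n)}
    (hF : ContDiff ℝ ∞ F) (V : L2 n) :
    Integrable (fun x => dC F (P.U x) (V x)) torusMeasure := by
  have hV : ∀ b, Integrable (fun x => V x b) torusMeasure := fun b =>
    (EuclideanSpace.proj b : EuclideanSpace ℂ (Fin n) →L[ℂ] ℂ).integrable_comp (integrable_L2 V)
  have hdF : Continuous fun x => fderiv ℝ F (P.U x) :=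
    (hF.continuous_fderiv (by simp)).comp P.continuous_U
  have hc : ∀ a, Integrable (fun x => dC F (P.U x) (V x) a) torusMeasure := by
    intro a
    simp only [dC]
    refine integrable_finsetSum _ fun b _ => ?_
    have hcont : Continuous fun x : Torus =>
        ((fderiv ℝ F (P.U x) (EuclideanSpace.single b 1) a : ℝ) : ℂ) := by
      refine Complex.continuous_ofReal.comp ?_
      exact (EuclideanSpace.proj a : EuclideanSpace ℝ (Fin n) →L[ℝ] ℝ).continuous.comp
        (hdF.clm_apply continuous_const)
    obtain ⟨C, hC⟩ := isCompact_univ.exists_bound_of_continuousOn hcont.continuousOn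
    exact (hV b).bdd_mul hcont.aestronglyMeasurable
      (Filter.Eventually.of_forall fun x => hC x (mem_univ x))
  have h := Integrable.of_eval hc
  exact (PiLp.continuousLinearEquiv 2 ℂ fun _ : Fin n => ℂ).symm.toContinuousLinearMap.integrable_comp
    h

theorem dC_add (F : EuclideanSpace ℝ (Fin n) → EuclideanSpace ℝ (Fin n))
    (u : EuclideanSpace ℝ (Fin n)) (v w : EuclideanSpace ℂ (Fin n)) :
    dC F u (v + w) = dC F u v + dC F u w := by
  ext a
  simp [dC, mul_add, Finset.sum_add_distrib]

theorem dC_smul (F : EuclideanSpace ℝ (Fin n) → EuclideanSpace ℝ (Fin n))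
    (u : EuclideanSpace ℝ (Fin n)) (z : ℂ) (v : EuclideanSpace ℂ (Fin n)) :
    dC F u (z • v) = z • dC F u v := by
  ext a
  simp [dC, Finset.mul_sum, mul_left_comm]

theorem coeff_dC_add {F : EuclideanSpace ℝ (Fin n) → EuclideanSpace ℝ (Fin n)}
    (hF : ContDiff ℝ ∞ F) (V W : L2 n) (k : Fin 2 → ℤ) :
    mFourierCoeff (fun x => dC F (P.U x) ((V + W : L2 n) x)) k
      = mFourierCoeff (fun x => dC F (P.U x) (V x)) k
        + mFourierCoeff (fun x => dC F (P.U x) (W x)) k := by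
  rw [← coeff_add (integrable_dC P hF V) (integrable_dC P hF W)]
  refine coeff_congr ?_ k
  filter_upwards [Lp.coeFn_add V W] with x hx
  rw [hx, Pi.add_apply, dC_add]

theorem coeff_dC_smul (F : EuclideanSpace ℝ (Fin n) → EuclideanSpace ℝ (Fin n))
    (z : ℂ) (V : L2 n) (k : Fin 2 → ℤ) :
    mFourierCoeff (fun x => dC F (P.U x) ((z • V : L2 n) x)) k
      = z • mFourierCoeff (fun x => dC F (P.U x) (V x)) k := by
  rw [← coeff_smul]
  refine coeff_congr ?_ k
  filter_upwards [Lp.coeFn_smul z V] with x hx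
  rw [hx, Pi.smul_apply, dC_smul]

/-- The Fourier multiplier of the `m`-th component of `K(∇ + iξ)`: it acts on `exp(2iπ k·x)` as
multiplication by `i (K(2πk + ξ))ₘ`. -/
def symb (ξ : EuclideanSpace ℝ (Fin 2)) (k : Fin 2 → ℤ) (m : Fin 2) : ℂ :=
  Complex.I * ((∑ j, P.K m j * (2 * Real.pi * (k j : ℝ) + ξ j) : ℝ) : ℂ)

/-- The `k`-th Fourier coefficient of
`(K(∇+iξ))ᵀ K(∇+iξ)V + (K(∇+iξ))ᵀ DG(U)(V) + (Kᵀc · (∇+iξ))V + Df(U)(V)`,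
all the derivatives being understood in the sense of periodic distributions. -/
def blochCoeff (ξ : EuclideanSpace ℝ (Fin 2)) (V : L2 n) (k : Fin 2 → ℤ) :
    EuclideanSpace ℂ (Fin n) :=
  (∑ m, symb P ξ k m ^ 2) • mFourierCoeff V k
    + (∑ m, symb P ξ k m • mFourierCoeff (fun x => dC (P.G m) (P.U x) (V x)) k)
    + (∑ m, (P.c m : ℂ) * symb P ξ k m) • mFourierCoeff V k
    + mFourierCoeff (fun x => dC P.f (P.U x) (V x)) k

theorem blochCoeff_add (ξ : EuclideanSpace ℝ (Fin 2)) (V W : L2 n) (k : Fin 2 → ℤ) :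
    blochCoeff P ξ (V + W) k = blochCoeff P ξ V k + blochCoeff P ξ W k := by
  simp only [blochCoeff, coeff_coe_add, coeff_dC_add P (P.smooth_G _), coeff_dC_add P P.smooth_f,
    smul_add, Finset.sum_add_distrib]
  abel

theorem blochCoeff_smul (ξ : EuclideanSpace ℝ (Fin 2)) (z : ℂ) (V : L2 n) (k : Fin 2 → ℤ) :
    blochCoeff P ξ (z • V) k = z • blochCoeff P ξ V k := by
  simp only [blochCoeff, coeff_coe_smul, coeff_dC_smul, smul_add, Finset.smul_sum, smul_comm z]

/-- The graph of the Bloch symbol: the pairs `(V, W)` with `V` in `H²` and `W = L_ξ V`, the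
equality being tested on every Fourier coefficient. -/
def blochGraph (ξ : EuclideanSpace ℝ (Fin 2)) : Submodule ℂ (L2 n × L2 n) where
  carrier := {p | IsH2 p.1 ∧ ∀ k, mFourierCoeff p.2 k = blochCoeff P ξ p.1 k}
  zero_mem' := by
    refine ⟨IsH2.zero, fun k => ?_⟩
    have := blochCoeff_smul P ξ 0 0 k
    rw [zero_smul, zero_smul] at this
    change mFourierCoeff (0 : L2 n) k = blochCoeff P ξ 0 k
    rw [this, coeff_coe_zero]
  add_mem' := by
    rintro p q ⟨hp, hp'⟩ ⟨hq, hq'⟩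
    refine ⟨hp.add hq, fun k => ?_⟩
    change mFourierCoeff (p.2 + q.2 : L2 n) k = blochCoeff P ξ (p.1 + q.1) k
    rw [coeff_coe_add, blochCoeff_add, hp', hq']
  smul_mem' := by
    rintro z p ⟨hp, hp'⟩
    refine ⟨hp.smul z, fun k => ?_⟩
    change mFourierCoeff (z • p.2 : L2 n) k = blochCoeff P ξ (z • p.1) k
    rw [coeff_coe_smul, blochCoeff_smul, hp']

/-- The Bloch graph is single-valued, so that the next definition involves no default value. -/
theorem blochGraph_single (ξ : EuclideanSpace ℝ (Fin 2)) (p : L2 n × L2 n)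
    (hp : p ∈ blochGraph P ξ) (h : p.1 = 0) : p.2 = 0 := by
  refine eq_zero_of_coeff _ fun k => ?_
  rw [hp.2 k, h]
  simpa using blochCoeff_smul P ξ 0 0 k

/-- The Bloch symbol `L_ξ`, as an unbounded operator on `L²` with domain `H²`:
`L_ξ V = (K(∇+iξ))ᵀ K(∇+iξ)V + (K(∇+iξ))ᵀ DG(U)(V) + (Kᵀc · (∇+iξ))V + Df(U)(V)`. -/
def bloch (ξ : EuclideanSpace ℝ (Fin 2)) : L2 n →ₗ.[ℂ] L2 n := (blochGraph P ξ).toLinearPMap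

end Bloch

/-! ### Spectral notions for unbounded operators -/

section Spectral

variable {E : Type*} [NormedAddCommGroup E] [NormedSpace ℂ E]

/-- The spectrum of an unbounded operator: the complement of the set of the `z` such that `T - z`
is a bijection from the domain onto the space, with bounded inverse. -/
def spec (T : E →ₗ.[ℂ] E) : Set ℂ :=
  {z | ¬ ∃ R : E →L[ℂ] E, (∀ w, ∃ h : R w ∈ T.domain, T ⟨R w, h⟩ - z • R w = w) ∧
    ∀ v : T.domain, R (T v - z • (v : E)) = v}

/-- The kernel of `(T - z)^p`, with its natural domain. -/
def kerPow (T : E →ₗ.[ℂ] E) (z : ℂ) : ℕ → Submodule ℂ E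
  | 0 => ⊥
  | p + 1 => ((kerPow T z p).comap (T.toFun - z • T.domain.subtype)).map T.domain.subtype

/-- The generalized eigenspace `⋃ₚ ker (T - z)^p`; it is trivial when `z` is not an eigenvalue. -/
def genEigenspace (T : E →ₗ.[ℂ] E) (z : ℂ) : Submodule ℂ E := ⨆ p, kerPow T z p

/-- The sum of the generalized eigenspaces of `T` for its eigenvalues of modulus less
than `δ`. -/
def criticalSpace (T : E →ₗ.[ℂ] E) (δ : ℝ) : Submodule ℂ E :=
  ⨆ z ∈ Metric.ball (0 : ℂ) δ, genEigenspace T z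

open scoped Classical in
/-- The value of an unbounded operator at a vector of its domain (zero outside the domain). -/
def applyOp (T : E →ₗ.[ℂ] E) (v : E) : E := if h : v ∈ T.domain then T ⟨v, h⟩ else 0

end Spectral

section Critical

variable {n r : ℕ} (P : PeriodicWave n r)

/-- The spectrum of `L_0` meets the imaginary axis only at `0`, which is an eigenvalue of
algebraic multiplicity `r + 2`. -/
def ConditionD1 : Prop :=
  spec (bloch P 0) ∩ {z | z.re = 0} = {0} ∧
    Module.finrank ℂ (genEigenspace (bloch P 0) 0) = r + 2

/-- For `‖ξ‖ < ξ₀`, `Q · ξ` is a basis of the sum of the generalized eigenspaces of `L_ξ` for its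
eigenvalues of modulus less than `δ`, and `Qt · ξ` is the dual basis of the same space for the
adjoint of `L_ξ` (the linear independence of both families follows from the duality relation).
Both depend smoothly on `ξ`. At `ξ = 0` the first two vectors of `Q` are `∂₁U`, `∂₂U` and the
last `r` vectors of `Qt` are the constant functions `e₁, …, e_r`. -/
structure IsCriticalBasis (δ ξ₀ : ℝ)
    (Q Qt : Fin 2 ⊕ Fin r → EuclideanSpace ℝ (Fin 2) → L2 n) : Prop where
  smooth : ∀ a, ContDiffOn ℝ ∞ (Q a) (Metric.ball 0 ξ₀)
  smooth_dual : ∀ a, ContDiffOn ℝ ∞ (Qt a) (Metric.ball 0 ξ₀)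
  span_eq : ∀ ξ ∈ Metric.ball (0 : EuclideanSpace ℝ (Fin 2)) ξ₀,
    Submodule.span ℂ (range fun a => Q a ξ) = criticalSpace (bloch P ξ) δ
  span_dual_eq : ∀ ξ ∈ Metric.ball (0 : EuclideanSpace ℝ (Fin 2)) ξ₀,
    Submodule.span ℂ (range fun a => Qt a ξ) = criticalSpace (bloch P ξ).adjoint δ
  dual : ∀ ξ ∈ Metric.ball (0 : EuclideanSpace ℝ (Fin 2)) ξ₀, ∀ a b,
    inner ℂ (Qt a ξ) (Q b ξ) = if a = b then 1 else 0
  at_zero : ∀ j : Fin 2, Q (Sum.inl j) 0 =ᵐ[torusMeasure] fun x => toC (pd j P.U x)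
  dual_at_zero : ∀ j : Fin r, Qt (Sum.inr j) 0 =ᵐ[torusMeasure]
    fun _ => EuclideanSpace.single (Fin.castLE P.r_le j) 1

/-- The matrix `D_ξ` with entries `⟨Qtₐ, L_ξ Q_b⟩`. -/
def critMatrix (Q Qt : Fin 2 ⊕ Fin r → EuclideanSpace ℝ (Fin 2) → L2 n)
    (ξ : EuclideanSpace ℝ (Fin 2)) : Matrix (Fin 2 ⊕ Fin r) (Fin 2 ⊕ Fin r) ℂ :=
  Matrix.of fun a b => inner ℂ (Qt a ξ) (applyOp (bloch P ξ) (Q b ξ))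

/-- The matrix `diag(ρ I₂, I_r)`. -/
def scaling (r : ℕ) (ρ : ℝ) : Matrix (Fin 2 ⊕ Fin r) (Fin 2 ⊕ Fin r) ℂ :=
  Matrix.fromBlocks ((ρ : ℂ) • 1) 0 0 1

open scoped Classical in
/-- The rescaled matrix `Δ_ξ = diag(‖ξ‖ I₂, I_r) D_ξ diag(‖ξ‖ I₂, I_r)⁻¹`, with `Δ_0 = 0`. -/
def rescaledMatrix (Q Qt : Fin 2 ⊕ Fin r → EuclideanSpace ℝ (Fin 2) → L2 n)
    (ξ : EuclideanSpace ℝ (Fin 2)) : Matrix (Fin 2 ⊕ Fin r) (Fin 2 ⊕ Fin r) ℂ :=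
  if ξ = 0 then 0 else scaling r ‖ξ‖ * critMatrix P Q Qt ξ * (scaling r ‖ξ‖)⁻¹

/-- The point of polar coordinates `(ρ, θ)`. -/
def polar (p : ℝ × ℝ) : EuclideanSpace ℝ (Fin 2) :=
  !₂[p.1 * Real.cos p.2, p.1 * Real.sin p.2]

/-- Smoothness in polar coordinates, up to `ρ = 0`, on the disk of radius `ξ₀`. -/
def SmoothInPolar {ι : Type*} (ξ₀ : ℝ) (M : EuclideanSpace ℝ (Fin 2) → Matrix ι ι ℂ) : Prop :=
  ∀ a b, ContDiffOn ℝ ∞ (fun p : ℝ × ℝ => M (polar p) a b) (Ico 0 ξ₀ ×ˢ univ)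

end Critical

end BlochWave

end

noncomputable section

namespace BlochWave

open scoped Topology Convolution

/-! The smoothness of the rescaled matrix comes from the order to which the blocks of `D_ξ` vanish
at `ξ = 0`. The existence of critical bases is analytic perturbation theory, applied to a resolvent.

Smoothness. Conjugation by `diag(ρ I₂, I_r)` keeps the diagonal blocks of `D_ξ`, multiplies the
upper right block by `ρ` and divides the lower left one by `ρ`. Since `D` is smooth in `ξ`
(`contDiffOn_critMatrix`) and `Δ_0 = 0`, it suffices that the diagonal blocks vanish at `0` and that
the lower left block is `o(‖ξ‖)`; Hadamard's lemma then allows the division in polar coordinates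
(`contDiffOn_div_polar`). The first two columns of `D_0` vanish because `∂ⱼU` is in the kernel of
`L_0`, by differentiation of the profile equation. The last `r` rows vanish because the conserved
components of `L_0 V` have mean zero. For the lower left block, the mean of a conserved component of
`L_ξ V` is a sum of terms with a factor `Kξ` and a factor that is the mean of a component of `V` or
of `DG_m(U)V`. For `V = ∂_lU` these means are zero, being means of derivatives of `U` and of
`G_m(U)`, so that the whole is of second order (`hasFDerivAt_critMatrix`).

Existence. With `B = (s² - (K∇)ᵀ(K∇))⁻¹`, the operator `B (L_ξ - s²)` is bounded and polynomial in
`Kξ`; it is invertible at `ξ = 0` when `s` is large. Thus the resolvent of `L_ξ` at `z = s²` is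
compact and analytic in `ξ` near `0`, and by elliptic regularity it describes `L_ξ` on its domain
`H²` exactly (`mem_graph_bloch_iff`). An eigenvalue `l` of `L_ξ` becomes the eigenvalue `(l - z)⁻¹ +
z⁻¹` of `A_ξ = R_ξ + z⁻¹`, with the same generalized eigenspace, and small values correspond to
small values. Riesz theory splits `A_0` into a nilpotent part of finite rank and an invertible part
(`exists_rieszSplitting`).

The splitting is continued without contour integrals: the invariant subspace of a nearby operator is
sought as a graph over the generalized kernel of `A_0`. The linearized invariance equation is `1`
minus a nilpotent map, so the implicit function theorem applies (`exists_slope`), and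
`exists_projection` identifies the graph with the sum of the generalized eigenspaces for small
eigenvalues. The same is done for the adjoints, and an inverse Gram matrix restores the duality
(`exists_dual_family`). At `ξ = 0` the prescribed vectors fit since `∂ⱼU` is in the kernel of `L_0`,
the constants `eⱼ` are in the kernel of its adjoint, and the multiplicity `r + 2` leaves no room for
others (`exists_bases_at_zero`). -/

/-- A splitting of `a` in a ring: `p` is an idempotent commuting with `a`, on which `a` is nilpotent,
and `r` is an inverse of `a` on the complement of `p`. -/
structure RieszSplitting {R : Type*} [Ring R] (a p r : R) : Prop where
  left_inv : r * a = 1 - p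
  right_inv : a * r = 1 - p
  mul_left : p * r = 0
  mul_right : r * p = 0
  nilpotent : IsNilpotent (a * p)

/-! ### Perturbation of a splitting: invariant graphs by the implicit function theorem. -/

namespace RieszSplitting

section Ring

variable {R : Type*} [Ring R] {a p r : R} (h : RieszSplitting a p r)

include h

theorem idem : p * p = p := by
  have : a * (r * p) = (1 - p) * p := by rw [← mul_assoc, h.right_inv]
  rw [h.mul_right, mul_zero, sub_mul, one_mul] at this
  exact (sub_eq_zero.1 this.symm).symm

theorem commute : a * p = p * a := by
  have : a * (r * a) = (a * r) * a := (mul_assoc _ _ _).symm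
  rw [h.left_inv, h.right_inv] at this
  simpa [mul_sub, sub_mul] using this

/-- A solution `s` of the invariance equation for `a'` is the slope of an invariant graph. -/
theorem slope_properties {a' s : R}
    (hs : s + r * ((1 - p - s) * a' * (p + s) * p - a * s * p) = 0) :
    s * p = s ∧ p * s = 0 ∧ (1 - (p + s)) * a' * (p + s) = 0 := by
  -- With `P = p + s`, the equation is the invariance `(1 - P) a' P = 0` composed with `r` and `p`,
  -- plus the correction `s - r a s p`, which vanishes when `s p = s` and `p s = 0`. It thus makes
  -- sense on the whole ring, and its form alone forces these two relations.
  have hs' : s = -(r * ((1 - p - s) * a' * (p + s) * p - a * s * p)) := eq_neg_of_add_eq_zero_left hs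
  have h1 : s * p = s := by
    have e : -(r * ((1 - p - s) * a' * (p + s) * p - a * s * p)) * p
        = -(r * ((1 - p - s) * a' * (p + s) * (p * p) - a * s * (p * p))) := by noncomm_ring
    rw [h.idem, ← hs'] at e
    exact e
  have h2 : p * s = 0 := by
    have e : p * -(r * ((1 - p - s) * a' * (p + s) * p - a * s * p))
        = -((p * r) * ((1 - p - s) * a' * (p + s) * p - a * s * p)) := by noncomm_ring
    rw [h.mul_left, zero_mul, neg_zero, ← hs'] at e
    exact e
  refine ⟨h1, h2, ?_⟩
  have h3 : (p + s) * p = p + s := by rw [add_mul, h.idem, h1]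
  have h4 : r * ((1 - p - s) * a' * (p + s)) = 0 := by
    have e : s + r * ((1 - p - s) * a' * (p + s) * p - a * s * p)
        = s + r * ((1 - p - s) * a' * ((p + s) * p)) - (r * a) * (s * p) := by noncomm_ring
    have e2 : (1 - p) * s = s := by rw [sub_mul, one_mul, h2, sub_zero]
    rw [hs, h3, h1, h.left_inv, e2, add_sub_cancel_left] at e
    exact e.symm
  have h5 : p * ((1 - p - s) * a' * (p + s)) = 0 := by
    have e : p * ((1 - p - s) * a' * (p + s)) = (p - p * p - p * s) * (a' * (p + s)) := by
      noncomm_ring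
    rw [e, h.idem, h2]; simp
  -- Composing with `r` lost only the `p` part, treated in `h5`; the rest is recovered by `a r = 1 -
  -- p`.
  have h6 : (1 - p) * ((1 - p - s) * a' * (p + s)) = 0 := by
    have e : a * r * ((1 - p - s) * a' * (p + s)) = 0 := by rw [mul_assoc a r, h4, mul_zero]
    rwa [h.right_inv] at e
  rw [sub_mul (1 : R), one_mul, h5, sub_zero] at h6
  rwa [← sub_sub]

/-- For `a' = a`, the terms with `r p` drop out and `r a s p` cancels. What remains displays both
the zero at `s = 0` and the linear part; the last term is quadratic in `s`. -/
theorem linearization_eq (s : R) :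
    s + r * ((1 - p - s) * a * (p + s) * p - a * s * p)
      = s - r * s * (a * p) - r * s * a * s * p := by
  have e : s + r * ((1 - p - s) * a * (p + s) * p - a * s * p)
    = s + (r * (a * p) * p) + r * (a * s * p) - (r * p) * a * (p + s) * p
      - r * s * (a * p) * p - r * s * a * s * p - r * a * s * p := by noncomm_ring
  rw [e, h.mul_right, h.commute]
  have e2 : r * (p * a) * p = (r * p) * a * p := by noncomm_ring
  have e3 : r * s * (p * a) * p = r * s * (p * a * p) := by noncomm_ring
  rw [e2, h.mul_right, e3, ← h.commute, mul_assoc a p p, h.idem]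
  noncomm_ring

end Ring

section Banach

variable {R : Type*} [NormedRing R] [NormedAlgebra ℂ R] {a p r : R}

/-- The invariance equation for graphs over the range of `p`. -/
def graphEquation (a p r : R) (u : R × R) : R :=
  u.2 + r * ((1 - p - u.2) * u.1 * (p + u.2) * p - a * u.2 * p)

theorem contDiff_graphEquation (a p r : R) : ContDiff ℂ ω (graphEquation a p r) := by
  unfold graphEquation
  fun_prop

/-- The map `s ↦ r s (a p)`. -/
def sylvester (a p r : R) : R →L[ℂ] R :=
  (ContinuousLinearMap.mul ℂ R r).comp ((ContinuousLinearMap.mul ℂ R).flip (a * p))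

theorem sylvester_apply (s : R) : sylvester a p r s = r * (s * (a * p)) := rfl

/-- The `k`-th power is `s ↦ rᵏ s (a p)ᵏ`, which dies with `(a p)ᵏ`. This makes the linearized
invariance equation invertible with no smallness condition on `r`. -/
theorem isNilpotent_sylvester (h : RieszSplitting a p r) : IsNilpotent (sylvester a p r) := by
  obtain ⟨N, hN⟩ := h.nilpotent
  refine ⟨N, ?_⟩
  have key : ∀ k s, (sylvester a p r ^ k) s = r ^ k * (s * (a * p) ^ k) := by
    intro k
    induction k with
    | zero => intro s; simp
    | succ k ih =>
      intro s
      rw [pow_succ', mul_apply_eq_comp, ih, sylvester_apply, pow_succ' r, pow_succ (a * p)]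
      noncomm_ring
  ext s
  rw [key, hN]; simp

theorem fderiv_graphEquation (h : RieszSplitting a p r) :
    (fderiv ℂ (graphEquation a p r) (a, 0)).comp (.inr ℂ R R) = 1 - sylvester a p r := by
  have h1 : HasFDerivAt (fun s => graphEquation a p r (a, s))
      ((fderiv ℂ (graphEquation a p r) (a, 0)).comp (.inr ℂ R R)) 0 := by
    have := ((contDiff_graphEquation a p r).differentiable (by simp) (a, 0)).hasFDerivAt
    exact HasFDerivAt.comp (0 : R) (g := graphEquation a p r) this (hasFDerivAt_prodMk_right a 0)
  have h2 : HasFDerivAt (fun s : R => graphEquation a p r (a, s)) (1 - sylvester a p r) 0 := by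
    have e : (fun s : R => graphEquation a p r (a, s))
        = fun s => (1 - sylvester a p r) s - (r * s * a) * (s * p) := by
      funext s
      simp only [graphEquation, h.linearization_eq, sub_apply,
        one_apply_eq_self, sylvester_apply]
      noncomm_ring
    rw [e]
    have h3 : HasFDerivAt (fun s : R => (r * s * a) * (s * p)) (0 : R →L[ℂ] R) 0 := by
      have d1 : DifferentiableAt ℂ (fun s : R => r * s * a) 0 := by fun_prop
      have d2 : DifferentiableAt ℂ (fun s : R => s * p) 0 := by fun_prop
      have := d1.hasFDerivAt.mul' d2.hasFDerivAt
      refine this.congr_fderiv ?_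
      ext v
      simp
    have := (1 - sylvester a p r).hasFDerivAt (x := 0).sub h3
    rwa [sub_zero] at this
  exact h1.unique h2

/-- Existence of a smooth family of invariant graphs. -/
theorem exists_slope [CompleteSpace R] (h : RieszSplitting a p r) :
    ∃ S : R → R, ContDiffAt ℂ ω S a ∧ S a = 0 ∧
      ∀ᶠ a' in 𝓝 a, graphEquation a p r (a', S a') = 0 := by
  have cd : ContDiffAt ℂ ω (graphEquation a p r) (a, 0) := (contDiff_graphEquation a p r).contDiffAt
  have hinv : ((fderiv ℂ (graphEquation a p r) (a, 0)).comp (.inr ℂ R R)).IsInvertible := by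
    rw [h.fderiv_graphEquation]
    obtain ⟨u, hu⟩ := h.isNilpotent_sylvester.isUnit_one_sub
    exact ⟨ContinuousLinearEquiv.unitsEquiv ℂ R u, by rw [← hu]; rfl⟩
  have h0 : graphEquation a p r (a, 0) = 0 := by
    have := h.linearization_eq 0
    simpa [graphEquation] using this
  refine ⟨cd.implicitFunction (by simp) hinv, cd.contDiffAt_implicitFunction _ hinv,
    cd.implicitFunction_apply_self _ hinv, ?_⟩
  have := cd.eventually_apply_implicitFunction (by simp) hinv
  rwa [h0] at this

end Banach

end RieszSplitting

/-! ### The invariant graph as a sum of generalized eigenspaces for small eigenvalues. -/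

namespace RieszSplitting

section Spectral

variable {E : Type*} [NormedAddCommGroup E] [NormedSpace ℂ E] {A p r : E →L[ℂ] E}

/-- By induction on `k`, `(B - ν) v` is in the range of `P`. Then `w = v - P v` is killed by `P` and
`p`, and `(1 - P) B w = ν w`. As `r` inverts `(1 - p) A (1 - p)` on the kernel of `p`, this gives
`‖w‖ ≤ 2 ε ‖r‖ ‖w‖`, so `w = 0`. -/
theorem eq_zero_of_small (h : RieszSplitting A p r) {B P : E →L[ℂ] E} {ε : ℝ}
    (hε : ‖r‖ * (2 * ε) < 1) (hP : P * P = P) (hpP : p * P = p) (hinv : (1 - P) * B * P = 0)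
    (hB : ‖(1 - p) * A * (1 - p) - (1 - P) * B * (1 - P)‖ ≤ ε) {ν : ℂ} (hν : ‖ν‖ < ε) (k : ℕ)
    (v : E) (hv : (((B : Module.End ℂ E) - ν • 1) ^ k) v = 0) : P v = v := by
  induction k generalizing v with
  | zero =>
    have : v = 0 := by simpa using hv
    simp [this]
  | succ k ih =>
    have h1 : P (B v - ν • v) = B v - ν • v := ih _ (by
      rw [pow_succ] at hv; simpa using hv)
    set w := v - P v with hw
    have happ : ∀ x, (1 - P) x = x - P x := fun x => by simp
    have hPw : P w = 0 := by
      have := congrArg (fun T : E →L[ℂ] E => T v) hP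
      simp only [mul_apply_eq_comp] at this
      rw [hw, map_sub, this, sub_self]
    have hpw : p w = 0 := by
      have := congrArg (fun T : E →L[ℂ] E => T v) hpP
      simp only [mul_apply_eq_comp] at this
      rw [hw, map_sub, this, sub_self]
    have h2 : B w - P (B w) = ν • w := by
      have := congrArg (fun T : E →L[ℂ] E => T v) hinv
      simp only [mul_apply_eq_comp, happ, zero_apply] at this
      rw [hw, map_sub, map_sub]
      simp only [map_sub, map_smul] at h1
      linear_combination (norm := module) -this - h1
    have h3 : w = r (((1 - p) * A * (1 - p) - (1 - P) * B * (1 - P)) w) + ν • r w := by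
      have e1 := congrArg (fun T : E →L[ℂ] E => T w) h.left_inv
      have e2 := congrArg (fun T : E →L[ℂ] E => T (A w)) h.mul_right
      simp only [mul_apply_eq_comp, sub_apply, one_apply_eq_self, zero_apply] at e1 e2 ⊢
      simp only [hPw, hpw, sub_zero, h2, map_sub, map_smul, e2] at e1 ⊢
      rw [e1]; simp
    have h4 : ‖w‖ ≤ ‖r‖ * (2 * ε) * ‖w‖ := by
      calc ‖w‖ ≤ ‖r (((1 - p) * A * (1 - p) - (1 - P) * B * (1 - P)) w)‖ + ‖ν • r w‖ := by
            conv_lhs => rw [h3]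
            exact norm_add_le _ _
        _ ≤ ‖r‖ * (ε * ‖w‖) + ε * (‖r‖ * ‖w‖) := by
            rw [norm_smul]
            gcongr
            · exact (r.le_opNorm _).trans (by gcongr; exact ContinuousLinearMap.le_of_opNorm_le _ hB w)
            · exact (norm_nonneg _).trans hB
            · exact r.le_opNorm _
        _ = ‖r‖ * (2 * ε) * ‖w‖ := by ring
    have h5 : ‖w‖ = 0 := by nlinarith [norm_nonneg w]
    exact (sub_eq_zero.1 (norm_eq_zero.1 h5)).symm

/-- The range of `P` is finite-dimensional and invariant under `B`, so over `ℂ` it is spanned by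
generalized eigenvectors. Since `P p = P`, the map `p` is injective on this range and carries
eigenvectors of `B` to eigenvectors of `p B P` with the same eigenvalue; the bound on a power of `p
B P` excludes eigenvalues of modulus at least `ε`. -/
theorem mem_iSup_of_pow_lt {p B P : E →L[ℂ] E} [FiniteDimensional ℂ (LinearMap.range (p : E →ₗ[ℂ] E))]
    {ε : ℝ} (hε : 0 < ε) (hP : P * P = P) (hPp : P * p = P)
    (hinv : (1 - P) * B * P = 0) {M : ℕ} (hM : ‖(p * B * P) ^ M‖ < ε ^ M) (v : E) :
    P v ∈ ⨆ ν ∈ Metric.ball (0 : ℂ) ε, Module.End.maxGenEigenspace (B : Module.End ℂ E) ν := by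
  set F : Submodule ℂ E := LinearMap.range (P : E →ₗ[ℂ] E)
  have hPF : ∀ x ∈ F, P x = x := by
    rintro _ ⟨y, rfl⟩
    exact congrArg (fun T : E →L[ℂ] E => T y) hP
  have hF : FiniteDimensional ℂ F := by
    have : F ≤ (LinearMap.range (p : E →ₗ[ℂ] E)).map (P : E →ₗ[ℂ] E) := by
      rintro _ ⟨y, rfl⟩
      exact ⟨p y, ⟨y, rfl⟩, congrArg (fun T : E →L[ℂ] E => T y) hPp⟩
    exact Submodule.finiteDimensional_of_le this
  have hBF : ∀ x ∈ F, (B : Module.End ℂ E) x ∈ F := by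
    intro x hx
    refine ⟨B x, ?_⟩
    have := congrArg (fun T : E →L[ℂ] E => T x) hinv
    simp only [mul_apply_eq_comp, sub_apply, one_apply_eq_self, zero_apply, hPF x hx] at this
    exact (sub_eq_zero.1 this).symm
  have hle : ∀ ν, Module.End.maxGenEigenspace (LinearMap.restrict (B : Module.End ℂ E) hBF) ν ≤
      (⨆ ν ∈ Metric.ball (0 : ℂ) ε, Module.End.maxGenEigenspace (B : Module.End ℂ E) ν).comap
        F.subtype := by
    intro ν
    by_cases hν : ‖ν‖ < ε
    · refine (Module.End.genEigenspace_restrict (B : Module.End ℂ E) F ⊤ ν hBF).le.trans ?_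
      exact Submodule.comap_mono (le_iSup₂_of_le ν (by simpa using hν) le_rfl)
    · have hne : ¬ Module.End.HasEigenvalue (LinearMap.restrict (B : Module.End ℂ E) hBF) ν := by
        intro hev
        obtain ⟨x, hx⟩ := hev.exists_hasEigenvector
        have hBx : B x = ν • (x : E) := congrArg Subtype.val hx.apply_eq_smul
        have hPy : P (p x) = x := (congrArg (fun T : E →L[ℂ] E => T x) hPp).trans (hPF x x.2)
        have hpow : ∀ m : ℕ, ((p * B * P) ^ m) (p x) = ν ^ m • p x := by
          intro m
          induction m with
          | zero => simp
          | succ m ih =>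
            rw [pow_succ, mul_apply_eq_comp, mul_apply_eq_comp, mul_apply_eq_comp, hPy, hBx,
              map_smul, map_smul, ih, smul_smul, pow_succ']
        have hpx : p x ≠ 0 := by
          intro h0
          rw [h0, map_zero] at hPy
          exact hx.2 (Subtype.ext hPy.symm)
        have h1 := ((p * B * P) ^ M).le_opNorm (p x)
        rw [hpow, norm_smul, norm_pow] at h1
        have h2 := le_of_mul_le_mul_right h1 (norm_pos_iff.2 hpx)
        have h3 : ε ^ M ≤ ‖ν‖ ^ M := pow_le_pow_left₀ hε.le (not_lt.1 hν) M
        linarith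
      have hbot : Module.End.maxGenEigenspace (LinearMap.restrict (B : Module.End ℂ E) hBF) ν = ⊥ := by
        by_contra hcon
        exact hne (Module.End.HasUnifEigenvalue.lt (k := ⊤) one_pos hcon)
      rw [hbot]; exact bot_le
  have htop := Module.End.iSup_maxGenEigenspace_eq_top (LinearMap.restrict (B : Module.End ℂ E) hBF)
  have : (⟨P v, v, rfl⟩ : F) ∈ (⊤ : Submodule ℂ F) := trivial
  rw [← htop] at this
  exact iSup_le hle this

/-- Analytic dependence of the spectral subspace of an operator for its small eigenvalues. -/
theorem exists_projection [CompleteSpace E] (h : RieszSplitting A p r)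
    [FiniteDimensional ℂ (LinearMap.range (p : E →ₗ[ℂ] E))] :
    ∃ P : (E →L[ℂ] E) → (E →L[ℂ] E), ContDiffAt ℂ ω P A ∧ P A = p ∧
      ∃ ε₁ > 0, ∀ ε₂ > 0, ∀ᶠ B in 𝓝 A, P B * p = P B ∧
        (∀ ν : ℂ, ‖ν‖ < ε₁ → ∀ v ∈ Module.End.maxGenEigenspace (B : Module.End ℂ E) ν, P B v = v) ∧
        ∀ v, P B v ∈ ⨆ ν ∈ Metric.ball (0 : ℂ) ε₂,
          Module.End.maxGenEigenspace (B : Module.End ℂ E) ν := by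
  obtain ⟨S, hS, hS0, hSeq⟩ := h.exists_slope
  have hP0 : p + S A = p := by rw [hS0, add_zero]
  have hc : ContinuousAt (fun B => p + S B) A := continuousAt_const.add hS.continuousAt
  -- The map `p + S B` is the projection onto the graph along the kernel of `p`, in general not the
  -- spectral projection; only its range matters. The radius `ε₁` depends on `r` alone, hence is
  -- fixed before `ε₂`.
  refine ⟨fun B => p + S B, contDiffAt_const.add hS, hP0, 1 / (2 * (‖r‖ + 1)), by positivity,
    fun ε₂ hε₂ => ?_⟩
  obtain ⟨M, hM⟩ := h.nilpotent
  have hε : ‖r‖ * (2 * (1 / (2 * (‖r‖ + 1)))) < 1 := by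
    have : ‖r‖ * (2 * (1 / (2 * (‖r‖ + 1)))) = ‖r‖ / (‖r‖ + 1) := by field_simp
    rw [this, div_lt_one (by positivity)]; linarith
  have c1 : ContinuousAt (fun B => ‖(1 - p) * A * (1 - p) - (1 - (p + S B)) * B * (1 - (p + S B))‖) A := by
    fun_prop
  have c2 : ContinuousAt (fun B => ‖(p * B * (p + S B)) ^ (M + 1)‖) A := by fun_prop
  have l1 := c1.eventually_lt continuousAt_const
    (show ‖(1 - p) * A * (1 - p) - (1 - (p + S A)) * A * (1 - (p + S A))‖ < 1 / (2 * (‖r‖ + 1)) by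
      rw [hP0, sub_self, norm_zero]; positivity)
  have l2 := c2.eventually_lt continuousAt_const
    (show ‖(p * A * (p + S A)) ^ (M + 1)‖ < ε₂ ^ (M + 1) by
      rw [hP0, ← h.commute, mul_assoc, h.idem, pow_succ, hM, zero_mul, norm_zero]; positivity)
  filter_upwards [hSeq, l1, l2] with B hB hB1 hB2
  obtain ⟨e1, e2, e3⟩ := h.slope_properties hB
  have hPp : (p + S B) * p = p + S B := by rw [add_mul, h.idem, e1]
  have hpP : p * (p + S B) = p := by rw [mul_add, h.idem, e2, add_zero]
  have hPP : (p + S B) * (p + S B) = p + S B := by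
    calc (p + S B) * (p + S B) = (p + S B) * p * (p + S B) := by rw [hPp]
      _ = p + S B := by rw [mul_assoc, hpP, hPp]
  refine ⟨hPp, fun ν hν v hv => ?_, fun v => mem_iSup_of_pow_lt hε₂ hPP hPp e3 hB2 v⟩
  obtain ⟨k, hk⟩ := (Module.End.mem_maxGenEigenspace _ _ _).1 hv
  exact h.eq_zero_of_small hε hPP hpP e3 hB1.le hν k v hk

end Spectral

end RieszSplitting

/-! ### From an unbounded operator to its resolvent: generalized eigenspaces. -/

section Resolvent

variable {E : Type*} [NormedAddCommGroup E] [NormedSpace ℂ E]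

/-- `R` is the resolvent `(T - z)⁻¹` of the unbounded operator `T`. -/
def IsResolvent (T : E →ₗ.[ℂ] E) (z : ℂ) (R : E →L[ℂ] E) : Prop :=
  ∀ v w, (v, w) ∈ T.graph ↔ R (w - z • v) = v

variable {T : E →ₗ.[ℂ] E} {z : ℂ} {R : E →L[ℂ] E}

theorem mem_kerPow_succ {l : ℂ} {p : ℕ} {v : E} :
    v ∈ kerPow T l (p + 1) ↔ ∃ w, (v, w) ∈ T.graph ∧ w - l • v ∈ kerPow T l p := by
  constructor
  · rintro ⟨u, hu, rfl⟩
    exact ⟨T u, T.mem_graph u, hu⟩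
  · rintro ⟨w, hw, hw'⟩
    obtain ⟨u, rfl, rfl⟩ := (LinearPMap.mem_graph_iff _).1 hw
    exact ⟨u, hw', rfl⟩

/-- `R` is `μ` plus a nilpotent map on the generalized eigenspace, hence onto there. If `R w = (R -
μ) u`, then `u = R (μ⁻¹ (u - w))`. -/
theorem exists_preimage_of_pow_eq_zero (R : Module.End ℂ E) {μ : ℂ} (hμ : μ ≠ 0) (p : ℕ) (u : E)
    (hu : ((R - μ • 1) ^ p) u = 0) : ∃ w, R w = u ∧ ((R - μ • 1) ^ p) w = 0 := by
  induction p generalizing u with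
  | zero => exact ⟨0, by simpa [eq_comm] using hu, by simp⟩
  | succ p ih =>
    obtain ⟨w, hw, hw'⟩ := ih ((R - μ • 1) u) (by rwa [pow_succ] at hu)
    refine ⟨μ⁻¹ • (u - w), ?_, ?_⟩
    · rw [map_smul, map_sub, hw, LinearMap.sub_apply, LinearMap.smul_apply, Module.End.one_apply,
        sub_sub_cancel, smul_smul, inv_mul_cancel₀ hμ, one_smul]
    · rw [map_smul, map_sub, hu, pow_succ', Module.End.mul_apply, hw', map_zero]
      simp

/-- On the domain, `(R - (l - z)⁻¹) v = -(l - z)⁻¹ R (T - l) v`, and `R` commutes with its own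
polynomials. In the converse direction membership in the domain has to be produced, by writing the
vector as a value of `R` within the same kernel. -/
theorem IsResolvent.mem_kerPow (h : IsResolvent T z R) {l : ℂ} (hl : l ≠ z) (p : ℕ) (v : E) :
    v ∈ kerPow T l p ↔ (((R : Module.End ℂ E) - (l - z)⁻¹ • 1) ^ p) v = 0 := by
  have hlz : l - z ≠ 0 := sub_ne_zero.2 hl
  induction p generalizing v with
  | zero => simp [kerPow]
  | succ p ih =>
    rw [mem_kerPow_succ, pow_succ]
    constructor
    · rintro ⟨w, hw, hw'⟩
      replace hw' := (ih _).1 hw'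
      rw [h] at hw
      have e : ((R : Module.End ℂ E) - (l - z)⁻¹ • 1) v
          = -((l - z)⁻¹ • (R : Module.End ℂ E) (w - l • v)) := by
        have : (R : Module.End ℂ E) (w - l • v) = v - (l - z) • R v := by
          have e : w - l • v = (w - z • v) - (l - z) • v := by module
          rw [e, ContinuousLinearMap.coe_coe, map_sub, map_smul, hw]
        rw [this, LinearMap.sub_apply, smul_sub, smul_smul, inv_mul_cancel₀ hlz]
        simp
      rw [Module.End.mul_apply, e, map_neg, map_smul]
      have hc : Commute (((R : Module.End ℂ E) - (l - z)⁻¹ • 1) ^ p) (R : Module.End ℂ E) := by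
        refine Commute.pow_left ?_ p
        exact ((Commute.refl _).sub_left ((Commute.one_left _).smul_left _))
      have := congrArg (fun T : Module.End ℂ E => T (w - l • v)) hc.eq
      simp only [Module.End.mul_apply] at this
      rw [this, hw']
      simp
    · intro hv
      obtain ⟨w, hw, hw'⟩ := exists_preimage_of_pow_eq_zero (R : Module.End ℂ E)
        (inv_ne_zero hlz) p _ hv
      refine ⟨-((l - z) • w) + l • v, ?_, ?_⟩
      · rw [h]
        have : -((l - z) • w) + l • v - z • v = -((l - z) • w) + (l - z) • v := by module
        simp only [ContinuousLinearMap.coe_coe] at hw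
        rw [this, map_add, map_neg, map_smul, map_smul, hw, LinearMap.sub_apply, smul_sub,
          LinearMap.smul_apply, Module.End.one_apply, smul_smul, mul_inv_cancel₀ hlz, one_smul]
        simp
      · refine (ih _).2 ?_
        rw [add_sub_cancel_right, map_neg, map_smul, hw', smul_zero, neg_zero]

theorem IsResolvent.genEigenspace_eq (h : IsResolvent T z R) {l : ℂ} (hl : l ≠ z) :
    genEigenspace T l = Module.End.maxGenEigenspace (R : Module.End ℂ E) (l - z)⁻¹ := by
  rw [genEigenspace, ← Module.End.iSup_genEigenspace_eq]
  refine iSup_congr fun p => ?_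
  ext v
  rw [h.mem_kerPow hl, Module.End.mem_genEigenspace_nat, LinearMap.mem_ker]

theorem maxGenEigenspace_add_smul_one (f : Module.End ℂ E) (c μ : ℂ) :
    Module.End.maxGenEigenspace (f + c • 1) (μ + c) = Module.End.maxGenEigenspace f μ := by
  ext v
  rw [Module.End.mem_maxGenEigenspace, Module.End.mem_maxGenEigenspace]
  have : f + c • 1 - (μ + c) • 1 = f - μ • 1 := by rw [add_smul]; abel
  rw [this]

/-- Vectors of the sum of the generalized eigenspaces are in the domain, and this sum is
invariant. -/
theorem exists_graph_of_mem_criticalSpace {δ : ℝ} {v : E} (hv : v ∈ criticalSpace T δ) :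
    ∃ w ∈ criticalSpace T δ, (v, w) ∈ T.graph := by
  have hle : criticalSpace T δ ≤
      ((criticalSpace T δ).comap T.toFun).map T.domain.subtype := by
    refine iSup₂_le fun l hl => iSup_le fun p => ?_
    have hp : ∀ p, kerPow T l p ≤ criticalSpace T δ := fun p =>
      (le_iSup (kerPow T l) p).trans (le_iSup₂_of_le (f := fun z _ => genEigenspace T z) l hl le_rfl)
    cases p with
    | zero => exact bot_le
    | succ p =>
      intro v hv
      have hv' := hp _ hv
      obtain ⟨u, hu, rfl⟩ := hv
      refine ⟨u, ?_, rfl⟩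
      have e : T.toFun u = (T.toFun - l • T.domain.subtype) u + l • (u : E) := by simp
      change T.toFun u ∈ criticalSpace T δ
      rw [e]
      exact add_mem (hp _ hu) (Submodule.smul_mem _ _ hv')
  obtain ⟨u, hu, rfl⟩ := hle hv
  exact ⟨_, hu, T.mem_graph u⟩

theorem applyOp_of_mem_graph {v w : E} (h : (v, w) ∈ T.graph) : applyOp T v = w := by
  obtain ⟨u, rfl, rfl⟩ := (LinearPMap.mem_graph_iff _).1 h
  simp [applyOp]

/-- Identification of the sum of the generalized eigenspaces near zero with the range of a
projection. -/
theorem IsResolvent.criticalSpace_eq_range {z : ℝ} (hz : 0 < z) (h : IsResolvent T z R)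
    {P : E →L[ℂ] E} {ε₁ ε₂ δ : ℝ}
    (h1 : ∀ ν : ℂ, ‖ν‖ < ε₁ → ∀ v ∈ Module.End.maxGenEigenspace
      ((R + (z : ℂ)⁻¹ • 1 : E →L[ℂ] E) : Module.End ℂ E) ν, P v = v)
    (h2 : ∀ v, P v ∈ ⨆ ν ∈ Metric.ball (0 : ℂ) ε₂, Module.End.maxGenEigenspace
      ((R + (z : ℂ)⁻¹ • 1 : E →L[ℂ] E) : Module.End ℂ E) ν)
    (hδz : δ ≤ z / 2) (hδε : 2 * δ ≤ ε₁ * z ^ 2) (hε : ε₂ ≤ 1 / (2 * z)) (hε2 : 2 * z ^ 2 * ε₂ ≤ δ) :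
    criticalSpace T δ = LinearMap.range (P : E →ₗ[ℂ] E) := by
  have hzc : (z : ℂ) ≠ 0 := by exact_mod_cast hz.ne'
  have hcoe : ((R + (z : ℂ)⁻¹ • 1 : E →L[ℂ] E) : Module.End ℂ E)
      = (R : Module.End ℂ E) + (z : ℂ)⁻¹ • 1 := rfl
  rw [hcoe] at h1 h2
  apply le_antisymm
  · refine iSup₂_le fun l hl => ?_
    rw [mem_ball_zero_iff] at hl
    have hlz : z / 2 ≤ ‖l - z‖ := by
      have := norm_sub_norm_le (z : ℂ) l
      rw [norm_sub_rev, Complex.norm_real, Real.norm_of_nonneg hz.le] at this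
      linarith
    have hne : l - z ≠ 0 := norm_pos_iff.1 (by linarith)
    rw [h.genEigenspace_eq (sub_ne_zero.1 hne), ← maxGenEigenspace_add_smul_one _ (z : ℂ)⁻¹]
    intro v hv
    refine ⟨v, h1 _ ?_ v hv⟩
    -- The eigenvalues correspond by a Möbius map fixing `0`. With `|l| < δ ≤ z / 2` the denominator
    -- is at least `z² / 2`, whence the requirement `2 δ ≤ ε₁ z²`.
    have : (l - z)⁻¹ + (z : ℂ)⁻¹ = l / ((l - z) * z) := by field_simp; ring
    rw [this, norm_div, norm_mul, Complex.norm_real, Real.norm_of_nonneg hz.le,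
      div_lt_iff₀ (by positivity)]
    have hε1 : 0 < ε₁ := by
      by_contra hcon
      have := norm_nonneg l
      nlinarith [sq_nonneg z]
    calc ‖l‖ < δ := hl
      _ ≤ ε₁ * (z / 2 * z) := by nlinarith
      _ ≤ ε₁ * (‖l - z‖ * z) := by gcongr
  · rintro _ ⟨v, rfl⟩
    refine (iSup₂_le fun ν hν => ?_ : _ ≤ criticalSpace T δ) (h2 v)
    rw [mem_ball_zero_iff] at hν
    have hzν : ‖(z : ℂ) * ν‖ < 1 / 2 := by
      rw [norm_mul, Complex.norm_real, Real.norm_of_nonneg hz.le]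
      calc z * ‖ν‖ < z * (1 / (2 * z)) := by gcongr; linarith
        _ = 1 / 2 := by field_simp
    have hd : 1 / 2 ≤ ‖(z : ℂ) * ν - 1‖ := by
      have := norm_sub_norm_le (1 : ℂ) (z * ν)
      rw [norm_sub_rev, norm_one] at this
      linarith
    have hne : (z : ℂ) * ν - 1 ≠ 0 := norm_pos_iff.1 (by linarith)
    -- The inverse Möbius map; `ε₂ ≤ 1 / (2 z)` keeps `ν` away from its pole `1 / z`.
    set l : ℂ := z ^ 2 * ν / (z * ν - 1) with hl
    have hlz : l - z = z / (z * ν - 1) := by rw [hl]; field_simp; ring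
    have hlne : l - z ≠ 0 := by rw [hlz]; exact div_ne_zero hzc hne
    have hν' : ν = (l - z)⁻¹ + (z : ℂ)⁻¹ := by rw [hlz]; field_simp; ring
    have hlδ : l ∈ Metric.ball (0 : ℂ) δ := by
      rw [mem_ball_zero_iff, hl, norm_div, div_lt_iff₀ (by linarith), norm_mul, norm_pow,
        Complex.norm_real, Real.norm_of_nonneg hz.le]
      have hδ : 0 < δ := by
        have : 0 < ε₂ := (norm_nonneg _).trans_lt hν
        nlinarith [sq_nonneg z, mul_pos (pow_pos hz 2) this]
      calc z ^ 2 * ‖ν‖ < z ^ 2 * ε₂ := by gcongr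
        _ ≤ δ * (1 / 2) := by linarith
        _ ≤ δ * ‖(z : ℂ) * ν - 1‖ := by gcongr
    rw [hν', maxGenEigenspace_add_smul_one, ← h.genEigenspace_eq (sub_ne_zero.1 hlne)]
    exact le_iSup₂_of_le (f := fun z _ => genEigenspace T z) l hlδ le_rfl

end Resolvent

/-! ### Resolvents and splittings of adjoints. -/

section Adjoint

variable {E : Type*} [NormedAddCommGroup E] [InnerProductSpace ℂ E] [CompleteSpace E]
  {T : E →ₗ.[ℂ] E} {R : E →L[ℂ] E}

/-- The graph of `T` is parametrized by `y ↦ (R y, y + z R y)`, which turns the relation defining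
the adjoint into an identity for all `y`. The point `z` is real, so no conjugate appears. -/
theorem IsResolvent.adjoint {z : ℝ} (h : IsResolvent T z R) (hT : Dense (T.domain : Set E)) :
    IsResolvent T.adjoint z (star R) := by
  intro v w
  have h1 : (v, w) ∈ T.adjoint.graph ↔ ∀ x : T.domain, inner ℂ w (x : E) = inner ℂ v (T x) := by
    constructor
    · intro hv
      obtain ⟨u, rfl, rfl⟩ := (LinearPMap.mem_graph_iff _).1 hv
      exact fun x => T.adjoint_isFormalAdjoint hT u x
    · intro hv
      have hmem := T.mem_adjoint_domain_of_exists v ⟨w, hv⟩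
      rw [LinearPMap.mem_graph_iff]
      exact ⟨⟨v, hmem⟩, rfl, LinearPMap.adjoint_apply_eq hT _ hv⟩
  rw [h1]
  have h2 : (∀ x : T.domain, inner ℂ w (x : E) = inner ℂ v (T x)) ↔
      ∀ y : E, inner ℂ w (R y) = inner ℂ v (y + (z : ℂ) • R y) := by
    constructor
    · intro hx y
      have : (R y, y + (z : ℂ) • R y) ∈ T.graph := by rw [h, add_sub_cancel_right]
      obtain ⟨u, hu, hu'⟩ := (LinearPMap.mem_graph_iff _).1 this
      have hu2 := hx u
      rwa [hu, hu'] at hu2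
    · intro hy x
      have := (h _ _).1 (T.mem_graph x)
      have hx := hy (T x - (z : ℂ) • (x : E))
      rwa [this, sub_add_cancel] at hx
  rw [h2]
  have h3 : ∀ y : E, inner ℂ (star R (w - (z : ℂ) • v)) y
      = inner ℂ w (R y) - (z : ℂ) * inner ℂ v (R y) := by
    intro y
    rw [ContinuousLinearMap.star_eq_adjoint, ContinuousLinearMap.adjoint_inner_left,
      inner_sub_left, inner_smul_left, Complex.conj_ofReal]
  constructor
  · intro hy
    refine ext_inner_right ℂ fun y => ?_
    rw [h3, hy, inner_add_right, inner_smul_right]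
    ring
  · intro hv y
    have := h3 y
    rw [hv] at this
    rw [inner_add_right, inner_smul_right, this]
    ring

theorem RieszSplitting.star {R : Type*} [Ring R] [StarRing R] {a p r : R} (h : RieszSplitting a p r) :
    RieszSplitting (star a) (star p) (star r) where
  left_inv := by rw [← star_mul, h.right_inv, star_sub, star_one]
  right_inv := by rw [← star_mul, h.left_inv, star_sub, star_one]
  mul_left := by rw [← star_mul, h.mul_right, star_zero]
  mul_right := by rw [← star_mul, h.mul_left, star_zero]
  nilpotent := by
    rw [← star_mul, ← h.commute]
    obtain ⟨N, hN⟩ := h.nilpotent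
    exact ⟨N, by rw [← star_pow, hN, star_zero]⟩

end Adjoint

/-! ### Riesz theory for compact perturbations of a nonzero scalar. -/

section Riesz

variable {E : Type*} [NormedAddCommGroup E] [InnerProductSpace ℂ E]

/-- Fredholm alternative: an injective compact perturbation of a nonzero scalar is invertible. -/
theorem isUnit_of_compact [CompleteSpace E] {K : E →L[ℂ] E} (hK : IsCompactOperator K) {c : ℂ} (hc : c ≠ 0)
    (hinj : ∀ v, c • v + K v = 0 → v = 0) : IsUnit (c • 1 + K : E →L[ℂ] E) := by
  rcases hK.hasEigenvalue_or_mem_resolventSet (neg_ne_zero.2 hc) with h | h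
  · obtain ⟨x, hx⟩ := h.exists_hasEigenvector
    refine absurd (hinj x ?_) hx.2
    have := hx.apply_eq_smul
    rw [ContinuousLinearMap.coe_coe] at this
    rw [this]; simp
  · rw [spectrum.mem_resolventSet_iff, ← IsUnit.neg_iff] at h
    convert h using 1
    rw [Algebra.algebraMap_eq_smul_one]
    module

theorem exists_pow_eq_smul_add_compact {K : E →L[ℂ] E} (hK : IsCompactOperator K) (c : ℂ) (N : ℕ) :
    ∃ L : E →L[ℂ] E, IsCompactOperator L ∧ (c • 1 + K) ^ N = c ^ N • 1 + L := by
  induction N with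
  | zero => exact ⟨0, isCompactOperator_zero, by simp⟩
  | succ N ih =>
    obtain ⟨L, hL, hN⟩ := ih
    refine ⟨c • L + K * (c ^ N • 1 + L), (hL.smul c).add (hK.comp_clm _), ?_⟩
    rw [pow_succ', hN, pow_succ']
    simp only [add_mul, mul_add, smul_mul_assoc, one_mul, mul_smul_comm, mul_one, smul_smul,
      smul_add, mul_comm (c ^ N) c]
    abel

theorem isCompactOperator_of_finiteDimensional_range {K : E →L[ℂ] E}
    [FiniteDimensional ℂ (LinearMap.range (K : E →ₗ[ℂ] E))] : IsCompactOperator K := by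
  let K' := K.codRestrict (LinearMap.range (K : E →ₗ[ℂ] E)) fun v => ⟨v, rfl⟩
  have := FiniteDimensional.proper ℂ (LinearMap.range (K : E →ₗ[ℂ] E))
  have : IsCompactOperator K' := isCompactOperator_of_locallyCompactSpace_dom K'
  exact this.clm_comp (LinearMap.range (K : E →ₗ[ℂ] E)).subtypeL

/-- Riesz theory: a nonzero scalar plus a compact operator splits, as soon as its generalized
kernel is finite-dimensional. -/
theorem exists_rieszSplitting [CompleteSpace E] {K : E →L[ℂ] E} (hK : IsCompactOperator K) {c : ℂ} (hc : c ≠ 0)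
    (hfin : FiniteDimensional ℂ
      (Module.End.maxGenEigenspace ((c • 1 + K : E →L[ℂ] E) : Module.End ℂ E) 0)) :
    ∃ p r : E →L[ℂ] E, RieszSplitting (c • 1 + K) p r ∧ LinearMap.range (p : E →ₗ[ℂ] E)
      = Module.End.maxGenEigenspace ((c • 1 + K : E →L[ℂ] E) : Module.End ℂ E) 0 := by
  set A : E →L[ℂ] E := c • 1 + K with hA
  set X := Module.End.maxGenEigenspace (A : Module.End ℂ E) 0 with hX
  have hmem : ∀ v, v ∈ X ↔ ∃ k, (A ^ k) v = 0 := by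
    intro v
    rw [hX, Module.End.mem_maxGenEigenspace]
    simp only [zero_smul, sub_zero, Module.End.pow_apply, FunLike.coe_pow_eq_iterate,
      ContinuousLinearMap.coe_coe]
  have hmono : ∀ {v : E} {k : ℕ} (m : ℕ), k ≤ m → (A ^ k) v = 0 → (A ^ m) v = 0 := by
    intro v k m hkm hv
    rw [← Nat.sub_add_cancel hkm, pow_add, mul_apply_eq_comp, hv, map_zero]
  -- Each generator of the finite-dimensional space `X` is killed by some power, so one power kills
  -- all of `X`.
  obtain ⟨N, hN⟩ : ∃ N, ∀ v ∈ X, (A ^ N) v = 0 := by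
    obtain ⟨s, hs⟩ := (Module.Finite.iff_fg (N := X)).1 hfin
    have hk : ∀ v ∈ s, ∃ k, (A ^ k) v = 0 := fun v hv =>
      (hmem v).1 (hs ▸ Submodule.subset_span hv)
    choose! k hk using hk
    refine ⟨s.sup k, fun v hv => ?_⟩
    have hle : Submodule.span ℂ (s : Set E) ≤ LinearMap.ker ((A ^ s.sup k : E →L[ℂ] E) : E →ₗ[ℂ] E) :=
      Submodule.span_le.2 fun v hv => hmono _ (Finset.le_sup hv) (hk v hv)
    exact hle (hs ▸ hv)
  obtain ⟨L, hL, hAL⟩ := exists_pow_eq_smul_add_compact hK c N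
  rw [← hA] at hAL
  set q : E →L[ℂ] E := X.starProjection with hq
  have hqX : ∀ v, q v ∈ X := fun v => X.starProjection_apply_mem v
  have hqv : ∀ v ∈ X, q v = v := fun v hv => Submodule.starProjection_eq_self_iff.2 hv
  have hqc : IsCompactOperator q := by
    have : FiniteDimensional ℂ (LinearMap.range (q : E →ₗ[ℂ] E)) :=
      Submodule.finiteDimensional_of_le (S₂ := X) (by rintro _ ⟨v, rfl⟩; exact hqX v)
    exact isCompactOperator_of_finiteDimensional_range
  -- By the Fredholm alternative only injectivity is needed. If `A^N v = -q v`, then `A^N v` lies in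
  -- `X`, hence so does `v`; then `A^N v = 0` and `v = q v = 0`.
  have hunit : IsUnit (A ^ N + q) := by
    rw [hAL, add_assoc]
    refine isUnit_of_compact (hL.add hqc) (pow_ne_zero _ hc) fun v hv => ?_
    have hv' : (A ^ N) v + q v = 0 := by
      rw [hAL, ← hv]; simp [add_assoc]
    have h1 : (A ^ N) v ∈ X := by
      rw [eq_neg_of_add_eq_zero_left hv']; exact neg_mem (hqX v)
    have h2 : v ∈ X := (hmem v).2 ⟨N + N, by rw [pow_add, mul_apply_eq_comp]; exact hN _ h1⟩
    rwa [hN v h2, zero_add, hqv v h2] at hv'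
  obtain ⟨g, hg1, hg2⟩ := isUnit_iff_exists.1 hunit
  have hANq : A ^ N * q = 0 := by ext v; exact hN _ (hqX v)
  have hqq : q * q = q := by ext v; exact hqv _ (hqX v)
  have hgq : g * q = q := by
    have : g * ((A ^ N + q) * q) = q := by rw [← mul_assoc, hg2, one_mul]
    rwa [add_mul, hANq, zero_add, hqq] at this
  have hpq : (q * g) * q = q := by rw [mul_assoc, hgq, hqq]
  -- The orthogonal projection `q` need not commute with `A`. With `g` the inverse of `A^N + q`, the
  -- product `q g` is the projection onto `X` along the range of `A^N`, which does.
  set p := q * g with hp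
  have hqp : q * p = p := by rw [hp, ← mul_assoc, hqq]
  have hpp : p * p = p := by
    calc p * p = (q * g * q) * g := by rw [hp]; noncomm_ring
      _ = p := by rw [hpq]
  have hpA : p * A ^ N = 0 := by
    have : g * (A ^ N) = 1 - q := by
      rw [mul_add, hgq] at hg2
      exact eq_sub_of_add_eq hg2
    rw [hp, mul_assoc, this, mul_sub, mul_one, hqq, sub_self]
  have hANp : A ^ N * p = 0 := by rw [← hqp, ← mul_assoc, hANq, zero_mul]
  have hdec : ∀ v, v = (A ^ N) (g v) + p v := by
    intro v
    exact (congrArg (fun T : E →L[ℂ] E => T v) hg1).symm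
  have hpX : ∀ v, p v ∈ X := fun v => hqX _
  have hpv : ∀ v ∈ X, p v = v := by
    intro v hv
    have := congrArg (fun T : E →L[ℂ] E => T v) hpq
    simpa [hqv v hv] using this
  have hAX : ∀ v ∈ X, A v ∈ X := by
    intro v hv
    obtain ⟨k, hk⟩ := (hmem v).1 hv
    exact (hmem _).2 ⟨k, by rw [← mul_apply_eq_comp, ← pow_succ, pow_succ', mul_apply_eq_comp, hk,
      map_zero]⟩
  have hcomm : A * p = p * A := by
    ext v
    have h1 : p (A ((A ^ N) (g v))) = 0 := by
      rw [← mul_apply_eq_comp A, ← pow_succ', pow_succ, mul_apply_eq_comp]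
      exact congrArg (fun T : E →L[ℂ] E => T (A (g v))) hpA
    change A (p v) = p (A v)
    conv_rhs => rw [hdec v, map_add, map_add, h1, zero_add, hpv _ (hAX _ (hpX v))]
  have hpc : IsCompactOperator p := hqc.comp_clm g
  have hunit2 : IsUnit (A + p) := by
    rw [hA, add_assoc]
    refine isUnit_of_compact (hK.add hpc) hc fun v hv => ?_
    have hv' : A v + p v = 0 := by rw [← hv, hA]; simp [add_assoc]
    have h1 : A v ∈ X := by rw [eq_neg_of_add_eq_zero_left hv']; exact neg_mem (hpX v)
    have h2 : v ∈ X := by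
      obtain ⟨k, hk⟩ := (hmem _).1 h1
      exact (hmem v).2 ⟨k + 1, by rw [pow_succ, mul_apply_eq_comp, hk]⟩
    rw [hpv v h2] at hv'
    -- On `X` the equation reads `A v = -v`, which is incompatible with the nilpotency of `A` there
    -- unless `v = 0`.
    have h3 : ∀ k : ℕ, (A ^ k) v = (-1 : ℂ) ^ k • v := by
      intro k
      induction k with
      | zero => simp
      | succ k ih =>
        rw [pow_succ', mul_apply_eq_comp, ih, map_smul, eq_neg_of_add_eq_zero_left hv', pow_succ]
        module
    have h4 := h3 N
    rw [hN v h2] at h4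
    exact (smul_eq_zero.1 h4.symm).resolve_left (pow_ne_zero _ (by norm_num))
  obtain ⟨s, hs1, hs2⟩ := isUnit_iff_exists.1 hunit2
  have hsp : s * p = p * s := by
    calc s * p = s * (p * ((A + p) * s)) := by rw [hs1, mul_one]
      _ = s * ((p * A + p * p) * s) := by noncomm_ring
      _ = s * ((A * p + p * p) * s) := by rw [hcomm]
      _ = (s * (A + p)) * (p * s) := by noncomm_ring
      _ = p * s := by rw [hs2, one_mul]
  have hp1 : p * (1 - p) = 0 := by rw [mul_sub, mul_one, hpp, sub_self]
  have hp2 : (1 - p) * p = 0 := by rw [sub_mul, one_mul, hpp, sub_self]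
  -- The partial inverse is that of `A + p`, cut off on the range of `p`. The exponent `N + 1`
  -- leaves a factor `p` for `A^N` to annihilate even when `N = 0`.
  refine ⟨p, s * (1 - p), ⟨?_, ?_, ?_, ?_, N + 1, ?_⟩, ?_⟩
  · calc s * (1 - p) * A = s * (A - p * A) := by noncomm_ring
      _ = s * (A - A * p) := by rw [hcomm]
      _ = s * (A + p) * (1 - p) - s * (p * (1 - p)) := by noncomm_ring
      _ = 1 - p := by rw [hs2, hp1]; simp
  · calc A * (s * (1 - p)) = (A + p) * s * (1 - p) - (p * s) * (1 - p) := by noncomm_ring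
      _ = 1 - p := by rw [hs1, ← hsp, mul_assoc s p, hp1]; simp
  · rw [← mul_assoc, ← hsp, mul_assoc, hp1, mul_zero]
  · rw [mul_assoc, hp2, mul_zero]
  · rw [Commute.mul_pow hcomm, pow_succ, pow_succ' p]
    calc A ^ N * A * (p * p ^ N) = A ^ N * (A * p) * p ^ N := by noncomm_ring
      _ = (A ^ N * p) * A * p ^ N := by rw [hcomm]; noncomm_ring
      _ = 0 := by rw [hANp]; simp
  · apply le_antisymm
    · rintro _ ⟨v, rfl⟩; exact hpX v
    · exact fun v hv => ⟨v, hpv v hv⟩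

end Riesz

open Filter UnitAddTorus

/-! ### Diagonal operators in a Hilbert basis. -/

section Diagonal

variable {ι E : Type*} [NormedAddCommGroup E] [InnerProductSpace ℂ E]
  (b : HilbertBasis ι ℂ E) {m : ι → ℂ} {C : ℝ}

open scoped Classical in
/-- The diagonal operator with bounded symbol `m` in a Hilbert basis (zero if `m` is unbounded). -/
def diagOp (m : ι → ℂ) : E →L[ℂ] E :=
  if h : ∃ C, 0 ≤ C ∧ ∀ i, ‖m i‖ ≤ C then
    (b.repr.symm : lp (fun _ : ι => ℂ) 2 →L[ℂ] E) ∘L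
      (lp.mapCLM 2 (fun i => m i • ContinuousLinearMap.id ℂ ℂ) (K := h.choose) h.choose_spec.1
        (fun i => by
          rw [norm_smul, ContinuousLinearMap.norm_id, mul_one]
          exact h.choose_spec.2 i) ) ∘L (b.repr : E →L[ℂ] lp (fun _ : ι => ℂ) 2)
  else 0

theorem repr_ext {v w : E} (h : ∀ i, b.repr v i = b.repr w i) : v = w :=
  b.repr.injective (lp.ext (funext h))

theorem repr_diagOp (hm : ∀ i, ‖m i‖ ≤ C) (v : E) (i : ι) :
    b.repr (diagOp b m v) i = m i * b.repr v i := by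
  have h : ∃ C, 0 ≤ C ∧ ∀ i, ‖m i‖ ≤ C := ⟨C, (norm_nonneg _).trans (hm i), hm⟩
  rw [diagOp, dif_pos h]
  simp

theorem norm_le_of_repr_le (hC : 0 ≤ C) {v w : E} (h : ∀ i, ‖b.repr v i‖ ≤ C * ‖b.repr w i‖) :
    ‖v‖ ≤ C * ‖w‖ := by
  rw [← b.repr.norm_map v, ← b.repr.norm_map w]
  have h1 : ‖((C : ℂ) • b.repr w)‖ = C * ‖b.repr w‖ := by
    rw [norm_smul, Complex.norm_real, Real.norm_of_nonneg hC]
  rw [← h1]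
  refine lp.norm_mono two_ne_zero fun i => (h i).trans_eq ?_
  rw [lp.coeFn_smul, Pi.smul_apply, norm_smul, Complex.norm_real, Real.norm_of_nonneg hC]

theorem norm_diagOp_le (hC : 0 ≤ C) (hm : ∀ i, ‖m i‖ ≤ C) : ‖diagOp b m‖ ≤ C := by
  refine ContinuousLinearMap.opNorm_le_bound _ hC fun v => norm_le_of_repr_le b hC fun i => ?_
  rw [repr_diagOp b hm, norm_mul]
  gcongr
  exact hm i

theorem repr_basis [DecidableEq ι] (i j : ι) : b.repr (b i) j = if j = i then 1 else 0 := by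
  rw [b.repr_self, lp.single_apply]
  simp [Pi.single_apply]

theorem diagOp_basis (hm : ∀ i, ‖m i‖ ≤ C) (i : ι) : diagOp b m (b i) = m i • b i := by
  classical
  refine repr_ext b fun j => ?_
  rw [repr_diagOp b hm, map_smul, lp.coeFn_smul, Pi.smul_apply, smul_eq_mul, repr_basis]
  split_ifs with h
  · rw [h]
  · simp

theorem exists_of_repr {a : ι → ℂ} (ha : Summable fun i => ‖a i‖ ^ 2) :
    ∃ v : E, ∀ i, b.repr v i = a i := by
  have : Memℓp a 2 := by
    rw [memℓp_gen_iff (by norm_num)]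
    simpa using ha
  exact ⟨b.repr.symm ⟨a, this⟩, fun i => by simp⟩

theorem summable_repr_sq (v : E) : Summable fun i => ‖b.repr v i‖ ^ 2 := by
  have := (lp.memℓp (b.repr v)).summable (by norm_num)
  simpa using this

/-- Truncating the symbol to the finitely many indices where it is at least `ε / 2` gives a
finite-rank operator within `ε / 2`, and compact operators form a closed set. -/
theorem isCompactOperator_diagOp [CompleteSpace E] (hm : Tendsto m cofinite (𝓝 0)) :
    IsCompactOperator (diagOp b m) := by
  classical
  have hfin : ∀ ε > 0, {i | ¬ ‖m i‖ < ε}.Finite := fun ε hε => by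
    have := (tendsto_zero_iff_norm_tendsto_zero.1 hm).eventually_lt_const hε
    exact this
  obtain ⟨C, hC, hmC⟩ : ∃ C, 0 ≤ C ∧ ∀ i, ‖m i‖ ≤ C := by
    refine ⟨1 + ∑ i ∈ (hfin 1 one_pos).toFinset, ‖m i‖, by positivity, fun i => ?_⟩
    by_cases hi : ‖m i‖ < 1
    · exact hi.le.trans (le_add_of_nonneg_right (by positivity))
    · refine le_add_of_nonneg_of_le zero_le_one ?_
      exact Finset.single_le_sum (f := fun i => ‖m i‖) (fun _ _ => norm_nonneg _) (by simpa using hi)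
  suffices h : diagOp b m ∈ closure {K : E →L[ℂ] E | IsCompactOperator K} by
    rwa [isClosed_setOfPred_isCompactOperator.closure_eq] at h
  rw [Metric.mem_closure_iff]
  intro ε hε
  set s := (hfin (ε / 2) (half_pos hε)).toFinset with hs
  let T : E →L[ℂ] E := ∑ i ∈ s, (m i • innerSL ℂ (b i)).smulRight (b i)
  have hTrepr : ∀ v j, b.repr (T v) j = if j ∈ s then m j * b.repr v j else 0 := by
    intro v j
    have : T v = ∑ i ∈ s, (m i * b.repr v i) • b i := by
      simp only [T, sum_apply, ContinuousLinearMap.smulRight_apply]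
      simp [b.repr_apply_apply]
    rw [this, map_sum, lp.coeFn_sum, Finset.sum_apply]
    simp only [map_smul, lp.coeFn_smul, Pi.smul_apply, repr_basis, smul_eq_mul, mul_ite, mul_one,
      mul_zero, Finset.sum_ite_eq]
  refine ⟨T, ?_, ?_⟩
  · have : ∀ i, IsCompactOperator ((m i • innerSL ℂ (b i)).smulRight (b i)) := fun i =>
      ((isCompactOperator_of_locallyCompactSpace_dom (m i • innerSL ℂ (b i))).clm_comp
        (ContinuousLinearMap.toSpanSingleton ℂ (b i)))
    exact Submodule.sum_mem (compactOperator (RingHom.id ℂ) E E) (fun i _ => this i)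
  · rw [dist_eq_norm]
    refine lt_of_le_of_lt ?_ (half_lt_self hε)
    refine ContinuousLinearMap.opNorm_le_bound _ (half_pos hε).le fun v =>
      norm_le_of_repr_le b (half_pos hε).le fun i => ?_
    rw [sub_apply, map_sub, lp.coeFn_sub, Pi.sub_apply, hTrepr, repr_diagOp b hmC]
    split_ifs with h
    · simp; positivity
    · rw [sub_zero, norm_mul]
      gcongr
      simp only [hs, Finite.mem_toFinset, mem_ofPred_eq, not_not] at h
      exact h.le

end Diagonal

/-! ### Differential calculus on the torus through periodic lifts. -/

section Calculus

theorem exists_lift_eq (x : Torus) : ∃ y : EuclideanSpace ℝ (Fin 2), x = fun i => ((y i : ℝ) : UnitAddCircle) := by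
  choose y hy using fun i => QuotientAddGroup.mk_surjective (x i)
  exact ⟨WithLp.toLp 2 y, funext fun i => (hy i).symm⟩

theorem continuous_of_lift {X : Type*} [TopologicalSpace X] {φ : Torus → X}
    (h : Continuous (lift φ)) : Continuous φ := by
  have hq : IsOpenQuotientMap
      (fun (y : Fin 2 → ℝ) (i : Fin 2) => ((y i : ℝ) : UnitAddCircle)) :=
    IsOpenQuotientMap.piMap fun _ => QuotientAddGroup.isOpenQuotientMap_mk
  rw [hq.isQuotientMap.continuous_iff]
  exact h.comp (PiLp.continuous_toLp 2 fun _ : Fin 2 => ℝ)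

theorem apply_add_single {F : Type*} (φ : Torus → F) (y : EuclideanSpace ℝ (Fin 2)) (j : Fin 2) (t : ℝ) :
    φ ((fun i => ((y i : ℝ) : UnitAddCircle)) + Pi.single j (t : UnitAddCircle))
      = lift φ (y + t • EuclideanSpace.single j 1) := by
  unfold lift
  congr 1
  funext i
  by_cases h : i = j
  · subst h; simp
  · simp [h]

variable {F : Type*} [NormedAddCommGroup F] [NormedSpace ℝ F]

theorem hasDerivAt_translate {φ : Torus → F} (h : ContDiff ℝ 1 (lift φ)) (x : Torus) (j : Fin 2)
    (s : ℝ) : HasDerivAt (fun t : ℝ => φ (x + Pi.single j (t : UnitAddCircle)))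
      (pd j φ (x + Pi.single j (s : UnitAddCircle))) s := by
  have key : ∀ (y : EuclideanSpace ℝ (Fin 2)) (s : ℝ),
      HasDerivAt (fun t : ℝ => lift φ (y + t • EuclideanSpace.single j 1))
        (fderiv ℝ (lift φ) (y + s • EuclideanSpace.single j 1) (EuclideanSpace.single j 1)) s := by
    intro y s
    have h1 := (h.differentiable one_ne_zero (y + s • EuclideanSpace.single j 1)).hasFDerivAt
    have h2 : HasDerivAt (fun t : ℝ => y + t • EuclideanSpace.single j (1 : ℝ))
        (EuclideanSpace.single j 1) s := by
      simpa using ((hasDerivAt_id s).smul_const (EuclideanSpace.single j (1 : ℝ))).const_add y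
    exact h1.comp_hasDerivAt s h2
  obtain ⟨y, rfl⟩ := exists_lift_eq x
  have h3 : pd j φ ((fun i => ((y i : ℝ) : UnitAddCircle)) + Pi.single j (s : UnitAddCircle))
      = fderiv ℝ (lift φ) (y + s • EuclideanSpace.single j 1) (EuclideanSpace.single j 1) := by
    have e : (fun i => ((y i : ℝ) : UnitAddCircle)) + Pi.single j (s : UnitAddCircle)
        = fun i => (((y + s • EuclideanSpace.single j 1 : EuclideanSpace ℝ (Fin 2)) i : ℝ) : UnitAddCircle) :=
      apply_add_single id y j s
    rw [e, pd]
    simp only [apply_add_single]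
    have := (key (y + s • EuclideanSpace.single j 1) 0).deriv
    simpa using this
  rw [h3]
  simp only [apply_add_single]
  exact key y s

theorem lift_pd {φ : Torus → F} (h : ContDiff ℝ 1 (lift φ)) (j : Fin 2) :
    lift (pd j φ) = fun y => fderiv ℝ (lift φ) y (EuclideanSpace.single j 1) := by
  funext y
  have h1 := (hasDerivAt_translate h (fun i => ((y i : ℝ) : UnitAddCircle)) j 0)
  simp only [apply_add_single] at h1
  have h2 := (h.differentiable one_ne_zero y).hasFDerivAt
  have h3 : HasDerivAt (fun t : ℝ => y + t • EuclideanSpace.single j (1 : ℝ))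
      (EuclideanSpace.single j 1) 0 := by
    simpa using ((hasDerivAt_id (0 : ℝ)).smul_const (EuclideanSpace.single j (1 : ℝ))).const_add y
  have h4 := HasFDerivAt.comp_hasDerivAt_of_eq (0 : ℝ) h2 h3 (by simp)
  simpa using h1.unique h4

theorem contDiff_lift_pd {φ : Torus → F} {n : WithTop ℕ∞} (h : ContDiff ℝ (n + 1) (lift φ)) (j : Fin 2) :
    ContDiff ℝ n (lift (pd j φ)) := by
  rw [lift_pd (h.of_le le_add_self)]
  exact (h.fderiv_right le_rfl).clm_apply contDiff_const

theorem continuous_pd {φ : Torus → F} (h : ContDiff ℝ 1 (lift φ)) (j : Fin 2) :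
    Continuous (pd j φ) :=
  continuous_of_lift (contDiff_lift_pd (n := 0) (by simpa using h) j).continuous

theorem pd_comp {G : Type*} [NormedAddCommGroup G] [NormedSpace ℝ G] {φ : Torus → F}
    (h : ContDiff ℝ 1 (lift φ)) {g : F → G} (hg : ContDiff ℝ 1 g) (j : Fin 2) (x : Torus) :
    pd j (fun y => g (φ y)) x = fderiv ℝ g (φ x) (pd j φ x) := by
  have h1 := hasDerivAt_translate h x j 0
  have h2 := (hg.differentiable one_ne_zero (φ x)).hasFDerivAt
  have h3 := HasFDerivAt.comp_hasDerivAt_of_eq (0 : ℝ) h2 h1 (by simp)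
  simpa [pd, Function.comp_def] using h3.deriv

end Calculus

/-! ### Fourier coefficients of translates and of derivatives. -/

section Coefficients

theorem mFourier_add_apply (k : Fin 2 → ℤ) (x y : Torus) :
    mFourier k (x + y) = mFourier k x * mFourier k y := by
  simp only [mFourier, ContinuousMap.coe_mk, Pi.add_apply, fourier_apply, smul_add,
    AddCircle.toCircle_add, Circle.coe_mul, Finset.prod_mul_distrib]

theorem mFourier_pi_single (k : Fin 2 → ℤ) (j : Fin 2) (t : ℝ) :
    mFourier k (Pi.single j (t : UnitAddCircle)) = Complex.exp (2 * Real.pi * Complex.I * k j * t) := by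
  rw [mFourier, ContinuousMap.coe_mk, Finset.prod_eq_single j]
  · rw [Pi.single_eq_same, fourier_coe_apply]; simp
  · intro i _ hi
    rw [Pi.single_eq_of_ne hi, fourier_eval_zero]
  · simp

variable {F : Type*} [NormedAddCommGroup F] [NormedSpace ℂ F]

theorem integral_translate {G : Type*} [NormedAddCommGroup G] [NormedSpace ℝ G] (f : Torus → G)
    (g : Torus) : ∫ x, f (x + g) ∂torusMeasure = ∫ x, f x ∂torusMeasure :=
  integral_add_right_eq_self f g

theorem mFourier_neg_apply_neg (k : Fin 2 → ℤ) (x : Torus) : mFourier (-k) (-x) = mFourier k x := by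
  simp [mFourier, fourier_apply]

theorem coeff_translate (φ : Torus → F) (k : Fin 2 → ℤ) (g : Torus) :
    (∫ x, mFourier (-k) x • φ (x + g) ∂torusMeasure) = mFourier k g • mFourierCoeff φ k := by
  have e : ∀ x, mFourier (-k) (x - g) • φ x = mFourier k g • (mFourier (-k) x • φ x) := fun x => by
    rw [sub_eq_add_neg, mFourier_add_apply, smul_smul, mul_comm, mFourier_neg_apply_neg]
  have h := integral_translate (fun x : Torus => mFourier (-k) (x - g) • φ x) g
  simp only [add_sub_cancel_right] at h
  rw [h]
  simp only [e]
  exact integral_smul _ _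

/-- A real structure compatible with the complex one is its restriction. This reconciles the real
structure carried by `EuclideanSpace ℂ (Fin n)` with the one that complex scalars induce. -/
theorem normedSpace_real_eq (i : NormedSpace ℝ F) [IsScalarTower ℝ ℂ F] :
    i = NormedSpace.complexToReal := by
  have : i.toModule = (NormedSpace.complexToReal : NormedSpace ℝ F).toModule :=
    Module.ext' _ _ fun r v => by
      have h := smul_assoc r (1 : ℂ) v
      rw [one_smul] at h
      rw [← h]
      change (r • (1 : ℂ)) • v = (r : ℂ) • v
      rw [Complex.real_smul, mul_one]
  cases i
  congr

variable [i : NormedSpace ℝ F] [IsScalarTower ℝ ℂ F]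

/-- Replaces integration by parts: translating by `t` in direction `j` multiplies the `k`-th
coefficient by `exp (2iπ kⱼ t)`, and this identity is differentiated at `t = 0`, under the integral
sign. -/
theorem coeff_pd {φ : Torus → F} (h : ContDiff ℝ 1 (lift φ)) (j : Fin 2) (k : Fin 2 → ℤ) :
    mFourierCoeff (pd j φ) k = (2 * Real.pi * Complex.I * k j) • mFourierCoeff φ k := by
  obtain rfl := normedSpace_real_eq i
  have hφ : Continuous φ := continuous_of_lift h.continuous
  have hpd := continuous_pd h j
  obtain ⟨C, hC⟩ := isCompact_univ.exists_bound_of_continuousOn hpd.continuousOn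
  have hcont : ∀ t : ℝ, Continuous fun x : Torus =>
      mFourier (-k) x • φ (x + Pi.single j (t : UnitAddCircle)) := fun t => by fun_prop
  have hcont' : ∀ t : ℝ, Continuous fun x : Torus =>
      mFourier (-k) x • pd j φ (x + Pi.single j (t : UnitAddCircle)) := fun t => by fun_prop
  have h1 : HasDerivAt (fun t : ℝ => ∫ x, mFourier (-k) x • φ (x + Pi.single j (t : UnitAddCircle)) ∂torusMeasure)
      (∫ x, mFourier (-k) x • pd j φ (x + Pi.single j ((0 : ℝ) : UnitAddCircle)) ∂torusMeasure) 0 := by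
    refine (hasDerivAt_integral_of_dominated_loc_of_deriv_le (μ := torusMeasure) (𝕜 := ℝ)
      (bound := fun _ => C) (s := univ)
      (F := fun (t : ℝ) x => mFourier (-k) x • φ (x + Pi.single j (t : UnitAddCircle)))
      (F' := fun (t : ℝ) x => mFourier (-k) x • pd j φ (x + Pi.single j (t : UnitAddCircle)))
      univ_mem ?_ ?_ ?_ ?_ (integrable_const C) ?_).2
    · exact Eventually.of_forall fun t => (hcont t).aestronglyMeasurable
    · exact (hcont 0).integrable_of_hasCompactSupport (HasCompactSupport.of_compactSpace _)
    · exact (hcont' 0).aestronglyMeasurable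
    · refine Eventually.of_forall fun x t _ => ?_
      rw [norm_smul]
      have := ((mFourier (-k)).norm_coe_le_norm x).trans mFourier_norm.le
      calc _ ≤ 1 * C := by gcongr; exact hC _ (mem_univ _)
        _ = C := one_mul C
    · exact Eventually.of_forall fun x t _ => (hasDerivAt_translate h x j t).const_smul _
  have h3 := h1
  have e : (fun t : ℝ => ∫ x, mFourier (-k) x • φ (x + Pi.single j (t : UnitAddCircle)) ∂torusMeasure)
      = fun t : ℝ => Complex.exp (2 * Real.pi * Complex.I * k j * t) • mFourierCoeff φ k := by
    funext t
    rw [coeff_translate, mFourier_pi_single]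
  rw [e] at h3
  have h4 : HasDerivAt (fun t : ℝ => Complex.exp (2 * Real.pi * Complex.I * k j * t) • mFourierCoeff φ k)
      ((2 * Real.pi * Complex.I * k j) • mFourierCoeff φ k) 0 := by
    have : HasDerivAt (fun t : ℝ => Complex.exp (2 * Real.pi * Complex.I * k j * t))
        (2 * Real.pi * Complex.I * k j) 0 := by
      have h5 : HasDerivAt (fun t : ℝ => 2 * Real.pi * Complex.I * k j * (t : ℂ))
          (2 * Real.pi * Complex.I * k j) 0 := by
        simpa using (Complex.ofRealCLM.hasDerivAt (x := (0 : ℝ))).const_mul (2 * Real.pi * Complex.I * k j)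
      simpa using h5.cexp
    exact this.smul_const _
  have h6 := h3.unique h4
  simp only [QuotientAddGroup.mk_zero, Pi.single_zero, add_zero] at h6
  exact h6

end Coefficients

/-! ### The Fourier basis of vector-valued `L²` and Fourier multipliers. -/

section Basis

variable {n : ℕ}

/-- The class in `L²` of a continuous function. -/
def toL2 (φ : C(Torus, EuclideanSpace ℂ (Fin n))) : L2 n := ContinuousMap.toLp 2 torusMeasure ℂ φ

theorem coeFn_toL2 (φ : C(Torus, EuclideanSpace ℂ (Fin n))) : toL2 φ =ᵐ[torusMeasure] φ :=
  ContinuousMap.coeFn_toLp torusMeasure φ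

theorem coeff_toL2 (φ : C(Torus, EuclideanSpace ℂ (Fin n))) (k : Fin 2 → ℤ) :
    mFourierCoeff (toL2 φ) k = mFourierCoeff φ k :=
  coeff_congr (coeFn_toL2 φ) k

/-- The Fourier mode `x ↦ exp (2iπ k·x) v`. -/
def mode (k : Fin 2 → ℤ) (v : EuclideanSpace ℂ (Fin n)) : C(Torus, EuclideanSpace ℂ (Fin n)) :=
  ⟨fun x => mFourier k x • v, by fun_prop⟩

theorem integral_mFourier (k : Fin 2 → ℤ) :
    (∫ x, mFourier k x ∂torusMeasure) = if k = 0 then 1 else 0 := by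
  have h := orthonormal_iff_ite.1 (orthonormal_mFourier (d := Fin 2)) 0 k
  rw [ContinuousMap.inner_toLp] at h
  simp only [mFourier_zero, ContinuousMap.one_apply, map_one, mul_one] at h
  refine Eq.trans h ?_
  by_cases hk : k = 0
  · rw [if_pos hk, if_pos hk.symm]
  · rw [if_neg hk, if_neg (Ne.symm hk)]

theorem coeff_mode (l : Fin 2 → ℤ) (v : EuclideanSpace ℂ (Fin n)) (k : Fin 2 → ℤ) :
    mFourierCoeff (mode l v) k = if k = l then v else 0 := by
  have e : mFourierCoeff (mode l v) k = (∫ x, mFourier (l - k) x ∂torusMeasure) • v := by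
    rw [← integral_smul_const]
    refine integral_congr_ae (Eventually.of_forall fun x => ?_)
    change mFourier (-k) x • mFourier l x • v = mFourier (l - k) x • v
    rw [smul_smul, ← mFourier_add, neg_add_eq_sub]
  rw [e, integral_mFourier]
  by_cases hk : k = l
  · rw [if_pos hk, if_pos (sub_eq_zero.2 hk.symm), one_smul]
  · rw [if_neg hk, if_neg (fun h => hk (sub_eq_zero.1 h).symm), zero_smul]

theorem inner_mode (k : Fin 2 → ℤ) (v : EuclideanSpace ℂ (Fin n)) (V : L2 n) :
    inner ℂ (toL2 (mode k v)) V = inner ℂ v (mFourierCoeff V k) := by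
  rw [L2.inner_def]
  have e := (innerSL ℂ v).integral_comp_comm (integrable_mFourier (integrable_L2 V) k)
  simp only [innerSL_apply_apply] at e
  refine Eq.trans ?_ e
  refine integral_congr_ae ?_
  filter_upwards [coeFn_toL2 (mode k v)] with x hx
  rw [hx]
  change inner ℂ (mFourier k x • v) (V x) = _
  rw [inner_smul_left, inner_smul_right, mFourier_neg]

/-- The Fourier modes with constant directions in the canonical basis. -/
def fourierMode (i : (Fin 2 → ℤ) × Fin n) : L2 n := toL2 (mode i.1 (EuclideanSpace.single i.2 1))

theorem inner_fourierMode (i : (Fin 2 → ℤ) × Fin n) (V : L2 n) :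
    inner ℂ (fourierMode i) V = mFourierCoeff V i.1 i.2 := by
  rw [fourierMode, inner_mode, EuclideanSpace.inner_single_left]; simp

theorem orthonormal_fourierMode : Orthonormal ℂ (fourierMode (n := n)) := by
  rw [orthonormal_iff_ite]
  intro i j
  rw [inner_fourierMode, fourierMode, coeff_toL2, coeff_mode]
  by_cases h1 : i.1 = j.1
  · by_cases h2 : i.2 = j.2
    · simp [Prod.ext h1 h2]
    · have : i ≠ j := fun h => h2 (congrArg Prod.snd h)
      simp [h1, h2, this]
  · have : i ≠ j := fun h => h1 (congrArg Prod.fst h)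
    simp [h1, this]

/-- The Fourier basis of `L²(ℝ²/ℤ²; ℂⁿ)`. -/
def fourierBasis (n : ℕ) : HilbertBasis ((Fin 2 → ℤ) × Fin n) ℂ (L2 n) :=
  HilbertBasis.mkOfOrthogonalEqBot orthonormal_fourierMode (by
    rw [Submodule.eq_bot_iff]
    intro V hV
    refine eq_zero_of_coeff V fun k => ?_
    ext a
    have := Submodule.inner_right_of_mem_orthogonal
      (Submodule.subset_span (mem_range_self (k, a))) hV
    rwa [inner_fourierMode] at this)

theorem fourierBasis_apply (i : (Fin 2 → ℤ) × Fin n) : fourierBasis n i = fourierMode i := by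
  rw [fourierBasis, HilbertBasis.coe_mkOfOrthogonalEqBot]

theorem repr_fourierBasis (V : L2 n) (i : (Fin 2 → ℤ) × Fin n) :
    (fourierBasis n).repr V i = mFourierCoeff V i.1 i.2 := by
  rw [HilbertBasis.repr_apply_apply, fourierBasis_apply, inner_fourierMode]

/-- The Fourier multiplier of symbol `m`. -/
def multiplier (n : ℕ) (m : (Fin 2 → ℤ) → ℂ) : L2 n →L[ℂ] L2 n :=
  diagOp (fourierBasis n) fun i => m i.1

theorem coeff_multiplier {m : (Fin 2 → ℤ) → ℂ} {C : ℝ} (hm : ∀ k, ‖m k‖ ≤ C) (V : L2 n)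
    (k : Fin 2 → ℤ) : mFourierCoeff (multiplier n m V) k = m k • mFourierCoeff V k := by
  ext a
  have := repr_diagOp (fourierBasis n) (m := fun i => m i.1) (fun i => hm i.1) V (k, a)
  rwa [repr_fourierBasis, repr_fourierBasis] at this

theorem multiplier_basis {m : (Fin 2 → ℤ) → ℂ} {C : ℝ} (hm : ∀ k, ‖m k‖ ≤ C)
    (i : (Fin 2 → ℤ) × Fin n) :
    multiplier n m (fourierBasis n i) = m i.1 • fourierBasis n i :=
  diagOp_basis (fourierBasis n) (m := fun i => m i.1) (fun i => hm i.1) i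

theorem coeff_ext {V W : L2 n} (h : ∀ k, mFourierCoeff V k = mFourierCoeff W k) : V = W :=
  repr_ext (fourierBasis n) fun i => by rw [repr_fourierBasis, repr_fourierBasis, h]

theorem summable_coeff_sq (V : L2 n) : Summable fun k => ‖mFourierCoeff V k‖ ^ 2 := by
  have h := (summable_repr_sq (fourierBasis n) V).prod
  simp only [repr_fourierBasis, tsum_fintype] at h
  refine h.congr fun k => ?_
  rw [EuclideanSpace.norm_sq_eq]

theorem exists_of_coeff {a : (Fin 2 → ℤ) → EuclideanSpace ℂ (Fin n)}
    (ha : Summable fun k => ‖a k‖ ^ 2) : ∃ V : L2 n, ∀ k, mFourierCoeff V k = a k := by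
  have h : Summable fun i : (Fin 2 → ℤ) × Fin n => ‖a i.1 i.2‖ ^ 2 := by
    rw [summable_prod_of_nonneg (fun i => by positivity)]
    refine ⟨fun k => (hasSum_fintype _).summable, ?_⟩
    simp only [tsum_fintype]
    exact ha.congr fun k => by rw [EuclideanSpace.norm_sq_eq]
  obtain ⟨V, hV⟩ := exists_of_repr (fourierBasis n) h
  refine ⟨V, fun k => ?_⟩
  ext c
  rw [← repr_fourierBasis V (k, c), hV]

end Basis

/-! ### Multiplication by a `C¹` matrix preserves `H¹`. -/

section Multiplication

variable {n : ℕ}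

local notation "𝔼" => EuclideanSpace ℂ (Fin n)

theorem norm_apply_le (A : C(Torus, 𝔼 →L[ℂ] 𝔼)) (x : Torus) (v : 𝔼) : ‖A x v‖ ≤ ‖A‖ * ‖v‖ :=
  (A x).le_of_opNorm_le (A.norm_coe_le_norm x) v

theorem memLp_apply (A : C(Torus, 𝔼 →L[ℂ] 𝔼)) (V : L2 n) :
    MemLp (fun x => A x (V x)) 2 torusMeasure := by
  refine (Lp.memLp V).of_le_mul (c := ‖A‖) ?_ (Eventually.of_forall fun x => norm_apply_le A x _)
  exact (ContinuousLinearMap.id ℂ (𝔼 →L[ℂ] 𝔼)).aestronglyMeasurable_comp₂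
    A.continuous.aestronglyMeasurable (Lp.aestronglyMeasurable V)

/-- The operator of multiplication by a continuous matrix-valued function. -/
def mulOp (A : C(Torus, 𝔼 →L[ℂ] 𝔼)) : L2 n →L[ℂ] L2 n :=
  LinearMap.mkContinuous
    { toFun := fun V => (memLp_apply A V).toLp
      map_add' := fun V W => by
        rw [← MemLp.toLp_add, MemLp.toLp_eq_toLp_iff]
        filter_upwards [Lp.coeFn_add V W] with x hx
        rw [hx, Pi.add_apply, Pi.add_apply, map_add]
      map_smul' := fun c V => by
        rw [RingHom.id_apply, ← MemLp.toLp_const_smul, MemLp.toLp_eq_toLp_iff]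
        filter_upwards [Lp.coeFn_smul c V] with x hx
        simp [hx] } ‖A‖ (fun V => by
      refine Lp.norm_le_mul_norm_of_ae_le_mul ?_
      filter_upwards [(memLp_apply A V).coeFn_toLp] with x hx
      rw [LinearMap.coe_mk, AddHom.coe_mk, hx]
      exact norm_apply_le A x _)

theorem coeFn_mulOp (A : C(Torus, 𝔼 →L[ℂ] 𝔼)) (V : L2 n) :
    mulOp A V =ᵐ[torusMeasure] fun x => A x (V x) :=
  (memLp_apply A V).coeFn_toLp

theorem coeff_mulOp_mode (A : C(Torus, 𝔼 →L[ℂ] 𝔼)) (l : Fin 2 → ℤ) (v : 𝔼) (k : Fin 2 → ℤ) :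
    mFourierCoeff (mulOp A (toL2 (mode l v))) k = mFourierCoeff (fun x => A x v) (k - l) := by
  refine integral_congr_ae ?_
  filter_upwards [coeFn_mulOp A (toL2 (mode l v)), coeFn_toL2 (mode l v)] with x h1 h2
  rw [h1, h2]
  change mFourier (-k) x • A x (mFourier l x • v) = mFourier (-(k - l)) x • A x v
  rw [map_smul, smul_smul, ← mFourier_add]
  congr 3
  abel

/-- The weight `(1 + |k|²)^{1/2}`. -/
def weight (k : Fin 2 → ℤ) : ℝ := Real.sqrt (1 + ∑ j, (k j : ℝ) ^ 2)

theorem weight_sq (k : Fin 2 → ℤ) : weight k ^ 2 = 1 + ∑ j, (k j : ℝ) ^ 2 :=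
  Real.sq_sqrt (by positivity)

theorem weight_pos (k : Fin 2 → ℤ) : 0 < weight k := Real.sqrt_pos.2 (by positivity)

theorem one_le_weight (k : Fin 2 → ℤ) : 1 ≤ weight k :=
  Real.one_le_sqrt.2 (le_add_of_nonneg_right (by positivity))

theorem abs_le_weight (k : Fin 2 → ℤ) (j : Fin 2) : |(k j : ℝ)| ≤ weight k := by
  refine Real.le_sqrt_of_sq_le ?_
  rw [sq_abs]
  have := Finset.single_le_sum (f := fun j => (k j : ℝ) ^ 2) (fun _ _ => sq_nonneg _) (Finset.mem_univ j)
  linarith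

/-- The Bessel potential `(1 - Δ/4π²)^{-1/2}`. -/
def bessel (n : ℕ) : L2 n →L[ℂ] L2 n := multiplier n fun k => ((weight k)⁻¹ : ℝ)

theorem norm_inv_weight_le (k : Fin 2 → ℤ) : ‖(((weight k)⁻¹ : ℝ) : ℂ)‖ ≤ 1 := by
  rw [Complex.norm_real, norm_inv, Real.norm_of_nonneg (weight_pos k).le]
  exact inv_le_one_of_one_le₀ (one_le_weight k)

theorem coeff_bessel (V : L2 n) (k : Fin 2 → ℤ) :
    mFourierCoeff (bessel n V) k = (((weight k)⁻¹ : ℝ) : ℂ) • mFourierCoeff V k :=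
  coeff_multiplier norm_inv_weight_le V k

/-- The range of the Bessel potential serves as `H¹` throughout. -/
theorem mem_range_bessel {V : L2 n} :
    V ∈ LinearMap.range (bessel n : L2 n →ₗ[ℂ] L2 n) ↔
      Summable fun k => weight k ^ 2 * ‖mFourierCoeff V k‖ ^ 2 := by
  constructor
  · rintro ⟨W, rfl⟩
    refine (summable_coeff_sq W).congr fun k => ?_
    rw [ContinuousLinearMap.coe_coe, coeff_bessel, norm_smul, Complex.norm_real, norm_inv,
      Real.norm_of_nonneg (weight_pos k).le]
    have := (weight_pos k).ne'
    field_simp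
  · intro h
    obtain ⟨W, hW⟩ := exists_of_coeff (n := n) (a := fun k => ((weight k : ℝ) : ℂ) • mFourierCoeff V k)
      (h.congr fun k => by
        rw [norm_smul, Complex.norm_real, Real.norm_of_nonneg (weight_pos k).le, mul_pow])
    refine ⟨W, coeff_ext fun k => ?_⟩
    rw [ContinuousLinearMap.coe_coe, coeff_bessel, hW, smul_smul, ← Complex.ofReal_mul,
      inv_mul_cancel₀ (weight_pos k).ne', Complex.ofReal_one, one_smul]

/-- The symbol `2iπ k_j (1 + |k|²)^{-1/2}`. -/
def rieszSymbol (j : Fin 2) (k : Fin 2 → ℤ) : ℂ := 2 * Real.pi * Complex.I * k j * ((weight k)⁻¹ : ℝ)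

theorem norm_rieszSymbol_le (j : Fin 2) (k : Fin 2 → ℤ) : ‖rieszSymbol j k‖ ≤ 2 * Real.pi := by
  have h : ‖rieszSymbol j k‖ = 2 * Real.pi * (|(k j : ℝ)| * (weight k)⁻¹) := by
    rw [rieszSymbol]
    simp only [norm_mul, Complex.norm_real, Complex.norm_I, norm_inv, Real.norm_of_nonneg (weight_pos k).le,
      Real.norm_of_nonneg Real.pi_pos.le, Complex.norm_intCast, Complex.norm_two]
    ring
  rw [h]
  refine mul_le_of_le_one_right (by positivity) ?_
  rw [← div_eq_mul_inv, div_le_one (weight_pos k)]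
  exact abs_le_weight k j

/-- The Leibniz rule for `A` times an `H¹` function, in the weak sense. Written in terms of the `L²`
function to which the Bessel potential is applied, both sides are continuous, so it suffices to
check Fourier modes, where it is classical. -/
theorem coeff_deriv_mulOp {A A' : C(Torus, 𝔼 →L[ℂ] 𝔼)} {j : Fin 2}
    (hA : ∀ v, ContDiff ℝ 1 (lift fun x => A x v)) (hA' : ∀ x v, A' x v = pd j (fun x => A x v) x)
    (V : L2 n) (k : Fin 2 → ℤ) :
    (2 * Real.pi * Complex.I * k j) • mFourierCoeff (mulOp A (bessel n V)) k
      = mFourierCoeff (mulOp A' (bessel n V) + mulOp A (multiplier n (rieszSymbol j) V) : L2 n) k := by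
  ext a
  let f : L2 n →L[ℂ] ℂ := innerSL ℂ (fourierMode (k, a)) ∘L mulOp A ∘L bessel n
  let g : L2 n →L[ℂ] ℂ := innerSL ℂ (fourierMode (k, a)) ∘L
    (mulOp A' ∘L bessel n + mulOp A ∘L multiplier n (rieszSymbol j))
  have hf : ∀ V, f V = mFourierCoeff (mulOp A (bessel n V)) k a := fun V =>
    inner_fourierMode (k, a) _
  have hg : ∀ V, g V = mFourierCoeff
      (mulOp A' (bessel n V) + mulOp A (multiplier n (rieszSymbol j) V) : L2 n) k a := fun V =>
    inner_fourierMode (k, a) _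
  have key : (2 * Real.pi * Complex.I * k j : ℂ) • f = g := by
    refine ContinuousLinearMap.ext_on (s := range (fourierBasis n))
      (Submodule.dense_iff_topologicalClosure_eq_top.2 (fourierBasis n).dense_span) ?_
    rintro _ ⟨⟨l, c⟩, rfl⟩
    have e1 : bessel n (fourierBasis n (l, c)) = (((weight l)⁻¹ : ℝ) : ℂ) • fourierBasis n (l, c) :=
      multiplier_basis norm_inv_weight_le (l, c)
    have e2 : multiplier n (rieszSymbol j) (fourierBasis n (l, c))
        = rieszSymbol j l • fourierBasis n (l, c) :=
      multiplier_basis (norm_rieszSymbol_le j) (l, c)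
    have h1 : mFourierCoeff (fun x => A' x (EuclideanSpace.single c 1)) (k - l)
        = (2 * Real.pi * Complex.I * ((k - l) j : ℤ)) •
          mFourierCoeff (fun x => A x (EuclideanSpace.single c 1)) (k - l) := by
      rw [← coeff_pd (hA (EuclideanSpace.single c 1)) j (k - l)]
      congr 1
      funext x
      exact hA' x _
    have h2 : ∀ B : C(Torus, 𝔼 →L[ℂ] 𝔼), mFourierCoeff (mulOp B (fourierBasis n (l, c))) k
        = mFourierCoeff (fun x => B x (EuclideanSpace.single c 1)) (k - l) := fun B => by
      rw [fourierBasis_apply]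
      exact coeff_mulOp_mode B l _ k
    change (2 * Real.pi * Complex.I * k j : ℂ) * f _ = g _
    rw [hf, hg, e1, e2, coeff_coe_add, map_smul, map_smul, map_smul, coeff_coe_smul, coeff_coe_smul,
      coeff_coe_smul, h2, h2, h1]
    simp only [PiLp.add_apply, PiLp.smul_apply, smul_eq_mul, rieszSymbol, Pi.sub_apply]
    push_cast
    ring
  have := congrArg (fun T : L2 n →L[ℂ] ℂ => T V) key
  change (2 * Real.pi * Complex.I * k j : ℂ) * f V = g V at this
  rwa [hf, hg] at this

theorem mulOp_mem_range_bessel {A : C(Torus, 𝔼 →L[ℂ] 𝔼)}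
    (hA : ∀ v, ContDiff ℝ 1 (lift fun x => A x v))
    (hA' : ∀ j, ∃ A' : C(Torus, 𝔼 →L[ℂ] 𝔼), ∀ x v, A' x v = pd j (fun x => A x v) x)
    {V : L2 n} (hV : V ∈ LinearMap.range (bessel n : L2 n →ₗ[ℂ] L2 n)) :
    mulOp A V ∈ LinearMap.range (bessel n : L2 n →ₗ[ℂ] L2 n) := by
  obtain ⟨W, rfl⟩ := hV
  rw [ContinuousLinearMap.coe_coe, mem_range_bessel]
  choose A' hA' using hA'
  have h := (summable_coeff_sq (mulOp A (bessel n W))).add (summable_sum fun j (_ : j ∈ Finset.univ) =>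
    (summable_coeff_sq (mulOp (A' j) (bessel n W) + mulOp A (multiplier n (rieszSymbol j) W))))
  refine Summable.of_nonneg_of_le (fun k => by positivity) (fun k => ?_) h
  simp only [← coeff_deriv_mulOp hA (hA' _)]
  rw [weight_sq, add_mul, one_mul, Finset.sum_mul]
  gcongr with j _
  have e : ‖(2 * Real.pi * Complex.I * k j : ℂ)‖ = 2 * Real.pi * |(k j : ℝ)| := by
    simp only [norm_mul, Complex.norm_real, Complex.norm_I, 
      Real.norm_of_nonneg Real.pi_pos.le, Complex.norm_intCast, Complex.norm_two, mul_one]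
  rw [norm_smul, mul_pow, e, mul_pow, sq_abs]
  gcongr
  have : (1 : ℝ) ≤ 2 * Real.pi := by have := Real.pi_gt_three; linarith
  nlinarith [sq_nonneg ((k j : ℝ)), mul_self_le_mul_self zero_le_one this]

end Multiplication

/-! ### Matrix-valued functions and Jacobians along the wave. -/

section Matrices

variable {n : ℕ}

local notation "𝔼" => EuclideanSpace ℂ (Fin n)

/-- A continuous matrix-valued function as a continuous operator-valued function. -/
def matFun (a : Fin n → Fin n → Torus → ℂ) (ha : ∀ i l, Continuous (a i l)) : C(Torus, 𝔼 →L[ℂ] 𝔼) where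
  toFun x := Matrix.toEuclideanCLM (𝕜 := ℂ) (Matrix.of fun i l => a i l x)
  continuous_toFun := by
    have h : Continuous (Matrix.toEuclideanCLM (𝕜 := ℂ) (n := Fin n)) :=
      (Matrix.toEuclideanCLM (𝕜 := ℂ) (n := Fin n)).toAlgEquiv.toLinearMap.continuous_of_finiteDimensional
    exact h.comp (continuous_matrix fun i l => ha i l)

theorem matFun_apply (a : Fin n → Fin n → Torus → ℂ) (ha : ∀ i l, Continuous (a i l)) (x : Torus)
    (v : 𝔼) : matFun a ha x v = WithLp.toLp 2 fun i => ∑ l, a i l x * v l := by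
  ext i
  simp [matFun, Matrix.ofLp_toEuclideanCLM, Matrix.mulVec, dotProduct]

/-- `WithLp.toLp` as a real continuous linear map. -/
def toLpReal (n : ℕ) : (Fin n → ℂ) →L[ℝ] EuclideanSpace ℂ (Fin n) :=
  (PiLp.continuousLinearEquiv 2 ℝ fun _ : Fin n => ℂ).symm.toContinuousLinearMap

theorem toLpReal_apply (v : Fin n → ℂ) : toLpReal n v = WithLp.toLp 2 v := rfl

theorem contDiff_lift_matFun {a : Fin n → Fin n → Torus → ℂ} (ha : ∀ i l, Continuous (a i l))
    (h : ∀ i l, ContDiff ℝ 1 (lift (a i l))) (v : 𝔼) :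
    ContDiff ℝ 1 (lift fun x => matFun a ha x v) := by
  have e : (lift fun x => matFun a ha x v)
      = fun y => toLpReal n fun i => ∑ l, lift (a i l) y * v l := by
    funext y
    exact matFun_apply a ha _ v
  rw [e]
  exact (toLpReal n).contDiff.comp (contDiff_pi.2 fun i => ContDiff.sum fun l _ =>
    (h i l).mul contDiff_const)

theorem pd_matFun {a : Fin n → Fin n → Torus → ℂ} (ha : ∀ i l, Continuous (a i l))
    (h : ∀ i l, ContDiff ℝ 1 (lift (a i l))) (v : 𝔼) (j : Fin 2) (x : Torus) :
    pd j (fun x => matFun a ha x v) x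
      = matFun (fun i l => pd j (a i l)) (fun i l => continuous_pd (h i l) j) x v := by
  rw [matFun_apply, pd]
  have h1 : HasDerivAt (fun t : ℝ => toLpReal n fun i => ∑ l, a i l (x + Pi.single j (t : UnitAddCircle)) * v l)
      (toLpReal n fun i => ∑ l, pd j (a i l) x * v l) 0 := by
    refine (toLpReal n).hasFDerivAt.comp_hasDerivAt (0 : ℝ) (hasDerivAt_pi.2 fun i => ?_)
    refine HasDerivAt.fun_sum fun l _ => ?_
    simpa using (hasDerivAt_translate (h i l) x j 0).mul_const (v l)
  have e : (fun t : ℝ => matFun a ha (x + Pi.single j (t : UnitAddCircle)) v)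
      = fun t : ℝ => toLpReal n fun i => ∑ l, a i l (x + Pi.single j (t : UnitAddCircle)) * v l :=
    funext fun t => matFun_apply a ha _ v
  rw [e, h1.deriv, toLpReal_apply]

theorem matFun_mul_mem {a : Fin n → Fin n → Torus → ℂ} (ha : ∀ i l, Continuous (a i l))
    (h : ∀ i l, ContDiff ℝ 1 (lift (a i l))) {V : L2 n}
    (hV : V ∈ LinearMap.range (bessel n : L2 n →ₗ[ℂ] L2 n)) :
    mulOp (matFun a ha) V ∈ LinearMap.range (bessel n : L2 n →ₗ[ℂ] L2 n) :=
  mulOp_mem_range_bessel (contDiff_lift_matFun ha h)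
    (fun j => ⟨_, fun x v => (pd_matFun ha h v j x).symm⟩) hV

end Matrices

section Jacobian

variable {n r : ℕ} (P : PeriodicWave n r)

theorem contDiff_jacEntry {F : EuclideanSpace ℝ (Fin n) → EuclideanSpace ℝ (Fin n)} (hF : ContDiff ℝ ∞ F)
    (i l : Fin n) : ContDiff ℝ 1 (lift fun x =>
      ((fderiv ℝ F (P.U x) (EuclideanSpace.single l 1) i : ℝ) : ℂ)) := by
  have h1 : ContDiff ℝ 1 (fun u => fderiv ℝ F u) := hF.fderiv_right (by norm_cast)
  have h2 : ContDiff ℝ 1 (fun y => fderiv ℝ F (lift P.U y)) := h1.comp (P.contDiff_U.of_le (by norm_num))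
  have h3 : ContDiff ℝ 1 (fun y => fderiv ℝ F (lift P.U y) (EuclideanSpace.single l 1)) :=
    h2.clm_apply contDiff_const
  have h4 := (EuclideanSpace.proj i : EuclideanSpace ℝ (Fin n) →L[ℝ] ℝ).contDiff.comp h3
  exact Complex.ofRealCLM.contDiff.comp h4

/-- Multiplication by the Jacobian matrix of `F` along the wave. -/
def jacOp {F : EuclideanSpace ℝ (Fin n) → EuclideanSpace ℝ (Fin n)} (hF : ContDiff ℝ ∞ F) :
    L2 n →L[ℂ] L2 n :=
  mulOp (matFun (fun i l x => ((fderiv ℝ F (P.U x) (EuclideanSpace.single l 1) i : ℝ) : ℂ))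
    fun i l => continuous_of_lift (contDiff_jacEntry P hF i l).continuous)

theorem coeff_jacOp {F : EuclideanSpace ℝ (Fin n) → EuclideanSpace ℝ (Fin n)} (hF : ContDiff ℝ ∞ F)
    (V : L2 n) (k : Fin 2 → ℤ) :
    mFourierCoeff (jacOp P hF V) k = mFourierCoeff (fun x => dC F (P.U x) (V x)) k := by
  refine coeff_congr ?_ k
  filter_upwards [coeFn_mulOp (matFun (fun i l x =>
    ((fderiv ℝ F (P.U x) (EuclideanSpace.single l 1) i : ℝ) : ℂ))
    fun i l => continuous_of_lift (contDiff_jacEntry P hF i l).continuous) V] with x hx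
  rw [jacOp, hx, matFun_apply]
  rfl

theorem jacOp_mem {F : EuclideanSpace ℝ (Fin n) → EuclideanSpace ℝ (Fin n)} (hF : ContDiff ℝ ∞ F)
    {V : L2 n} (hV : V ∈ LinearMap.range (bessel n : L2 n →ₗ[ℂ] L2 n)) :
    jacOp P hF V ∈ LinearMap.range (bessel n : L2 n →ₗ[ℂ] L2 n) :=
  matFun_mul_mem _ (contDiff_jacEntry P hF) hV

end Jacobian

/-! ### Gain of regularity by multipliers of order `-1` and `-2`. -/

section Regularity

variable {n : ℕ}

theorem IsH2.mem_range_bessel {V : L2 n} (hV : IsH2 V) :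
    V ∈ LinearMap.range (bessel n : L2 n →ₗ[ℂ] L2 n) := by
  rw [BlochWave.mem_range_bessel]
  refine Summable.of_nonneg_of_le (fun k => by positivity) (fun k => ?_) hV
  rw [← weight_sq]
  gcongr
  · exact (weight_pos k).le
  · exact le_self_pow₀ (one_le_weight k) two_ne_zero

theorem isH2_multiplier_of_sq {m : (Fin 2 → ℤ) → ℂ} {C : ℝ} (hm : ∀ k, weight k ^ 2 * ‖m k‖ ≤ C)
    (V : L2 n) : IsH2 (multiplier n m V) := by
  have hm' : ∀ k, ‖m k‖ ≤ C := fun k =>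
    (le_mul_of_one_le_left (norm_nonneg _) (one_le_pow₀ (one_le_weight k))).trans (hm k)
  refine Summable.of_nonneg_of_le (fun k => by positivity) (fun k => ?_)
    ((summable_coeff_sq V).mul_left (C ^ 2))
  rw [coeff_multiplier hm', norm_smul, ← weight_sq]
  have := pow_le_pow_left₀ (by positivity) (hm k) 2
  nlinarith [mul_le_mul_of_nonneg_right this (sq_nonneg ‖mFourierCoeff V k‖)]

theorem multiplier_mem_range_bessel {m : (Fin 2 → ℤ) → ℂ} {C : ℝ} (hm : ∀ k, weight k * ‖m k‖ ≤ C)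
    (V : L2 n) : multiplier n m V ∈ LinearMap.range (bessel n : L2 n →ₗ[ℂ] L2 n) := by
  have hm' : ∀ k, ‖m k‖ ≤ C := fun k =>
    (le_mul_of_one_le_left (norm_nonneg _) (one_le_weight k)).trans (hm k)
  rw [mem_range_bessel]
  refine Summable.of_nonneg_of_le (fun k => by positivity) (fun k => ?_)
    ((summable_coeff_sq V).mul_left (C ^ 2))
  rw [coeff_multiplier hm', norm_smul]
  have hw := (weight_pos k).le
  have := pow_le_pow_left₀ (by positivity) (hm k) 2
  nlinarith [mul_le_mul_of_nonneg_right this (sq_nonneg ‖mFourierCoeff V k‖)]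

theorem isH2_multiplier {m : (Fin 2 → ℤ) → ℂ} {C : ℝ} (hm : ∀ k, weight k * ‖m k‖ ≤ C)
    {V : L2 n} (hV : V ∈ LinearMap.range (bessel n : L2 n →ₗ[ℂ] L2 n)) :
    IsH2 (multiplier n m V) := by
  have hm' : ∀ k, ‖m k‖ ≤ C := fun k =>
    (le_mul_of_one_le_left (norm_nonneg _) (one_le_weight k)).trans (hm k)
  rw [mem_range_bessel] at hV
  refine Summable.of_nonneg_of_le (fun k => by positivity) (fun k => ?_) (hV.mul_left (C ^ 2))
  rw [coeff_multiplier hm', norm_smul, ← weight_sq]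
  have hw := (weight_pos k).le
  have := pow_le_pow_left₀ (by positivity) (hm k) 2
  have h2 := mul_le_mul_of_nonneg_right this
    (mul_nonneg (sq_nonneg (weight k)) (sq_nonneg ‖mFourierCoeff V k‖))
  refine le_trans (le_of_eq ?_) h2
  ring

end Regularity

/-! ### The preconditioned Bloch operator and its resolvent. -/

section Preconditioner

variable {n r : ℕ} (P : PeriodicWave n r)

/-- The frequency vector `2π K k`. -/
def freq (k : Fin 2 → ℤ) (m : Fin 2) : ℝ := ∑ j, P.K m j * (2 * Real.pi * (k j : ℝ))

/-- The vector `K ξ`. -/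
def shift (ξ : EuclideanSpace ℝ (Fin 2)) (m : Fin 2) : ℂ := ((∑ j, P.K m j * ξ j : ℝ) : ℂ)

theorem symb_eq (ξ : EuclideanSpace ℝ (Fin 2)) (k : Fin 2 → ℤ) (m : Fin 2) :
    symb P ξ k m = Complex.I * (freq P k m + shift P ξ m) := by
  rw [symb, freq, shift, ← Complex.ofReal_add, ← Finset.sum_add_distrib]
  simp only [mul_add]

variable (s : ℝ)

/-- The symbol `s² + |2π K k|²` of `s² - (K∇)ᵀ(K∇)`. -/
def den (k : Fin 2 → ℤ) : ℝ := s ^ 2 + ∑ m, freq P k m ^ 2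

variable {s}

theorem den_pos (hs : 0 < s) (k : Fin 2 → ℤ) : 0 < den P s k := by
  unfold den; positivity

theorem freq_sq_le (k : Fin 2 → ℤ) (m : Fin 2) : freq P k m ^ 2 ≤ den P s k := by
  have := Finset.single_le_sum (f := fun m => freq P k m ^ 2) (fun _ _ => sq_nonneg _)
    (Finset.mem_univ m)
  unfold den
  nlinarith [sq_nonneg s]

theorem mul_freq_le (k : Fin 2 → ℤ) (m : Fin 2) : s * |freq P k m| ≤ den P s k := by
  have h1 := Finset.single_le_sum (f := fun m => freq P k m ^ 2) (fun _ _ => sq_nonneg _)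
    (Finset.mem_univ m)
  unfold den
  have h2 : |freq P k m| ^ 2 = freq P k m ^ 2 := sq_abs _
  nlinarith [sq_nonneg (s - |freq P k m|)]

/-- Ellipticity: since `K` is invertible, `2π k` is recovered from `2π K k` by `K⁻¹`, and
Cauchy–Schwarz bounds each component. -/
theorem sq_le_freq (k : Fin 2 → ℤ) (j : Fin 2) :
    (k j : ℝ) ^ 2 ≤ (∑ m, P.K⁻¹ j m ^ 2) * ∑ m, freq P k m ^ 2 := by
  have hu : IsUnit P.K.det := isUnit_iff_ne_zero.2 P.det_K
  have h0 : freq P k = P.K.mulVec fun j => 2 * Real.pi * (k j : ℝ) := rfl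
  have h1 : P.K⁻¹.mulVec (freq P k) = fun j => 2 * Real.pi * (k j : ℝ) := by
    rw [h0, Matrix.mulVec_mulVec, Matrix.nonsing_inv_mul _ hu, Matrix.one_mulVec]
  have h2 : ∑ m, P.K⁻¹ j m * freq P k m = 2 * Real.pi * (k j : ℝ) := congrFun h1 j
  have h3 := Finset.sum_mul_sq_le_sq_mul_sq Finset.univ (fun m => P.K⁻¹ j m) (freq P k)
  rw [h2] at h3
  have h4 : (1 : ℝ) ≤ 2 * Real.pi := by have := Real.pi_gt_three; linarith
  nlinarith [sq_nonneg ((k j : ℝ)), mul_self_le_mul_self zero_le_one h4]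

theorem exists_weight_sq_le (hs : 0 < s) : ∃ C, 0 ≤ C ∧ ∀ k, weight k ^ 2 ≤ C * den P s k := by
  refine ⟨(s ^ 2)⁻¹ + ∑ j, ∑ m, P.K⁻¹ j m ^ 2, by positivity, fun k => ?_⟩
  have h : ∑ j, (k j : ℝ) ^ 2 ≤ (∑ j, ∑ m, P.K⁻¹ j m ^ 2) * ∑ m, freq P k m ^ 2 := by
    rw [Finset.sum_mul]
    exact Finset.sum_le_sum fun j _ => sq_le_freq P k j
  rw [weight_sq, den]
  have h1 : (s ^ 2)⁻¹ * s ^ 2 = 1 := inv_mul_cancel₀ (by positivity)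
  have h2 : 0 ≤ (s ^ 2)⁻¹ * ∑ m, freq P k m ^ 2 := by positivity
  have h3 : 0 ≤ (∑ j, ∑ m, P.K⁻¹ j m ^ 2) * s ^ 2 := by positivity
  nlinarith

variable (s)

/-- The symbol of `(s² - (K∇)ᵀ(K∇))⁻¹`. -/
def invSymb (k : Fin 2 → ℤ) : ℂ := (((den P s k)⁻¹ : ℝ) : ℂ)

/-- The symbol of `(s² - (K∇)ᵀ(K∇))⁻¹ (K∇)ₘ`. -/
def gradInvSymb (m : Fin 2) (k : Fin 2 → ℤ) : ℂ :=
  Complex.I * ((freq P k m * (den P s k)⁻¹ : ℝ) : ℂ)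

/-- The operator `(s² - (K∇)ᵀ(K∇))⁻¹`. -/
def invOp : L2 n →L[ℂ] L2 n := multiplier n (invSymb P s)

/-- The operator `(s² - (K∇)ᵀ(K∇))⁻¹ (K∇)ₘ`. -/
def gradInvOp (m : Fin 2) : L2 n →L[ℂ] L2 n := multiplier n (gradInvSymb P s m)

variable {s}

theorem norm_invSymb (hs : 0 < s) (k : Fin 2 → ℤ) : ‖invSymb P s k‖ = (den P s k)⁻¹ := by
  rw [invSymb, Complex.norm_real, norm_inv, Real.norm_of_nonneg (den_pos P hs k).le]

theorem norm_gradInvSymb (hs : 0 < s) (m : Fin 2) (k : Fin 2 → ℤ) :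
    ‖gradInvSymb P s m k‖ = |freq P k m| * (den P s k)⁻¹ := by
  rw [gradInvSymb, norm_mul, Complex.norm_I, one_mul, Complex.norm_real, norm_mul, norm_inv,
    Real.norm_of_nonneg (den_pos P hs k).le, Real.norm_eq_abs]

theorem norm_invSymb_le (hs : 0 < s) (k : Fin 2 → ℤ) : ‖invSymb P s k‖ ≤ (s ^ 2)⁻¹ := by
  rw [norm_invSymb P hs]
  refine inv_anti₀ (by positivity) ?_
  unfold den
  exact le_add_of_nonneg_right (by positivity)

theorem norm_gradInvSymb_le (hs : 0 < s) (m : Fin 2) (k : Fin 2 → ℤ) :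
    ‖gradInvSymb P s m k‖ ≤ s⁻¹ := by
  rw [norm_gradInvSymb P hs, ← div_eq_mul_inv, div_le_iff₀ (den_pos P hs k), inv_mul_eq_div,
    le_div_iff₀ hs, mul_comm]
  exact mul_freq_le P k m

theorem coeff_invOp (hs : 0 < s) (V : L2 n) (k : Fin 2 → ℤ) :
    mFourierCoeff (invOp P s V) k = invSymb P s k • mFourierCoeff V k :=
  coeff_multiplier (norm_invSymb_le P hs) V k

theorem coeff_gradInvOp (hs : 0 < s) (m : Fin 2) (V : L2 n) (k : Fin 2 → ℤ) :
    mFourierCoeff (gradInvOp P s m V) k = gradInvSymb P s m k • mFourierCoeff V k :=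
  coeff_multiplier (norm_gradInvSymb_le P hs m) V k

theorem norm_invOp_le (hs : 0 < s) : ‖invOp (n := n) P s‖ ≤ (s ^ 2)⁻¹ :=
  norm_diagOp_le _ (by positivity) fun i => norm_invSymb_le P hs i.1

theorem norm_gradInvOp_le (hs : 0 < s) (m : Fin 2) : ‖gradInvOp (n := n) P s m‖ ≤ s⁻¹ :=
  norm_diagOp_le _ (by positivity) fun i => norm_gradInvSymb_le P hs m i.1

theorem isH2_invOp (hs : 0 < s) (V : L2 n) : IsH2 (invOp P s V) := by
  obtain ⟨C, -, hC⟩ := exists_weight_sq_le P hs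
  refine isH2_multiplier_of_sq (C := C) (fun k => ?_) V
  rw [norm_invSymb P hs, ← div_eq_mul_inv, div_le_iff₀ (den_pos P hs k)]
  exact hC k

theorem exists_weight_mul_gradInvSymb_le (hs : 0 < s) (m : Fin 2) :
    ∃ C, ∀ k, weight k * ‖gradInvSymb P s m k‖ ≤ C := by
  obtain ⟨C, hC0, hC⟩ := exists_weight_sq_le P hs
  refine ⟨Real.sqrt C, fun k => ?_⟩
  have hd := den_pos P hs k
  rw [norm_gradInvSymb P hs, ← div_eq_mul_inv, ← mul_div_assoc, div_le_iff₀ hd]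
  refine le_of_sq_le_sq ?_ (by positivity)
  rw [mul_pow, mul_pow, sq_abs, Real.sq_sqrt hC0, sq (den P s k), ← mul_assoc]
  exact mul_le_mul (hC k) (freq_sq_le P k m) (sq_nonneg _) (by positivity)

theorem injective_invOp (hs : 0 < s) : Function.Injective (invOp (n := n) P s) := by
  intro V W h
  refine coeff_ext fun k => ?_
  have h1 := coeff_invOp P hs V k
  rw [h, coeff_invOp P hs] at h1
  refine (smul_right_injective _ (?_ : invSymb P s k ≠ 0) h1).symm
  rw [invSymb]
  exact Complex.ofReal_ne_zero.2 (inv_ne_zero (den_pos P hs k).ne')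

theorem denseRange_invOp (hs : 0 < s) : DenseRange (invOp (n := n) P s) := by
  have h : Dense ((LinearMap.range (invOp (n := n) P s : L2 n →ₗ[ℂ] L2 n) : Submodule ℂ (L2 n)) : Set (L2 n)) := by
    refine (Submodule.dense_iff_topologicalClosure_eq_top.2 (fourierBasis n).dense_span).mono ?_
    refine Submodule.span_le.2 ?_
    rintro _ ⟨i, rfl⟩
    refine ⟨((den P s i.1 : ℝ) : ℂ) • fourierBasis n i, ?_⟩
    rw [ContinuousLinearMap.coe_coe, map_smul, invOp, multiplier_basis (norm_invSymb_le P hs), smul_smul,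
      invSymb, ← Complex.ofReal_mul, mul_inv_cancel₀ (den_pos P hs i.1).ne', Complex.ofReal_one, one_smul]
  exact h

theorem tendsto_weight : Tendsto (fun k => weight k) cofinite atTop := by
  rw [tendsto_atTop]
  intro C
  rw [eventually_cofinite]
  refine Set.Finite.subset (Set.Finite.pi' fun _ : Fin 2 => Set.finite_Icc (-⌈C⌉) ⌈C⌉) ?_
  intro k hk j
  have h1 : |(k j : ℝ)| ≤ ⌈C⌉ := (abs_le_weight k j).trans ((not_le.1 hk).le.trans (Int.le_ceil C))
  rw [abs_le] at h1
  exact ⟨by exact_mod_cast h1.1, by exact_mod_cast h1.2⟩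

theorem isCompactOperator_invOp (hs : 0 < s) : IsCompactOperator (invOp (n := n) P s) := by
  refine isCompactOperator_diagOp _ ?_
  obtain ⟨C, hC0, hC⟩ := exists_weight_sq_le P hs
  have h1 : Tendsto (fun i : (Fin 2 → ℤ) × Fin n => weight i.1) cofinite atTop := by
    refine tendsto_atTop.2 fun a => ?_
    have h := tendsto_atTop.1 tendsto_weight a
    rw [eventually_cofinite] at h ⊢
    refine (h.prod (Set.finite_univ (α := Fin n))).subset fun i hi => ⟨hi, mem_univ _⟩
  have h2 : Tendsto (fun i : (Fin 2 → ℤ) × Fin n => C * (weight i.1 ^ 2)⁻¹) cofinite (𝓝 0) := by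
    simpa using ((tendsto_pow_atTop two_ne_zero).comp h1).inv_tendsto_atTop.const_mul C
  refine squeeze_zero_norm (fun i => ?_) h2
  rw [norm_invSymb P hs, ← div_eq_mul_inv, le_div_iff₀ (by have := weight_pos i.1; positivity),
    inv_mul_le_iff₀ (den_pos P hs _), mul_comm]
  exact hC i.1

variable (s)

/-- The operator `(s² - (K∇)ᵀ(K∇))⁻¹ (L - s²)`, where `L` is the Bloch operator with `K ξ`
replaced by the complex vector `κ`. -/
def preOp (κ : Fin 2 → ℂ) : L2 n →L[ℂ] L2 n :=
  -1 + invOp P s * (jacOp P P.smooth_f +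
      ∑ m, (-(κ m ^ 2) • 1 + (Complex.I * κ m) • (jacOp P (P.smooth_G m) + (P.c m : ℂ) • 1)))
    + ∑ m, gradInvOp P s m * ((2 * Complex.I * κ m) • 1 + jacOp P (P.smooth_G m) + (P.c m : ℂ) • 1)

theorem contDiff_preOp : ContDiff ℂ ω (preOp (n := n) P s) := by
  unfold preOp
  have h : ∀ m, ContDiff ℂ ω fun κ : Fin 2 → ℂ => κ m := fun m => contDiff_apply ℂ ℂ m
  refine ContDiff.add (ContDiff.add contDiff_const (ContDiff.mul contDiff_const
    (ContDiff.add contDiff_const (ContDiff.sum fun m _ => ?_)))) (ContDiff.sum fun m _ => ?_)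
  · exact (((h m).pow 2).neg.smul contDiff_const).add ((contDiff_const.mul (h m)).smul contDiff_const)
  · exact ContDiff.mul contDiff_const
      ((((contDiff_const.mul (h m)).smul contDiff_const).add contDiff_const).add contDiff_const)

variable {s}

theorem preOp_apply (κ : Fin 2 → ℂ) (V : L2 n) : preOp P s κ V =
    -V + invOp P s (jacOp P P.smooth_f V + ∑ m, (-(κ m ^ 2) • V
      + (Complex.I * κ m) • (jacOp P (P.smooth_G m) V + (P.c m : ℂ) • V)))
    + ∑ m, gradInvOp P s m ((2 * Complex.I * κ m) • V + jacOp P (P.smooth_G m) V + (P.c m : ℂ) • V) := by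
  simp only [preOp, add_apply, sum_apply, neg_apply, mul_apply_eq_comp, smul_apply, one_apply_eq_self]

theorem coeff_neg (V : L2 n) (k : Fin 2 → ℤ) : mFourierCoeff (-V : L2 n) k = -mFourierCoeff V k := by
  rw [← neg_one_smul ℂ V, coeff_coe_smul, neg_one_smul]

/-- Explains the formula for `preOp`. With `κ = Kξ`, expanding `(i (freq + κ))²` shows that `L_ξ -
s²` is `-den` plus terms with at most one factor `freq`; dividing by `den` leaves `-1` plus bounded
operators with coefficients polynomial in `κ`. -/
theorem coeff_preOp (hs : 0 < s) (ξ : EuclideanSpace ℝ (Fin 2)) (V : L2 n) (k : Fin 2 → ℤ) :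
    mFourierCoeff (preOp P s (shift P ξ) V) k
      = invSymb P s k • (blochCoeff P ξ V k - (s ^ 2 : ℂ) • mFourierCoeff V k) := by
  rw [preOp_apply]
  have hd : ((den P s k : ℝ) : ℂ) ≠ 0 := Complex.ofReal_ne_zero.2 (den_pos P hs k).ne'
  have hden : ((den P s k : ℝ) : ℂ) = s ^ 2 + (freq P k 0 ^ 2 + freq P k 1 ^ 2) := by
    rw [den, Fin.sum_univ_two]; push_cast; ring
  simp only [Fin.sum_univ_two, coeff_coe_add, coeff_neg, coeff_invOp P hs, coeff_gradInvOp P hs,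
    coeff_coe_smul, coeff_jacOp, blochCoeff, symb_eq, invSymb, gradInvSymb, Complex.ofReal_mul,
    Complex.ofReal_inv]
  generalize mFourierCoeff (fun x => dC P.f (P.U x) (V x)) k = a
  generalize mFourierCoeff (fun x => dC (P.G 0) (P.U x) (V x)) k = b
  generalize mFourierCoeff (fun x => dC (P.G 1) (P.U x) (V x)) k = c
  generalize mFourierCoeff V k = v
  have hI : Complex.I ^ 2 = -1 := Complex.I_sq
  -- The term `-V` is the only one without a factor `den⁻¹`; inserting `den⁻¹ den` there makes the
  -- identity polynomial in the remaining symbols.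
  have hv : v = ((((den P s k : ℝ) : ℂ))⁻¹ * (s ^ 2 + (freq P k 0 ^ 2 + freq P k 1 ^ 2))) • v := by
    rw [← hden, inv_mul_cancel₀ hd, one_smul]
  generalize ((den P s k : ℝ) : ℂ)⁻¹ = d at *
  nth_rewrite 1 [hv]
  clear hv
  match_scalars <;> first
    | (ring1)
    | linear_combination (-d * (freq P k 0 ^ 2 + freq P k 1 ^ 2 + shift P ξ 0 ^ 2 + shift P ξ 1 ^ 2)) * hI

theorem invOp_eq_preOp_iff (hs : 0 < s) (ξ : EuclideanSpace ℝ (Fin 2)) (V W : L2 n) :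
    invOp P s (W - (s ^ 2 : ℂ) • V) = preOp P s (shift P ξ) V ↔
      ∀ k, mFourierCoeff W k = blochCoeff P ξ V k := by
  have hne : ∀ k, invSymb P s k ≠ 0 := fun k =>
    Complex.ofReal_ne_zero.2 (inv_ne_zero (den_pos P hs k).ne')
  have hsub : ∀ k, mFourierCoeff (W - (s ^ 2 : ℂ) • V : L2 n) k
      = mFourierCoeff W k - (s ^ 2 : ℂ) • mFourierCoeff V k := fun k => by
    rw [sub_eq_add_neg, coeff_coe_add, coeff_neg, coeff_coe_smul, sub_eq_add_neg]
  constructor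
  · intro h k
    have h1 := congrArg (fun X : L2 n => mFourierCoeff X k) h
    simp only [coeff_invOp P hs, coeff_preOp P hs, hsub] at h1
    exact sub_left_injective (smul_right_injective _ (hne k) h1)
  · intro h
    refine coeff_ext fun k => ?_
    rw [coeff_invOp P hs, coeff_preOp P hs, hsub, h k]

/-- The `H²` condition in the domain is automatic, by bootstrap: the bounded identity expresses `V`
by operators of order `-2` applied to `L²` functions and operators of order `-1` applied to `Y m`.
First `V` is in `H¹`, then so is `Y m`, and finally `V` is in `H²`. -/
theorem mem_graph_bloch_iff (hs : 0 < s) (ξ : EuclideanSpace ℝ (Fin 2)) (V W : L2 n) :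
    (V, W) ∈ (bloch P ξ).graph ↔
      invOp P s (W - (s ^ 2 : ℂ) • V) = preOp P s (shift P ξ) V := by
  have hg : (V, W) ∈ (bloch P ξ).graph ↔ IsH2 V ∧ ∀ k, mFourierCoeff W k = blochCoeff P ξ V k := by
    rw [bloch, Submodule.toLinearPMap_graph_eq _ fun p hp => blochGraph_single P ξ p hp]
    rfl
  rw [hg, ← invOp_eq_preOp_iff P hs, and_iff_right_iff_imp]
  intro h
  rw [preOp_apply] at h
  have hb : ∀ m, ∃ C, ∀ k, weight k * ‖gradInvSymb P s m k‖ ≤ C :=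
    exists_weight_mul_gradInvSymb_le P hs
  let X := jacOp P P.smooth_f V + ∑ m, (-(shift P ξ m ^ 2) • V
      + (Complex.I * shift P ξ m) • (jacOp P (P.smooth_G m) V + (P.c m : ℂ) • V))
  let Y := fun m => (2 * Complex.I * shift P ξ m) • V + jacOp P (P.smooth_G m) V + (P.c m : ℂ) • V
  have hV : V = invOp P s (X - (W - (s ^ 2 : ℂ) • V)) + ∑ m, gradInvOp P s m (Y m) := by
    rw [map_sub, h]
    change V = invOp P s X - (-V + invOp P s X + ∑ m, gradInvOp P s m (Y m)) + ∑ m, gradInvOp P s m (Y m)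
    abel
  have h1 : V ∈ LinearMap.range (bessel n : L2 n →ₗ[ℂ] L2 n) := by
    rw [hV]
    refine add_mem (isH2_invOp P hs _).mem_range_bessel (sum_mem fun m _ => ?_)
    exact multiplier_mem_range_bessel (hb m).choose_spec _
  have h2 : ∀ m, Y m ∈ LinearMap.range (bessel n : L2 n →ₗ[ℂ] L2 n) := fun m =>
    add_mem (add_mem (Submodule.smul_mem _ _ h1) (jacOp_mem P (P.smooth_G m) h1))
      (Submodule.smul_mem _ _ h1)
  have h3 : ∀ m, IsH2 (gradInvOp P s m (Y m)) := fun m =>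
    isH2_multiplier (hb m).choose_spec (h2 m)
  rw [hV, Fin.sum_univ_two]
  exact (isH2_invOp P hs _).add ((h3 0).add (h3 1))

theorem mem_graph_bloch_iff_coeff (ξ : EuclideanSpace ℝ (Fin 2)) (V W : L2 n) :
    (V, W) ∈ (bloch P ξ).graph ↔ ∀ k, mFourierCoeff W k = blochCoeff P ξ V k :=
  (mem_graph_bloch_iff P one_pos ξ V W).trans (invOp_eq_preOp_iff P one_pos ξ V W)

/-- Neumann series: the terms of order zero cost `s⁻²`, at most `s⁻¹`, and the terms of order one
cost `s⁻¹`, so a large `s` makes the perturbation of `-1` smaller than one. -/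
theorem isUnit_preOp_zero (hs1 : 1 ≤ s)
    (hs : ‖jacOp P P.smooth_f‖ + ∑ m, (‖jacOp P (P.smooth_G m)‖ + ‖(P.c m : ℂ)‖) < s) :
    IsUnit (preOp (n := n) P s 0) := by
  have hs0 : 0 < s := by linarith
  let Z : L2 n →L[ℂ] L2 n := invOp P s * jacOp P P.smooth_f
    + ∑ m, gradInvOp P s m * (jacOp P (P.smooth_G m) + (P.c m : ℂ) • 1)
  have e : preOp (n := n) P s 0 = -(1 - Z) := by
    simp only [preOp, Z, Pi.zero_apply, mul_zero, zero_smul, ne_eq, OfNat.ofNat_ne_zero, not_false_eq_true,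
      zero_pow, neg_zero, add_zero, Finset.sum_const_zero, zero_add]
    abel
  have h1 : ‖invOp (n := n) P s‖ ≤ s⁻¹ := (norm_invOp_le P hs0).trans
    (inv_anti₀ hs0 (by nlinarith))
  have hone : ‖(1 : L2 n →L[ℂ] L2 n)‖ ≤ 1 := ContinuousLinearMap.norm_id_le
  have hZ : ‖Z‖ < 1 := by
    calc ‖Z‖ ≤ ‖invOp P s * jacOp P P.smooth_f‖
        + ∑ m, ‖gradInvOp P s m * (jacOp P (P.smooth_G m) + (P.c m : ℂ) • 1)‖ :=
          (norm_add_le _ _).trans (add_le_add_right (norm_sum_le _ _) _)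
      _ ≤ s⁻¹ * ‖jacOp P P.smooth_f‖ + ∑ m, s⁻¹ * (‖jacOp P (P.smooth_G m)‖ + ‖(P.c m : ℂ)‖) := by
          gcongr with m
          · exact (norm_mul_le _ _).trans (by gcongr)
          · refine (norm_mul_le _ _).trans ?_
            gcongr
            · exact norm_gradInvOp_le P hs0 m
            · refine (norm_add_le _ _).trans ?_
              gcongr
              rw [norm_smul]
              exact mul_le_of_le_one_right (norm_nonneg _) hone
      _ = s⁻¹ * (‖jacOp P P.smooth_f‖ + ∑ m, (‖jacOp P (P.smooth_G m)‖ + ‖(P.c m : ℂ)‖)) := by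
          rw [mul_add, Finset.mul_sum]
      _ < s⁻¹ * s := by gcongr
      _ = 1 := inv_mul_cancel₀ hs0.ne'
  rw [e]
  exact (isUnit_one_sub_of_norm_lt_one hZ).neg

variable (s)

/-- The resolvent at `s²` of the Bloch operator, where `K ξ` is replaced by the complex vector
`κ`. -/
def resolventOp (κ : Fin 2 → ℂ) : L2 n →L[ℂ] L2 n := Ring.inverse (preOp P s κ) * invOp P s

variable {s}

theorem isResolvent_resolventOp (hs : 0 < s) {ξ : EuclideanSpace ℝ (Fin 2)}
    (hu : IsUnit (preOp (n := n) P s (shift P ξ))) :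
    IsResolvent (bloch P ξ) (s ^ 2 : ℝ) (resolventOp P s (shift P ξ)) := by
  intro V W
  rw [mem_graph_bloch_iff P hs, resolventOp, mul_apply_eq_comp, Complex.ofReal_pow]
  constructor
  · intro h
    rw [h, ← mul_apply_eq_comp, Ring.inverse_mul_cancel _ hu, one_apply_eq_self]
  · intro h
    conv_rhs => rw [← h]
    rw [← mul_apply_eq_comp, Ring.mul_inverse_cancel _ hu, one_apply_eq_self]

theorem contDiffAt_resolventOp (hu : IsUnit (preOp (n := n) P s 0)) :
    ContDiffAt ℂ ω (resolventOp (n := n) P s) 0 := by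
  obtain ⟨u, hu⟩ := hu
  have h : ContDiffAt ℂ ω (Ring.inverse : (L2 n →L[ℂ] L2 n) → _) (preOp (n := n) P s 0) := by
    rw [← hu]
    exact contDiffAt_ringInverse ℂ u
  exact (h.comp (0 : Fin 2 → ℂ) (contDiff_preOp P s).contDiffAt).mul contDiffAt_const

theorem isCompactOperator_resolventOp (hs : 0 < s) (κ : Fin 2 → ℂ) :
    IsCompactOperator (resolventOp (n := n) P s κ) :=
  (isCompactOperator_invOp P hs).clm_comp _

theorem eventually_isUnit_preOp (hu : IsUnit (preOp (n := n) P s 0)) :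
    ∀ᶠ κ in 𝓝 0, IsUnit (preOp (n := n) P s κ) :=
  (contDiff_preOp P s).continuous.continuousAt.eventually (Units.isOpen.mem_nhds hu)

/-- The domain contains the range of the resolvent, which is the image of a dense range by an
invertible operator. Density makes the adjoint meaningful. -/
theorem dense_domain_bloch (hs : 0 < s) {ξ : EuclideanSpace ℝ (Fin 2)}
    (hu : IsUnit (preOp (n := n) P s (shift P ξ))) : Dense ((bloch P ξ).domain : Set (L2 n)) := by
  have h1 : DenseRange (resolventOp (n := n) P s (shift P ξ)) := by
    have h2 : Function.Surjective (Ring.inverse (preOp (n := n) P s (shift P ξ)) : L2 n →L[ℂ] L2 n) := fun V =>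
      ⟨preOp P s (shift P ξ) V, by
        rw [← mul_apply_eq_comp, Ring.inverse_mul_cancel _ hu, one_apply_eq_self]⟩
    exact h2.denseRange.comp (denseRange_invOp P hs) (ContinuousLinearMap.continuous _)
  refine h1.mono ?_
  rintro _ ⟨V, rfl⟩
  have h := (isResolvent_resolventOp P hs hu (resolventOp P s (shift P ξ) V)
    (V + ((s ^ 2 : ℝ) : ℂ) • resolventOp P s (shift P ξ) V)).2 (by rw [add_sub_cancel_right])
  exact LinearPMap.mem_domain_of_mem_graph h

end Preconditioner

/-! ### Smooth dependence of determinants and inverse matrices. -/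

section Matrices

variable {X : Type*} [NormedAddCommGroup X] [NormedSpace ℝ X] {ι : Type*} [Fintype ι] [DecidableEq ι]
  {N : WithTop ℕ∞} {s : Set X} {x : X} {g : X → Matrix ι ι ℂ}

theorem contDiffWithinAt_det (hg : ∀ a b, ContDiffWithinAt ℝ N (fun y => g y a b) s x) :
    ContDiffWithinAt ℝ N (fun y => (g y).det) s x := by
  simp only [Matrix.det_apply']
  exact ContDiffWithinAt.sum fun σ _ => contDiffWithinAt_const.mul
    (contDiffWithinAt_prod fun i _ => hg _ _)

theorem contDiffWithinAt_inv (hg : ∀ a b, ContDiffWithinAt ℝ N (fun y => g y a b) s x)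
    (h0 : (g x).det ≠ 0) (a b : ι) : ContDiffWithinAt ℝ N (fun y => (g y)⁻¹ a b) s x := by
  simp only [Matrix.inv_def, Ring.inverse_eq_inv', Matrix.smul_apply, smul_eq_mul,
    Matrix.adjugate_apply]
  refine ((contDiffWithinAt_det hg).inv h0).mul (contDiffWithinAt_det fun c d => ?_)
  by_cases hc : c = b
  · subst hc
    simp only [Matrix.updateRow_self]
    exact contDiffWithinAt_const
  · simp only [Matrix.updateRow_ne hc]
    exact hg c d

end Matrices

/-! ### Smooth families of dual bases of spectral subspaces. -/

section DualBases

variable {E : Type*} [NormedAddCommGroup E] [InnerProductSpace ℂ E] [CompleteSpace E]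
  [NormedSpace ℝ E] [IsScalarTower ℝ ℂ E]

/-- `M` is the range of a projection onto a sum of generalized eigenspaces of `B` for eigenvalues in
the disk of radius `ε₂`, which contains all those for eigenvalues in the disk of radius `ε₁`. -/
def IsSpectralRange (ε₁ ε₂ : ℝ) (B : E →L[ℂ] E) (M : Submodule ℂ E) : Prop :=
  ∃ S : E →L[ℂ] E,
    (∀ ν : ℂ, ‖ν‖ < ε₁ → ∀ v ∈ Module.End.maxGenEigenspace (B : Module.End ℂ E) ν, S v = v) ∧
    (∀ v, S v ∈ ⨆ ν ∈ Metric.ball (0 : ℂ) ε₂, Module.End.maxGenEigenspace (B : Module.End ℂ E) ν) ∧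
    LinearMap.range (S : E →ₗ[ℂ] E) = M

variable {X : Type*} [NormedAddCommGroup X] [NormedSpace ℝ X]

/-- The basis of a spectral subspace extends to a smooth family of bases. -/
theorem exists_spectral_family {A : X → E →L[ℂ] E} (hA : ContDiffAt ℝ ω A 0) {p r : E →L[ℂ] E}
    (h : RieszSplitting (A 0) p r) [FiniteDimensional ℂ (LinearMap.range (p : E →ₗ[ℂ] E))]
    {ι : Type*} {q : ι → E} (hq : Submodule.span ℂ (range q) = LinearMap.range (p : E →ₗ[ℂ] E)) :
    ∃ Q : ι → X → E, (∀ a, ContDiffAt ℝ ω (Q a) 0) ∧ (∀ a, Q a 0 = q a) ∧ ∃ ε₁ > 0, ∀ ε₂ > 0,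
      ∀ᶠ ξ in 𝓝 0, IsSpectralRange ε₁ ε₂ (A ξ) (Submodule.span ℂ (range fun a => Q a ξ)) := by
  obtain ⟨S, hS, hS0, ε₁, hε₁, hev⟩ := h.exists_projection
  -- The initial basis is projected. Since `S B * p = S B`, the images of vectors spanning the range
  -- of `p` still span the range of `S B`.
  refine ⟨fun a ξ => S (A ξ) (q a), fun a => ?_, fun a => ?_, ε₁, hε₁, fun ε₂ hε₂ => ?_⟩
  · have h1 : ContDiffAt ℝ ω (fun ξ => S (A ξ)) 0 := (hS.restrict_scalars ℝ).comp (0 : X) hA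
    exact ((((ContinuousLinearMap.apply ℂ E (q a)).contDiff (n := ω)).restrict_scalars ℝ).contDiffAt).comp
      (0 : X) h1
  · have h1 : q a ∈ LinearMap.range (p : E →ₗ[ℂ] E) := hq ▸ Submodule.subset_span (mem_range_self a)
    obtain ⟨v, hv⟩ := h1
    change S (A 0) (q a) = q a
    rw [hS0, ← hv, ContinuousLinearMap.coe_coe, ← mul_apply_eq_comp, h.idem]
  · filter_upwards [hA.continuousAt.eventually (hev ε₂ hε₂)] with ξ hξ
    refine ⟨S (A ξ), hξ.2.1, hξ.2.2, ?_⟩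
    have e : LinearMap.range (S (A ξ) : E →ₗ[ℂ] E)
        = (LinearMap.range (p : E →ₗ[ℂ] E)).map (S (A ξ) : E →ₗ[ℂ] E) := by
      conv_lhs => rw [← hξ.1]
      rw [← LinearMap.range_comp]
      rfl
    rw [e, ← hq, Submodule.map_span, ← range_comp]
    rfl

omit [CompleteSpace E] in
/-- Two smooth families of bases that are dual to each other at a point can be made dual near this
point. -/
theorem exists_dual_family {ι : Type*} [Fintype ι] [DecidableEq ι] {Q W : ι → X → E}
    (hQ : ∀ a, ContDiffAt ℝ ω (Q a) 0) (hW : ∀ a, ContDiffAt ℝ ω (W a) 0)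
    (h0 : ∀ a b, inner ℂ (W a 0) (Q b 0) = if a = b then 1 else 0) :
    ∃ W' : ι → X → E, (∀ a, ContDiffAt ℝ ω (W' a) 0) ∧ (∀ a, W' a 0 = W a 0) ∧ ∀ᶠ ξ in 𝓝 0,
      Submodule.span ℂ (range fun a => W' a ξ) = Submodule.span ℂ (range fun a => W a ξ) ∧
      ∀ a b, inner ℂ (W' a ξ) (Q b ξ) = if a = b then 1 else 0 := by
  let g : X → Matrix ι ι ℂ := fun ξ => Matrix.of fun a b => inner ℂ (W a ξ) (Q b ξ)
  have hg : ∀ a b, ContDiffAt ℝ ω (fun ξ => g ξ a b) 0 := fun a b => (hW a).inner ℂ (hQ b)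
  have hg0 : g 0 = 1 := by
    ext a b
    rw [Matrix.one_apply]
    exact h0 a b
  have hdet : (g 0).det ≠ 0 := by rw [hg0, Matrix.det_one]; exact one_ne_zero
  have hgi : ∀ a b, ContDiffAt ℝ ω (fun ξ => (g ξ)⁻¹ a b) 0 := fun a b =>
    contDiffWithinAt_univ.1 (contDiffWithinAt_inv (fun a b => contDiffWithinAt_univ.2 (hg a b)) hdet a b)
  have hev : ∀ᶠ ξ in 𝓝 0, (g ξ).det ≠ 0 :=
    (contDiffWithinAt_univ.1 (contDiffWithinAt_det fun a b =>
      contDiffWithinAt_univ.2 (hg a b))).continuousAt.eventually_ne hdet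
  -- The second family is corrected by the inverse of the pairing matrix; the conjugate compensates
  -- for the conjugate-linearity of the inner product in its first slot.
  refine ⟨fun a ξ => ∑ b, (starRingEnd ℂ) ((g ξ)⁻¹ a b) • W b ξ, fun a => ?_, fun a => ?_, ?_⟩
  · refine ContDiffAt.sum fun b _ => ContDiffAt.smul ?_ (hW b)
    exact Complex.conjCLE.contDiff.contDiffAt.comp (0 : X) (hgi a b)
  · simp [hg0, Matrix.one_apply]
  · filter_upwards [hev] with ξ hξ
    have hu : IsUnit (g ξ).det := isUnit_iff_ne_zero.2 hξ
    refine ⟨le_antisymm (Submodule.span_le.2 ?_) (Submodule.span_le.2 ?_), fun a b => ?_⟩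
    · rintro _ ⟨a, rfl⟩
      exact sum_mem fun b _ => Submodule.smul_mem _ _ (Submodule.subset_span (mem_range_self b))
    · rintro _ ⟨b, rfl⟩
      have e : W b ξ = ∑ a, (starRingEnd ℂ) (g ξ b a) • ∑ c, (starRingEnd ℂ) ((g ξ)⁻¹ a c) • W c ξ := by
        simp only [Finset.smul_sum, smul_smul, ← map_mul]
        rw [Finset.sum_comm]
        simp only [← Finset.sum_smul, ← map_sum, ← Matrix.mul_apply, Matrix.mul_nonsing_inv _ hu,
          Matrix.one_apply]
        simp
      change W b ξ ∈ _
      rw [e]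
      exact sum_mem fun a _ => Submodule.smul_mem _ _ (Submodule.subset_span ⟨a, rfl⟩)
    · have e : ∑ c, (g ξ)⁻¹ a c * g ξ c b = if a = b then 1 else 0 := by
        rw [← Matrix.mul_apply, Matrix.nonsing_inv_mul _ hu, Matrix.one_apply]
      rw [← e, sum_inner]
      refine Finset.sum_congr rfl fun c _ => ?_
      rw [inner_smul_left, Complex.conj_conj]
      rfl

omit [NormedSpace ℝ E] [IsScalarTower ℝ ℂ E] in
-- The kernel of `p*` is the orthogonal of the range of `p`, so `p*` takes all its values already on
-- the range of `p`.
theorem finiteDimensional_range_star {p : E →L[ℂ] E}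
    [FiniteDimensional ℂ (LinearMap.range (p : E →ₗ[ℂ] E))] :
    FiniteDimensional ℂ (LinearMap.range (star p : E →L[ℂ] E).toLinearMap) := by
  have h : LinearMap.ker (star p : E →L[ℂ] E).toLinearMap = (LinearMap.range (p : E →ₗ[ℂ] E))ᗮ := by
    rw [ContinuousLinearMap.star_eq_adjoint]
    exact (ContinuousLinearMap.orthogonal_range p).symm
  have e : LinearMap.range (star p : E →L[ℂ] E).toLinearMap
      = (LinearMap.range (p : E →ₗ[ℂ] E)).map (star p : E →L[ℂ] E).toLinearMap := by
    refine le_antisymm ?_ LinearMap.map_le_range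
    rintro _ ⟨v, rfl⟩
    let K := LinearMap.range (p : E →ₗ[ℂ] E)
    refine ⟨K.starProjection v, Submodule.starProjection_apply_mem _ v, ?_⟩
    have : v - K.starProjection v ∈ LinearMap.ker (star p : E →L[ℂ] E).toLinearMap := by
      rw [h]
      exact Submodule.sub_starProjection_mem_orthogonal v
    rw [LinearMap.mem_ker, map_sub, sub_eq_zero] at this
    exact this.symm
  rw [e]
  infer_instance

/-- A pair of dual bases for a spectral subspace extends to a smooth family. -/
theorem exists_dual_spectral_family {A : X → E →L[ℂ] E} (hA : ContDiffAt ℝ ω A 0) {p r : E →L[ℂ] E}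
    (h : RieszSplitting (A 0) p r) [FiniteDimensional ℂ (LinearMap.range (p : E →ₗ[ℂ] E))]
    {ι : Type*} [Fintype ι] [DecidableEq ι] {q w : ι → E}
    (hq : Submodule.span ℂ (range q) = LinearMap.range (p : E →ₗ[ℂ] E))
    (hw : Submodule.span ℂ (range w) = LinearMap.range (star p : E →L[ℂ] E).toLinearMap)
    (hqw : ∀ a b, inner ℂ (w a) (q b) = if a = b then 1 else 0) :
    ∃ Q W : ι → X → E, (∀ a, ContDiffAt ℝ ω (Q a) 0) ∧ (∀ a, ContDiffAt ℝ ω (W a) 0) ∧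
      (∀ a, Q a 0 = q a) ∧ (∀ a, W a 0 = w a) ∧ ∃ ε₁ > 0, ∀ ε₂ > 0, ∀ᶠ ξ in 𝓝 0,
        IsSpectralRange ε₁ ε₂ (A ξ) (Submodule.span ℂ (range fun a => Q a ξ)) ∧
        IsSpectralRange ε₁ ε₂ (star (A ξ)) (Submodule.span ℂ (range fun a => W a ξ)) ∧
        ∀ a b, inner ℂ (W a ξ) (Q b ξ) = if a = b then 1 else 0 := by
  have hstar : ContDiffAt ℝ ω (fun ξ => star (A ξ)) 0 := by
    let σ : (E →L[ℂ] E) →+ (E →L[ℂ] E) := starAddEquiv.toAddMonoidHom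
    exact (σ.toRealLinearMap continuous_star).contDiff.contDiffAt.comp (0 : X) hA
  have := finiteDimensional_range_star (p := p)
  obtain ⟨Q, hQ, hQ0, ε, hε, hQr⟩ := exists_spectral_family hA h hq
  obtain ⟨W, hW, hW0, ε', hε', hWr⟩ := exists_spectral_family hstar h.star hw
  obtain ⟨W', hW', hW'0, hev⟩ := exists_dual_family hQ hW (by simpa only [hQ0, hW0] using hqw)
  refine ⟨Q, W', hQ, hW', hQ0, fun a => (hW'0 a).trans (hW0 a), min ε ε', lt_min hε hε', fun ε₂ hε₂ => ?_⟩
  filter_upwards [hQr ε₂ hε₂, hWr ε₂ hε₂, hev] with ξ h1 h2 h3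
  obtain ⟨S, hS1, hS2, hS3⟩ := h1
  obtain ⟨S', hS1', hS2', hS3'⟩ := h2
  exact ⟨⟨S, fun ν hν => hS1 ν (hν.trans_le (min_le_left _ _)), hS2, hS3⟩,
    ⟨S', fun ν hν => hS1' ν (hν.trans_le (min_le_right _ _)), hS2', by rw [hS3', h3.1]⟩, h3.2⟩

end DualBases

/-! ### Translation modes `∂ⱼU` and conserved means. -/

section Modes

variable {n r : ℕ} (P : PeriodicWave n r)

/-- The inclusion of `ℝⁿ` in `ℂⁿ` as a continuous linear map. -/
def toCL (n : ℕ) : EuclideanSpace ℝ (Fin n) →L[ℝ] EuclideanSpace ℂ (Fin n) :=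
  toLpReal n ∘L ContinuousLinearMap.pi fun a => Complex.ofRealCLM ∘L EuclideanSpace.proj a

theorem toCL_apply (u : EuclideanSpace ℝ (Fin n)) : toCL n u = toC u := rfl

theorem dC_toC (F : EuclideanSpace ℝ (Fin n) → EuclideanSpace ℝ (Fin n))
    (u v : EuclideanSpace ℝ (Fin n)) : dC F u (toC v) = toC (fderiv ℝ F u v) := by
  have hv : v = ∑ b, v b • EuclideanSpace.single b (1 : ℝ) := by
    ext a
    simp [Finset.sum_apply, Pi.single_apply]
  ext a
  conv_rhs => rw [hv, map_sum]
  simp [dC, toC, mul_comm]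

theorem contDiff_lift_toCL {φ : Torus → EuclideanSpace ℝ (Fin n)} {N : WithTop ℕ∞}
    (h : ContDiff ℝ N (lift φ)) : ContDiff ℝ N (lift fun x => toCL n (φ x)) :=
  (toCL n).contDiff.comp h

theorem continuous_toCL {φ : Torus → EuclideanSpace ℝ (Fin n)} (h : ContDiff ℝ 1 (lift φ)) :
    Continuous fun x => toCL n (φ x) := continuous_of_lift (contDiff_lift_toCL h).continuous

theorem integrable_of_continuous {φ : Torus → EuclideanSpace ℂ (Fin n)} (h : Continuous φ) :
    Integrable φ torusMeasure := by
  rw [← integrableOn_univ]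
  exact h.continuousOn.integrableOn_compact isCompact_univ

theorem coeff_toCL_pd {φ : Torus → EuclideanSpace ℝ (Fin n)} (h : ContDiff ℝ 1 (lift φ)) (j : Fin 2)
    (k : Fin 2 → ℤ) : mFourierCoeff (fun x => toCL n (pd j φ x)) k
      = (2 * Real.pi * Complex.I * k j) • mFourierCoeff (fun x => toCL n (φ x)) k := by
  rw [← coeff_pd (contDiff_lift_toCL h) j k]
  congr 1
  funext x
  rw [pd_comp h (toCL n).contDiff, ContinuousLinearMap.fderiv]

theorem coeff_finset_sum {ι : Type*} (t : Finset ι) {φ : ι → Torus → EuclideanSpace ℂ (Fin n)}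
    (h : ∀ i, Continuous (φ i)) (k : Fin 2 → ℤ) :
    mFourierCoeff (fun x => ∑ i ∈ t, φ i x) k = ∑ i ∈ t, mFourierCoeff (φ i) k := by
  unfold mFourierCoeff
  simp only [Finset.smul_sum]
  exact integral_finsetSum _ fun i _ => integrable_mFourier (integrable_of_continuous (h i)) k

theorem contDiff_lift_gradK {φ : Torus → EuclideanSpace ℝ (Fin n)} {N : WithTop ℕ∞}
    (h : ContDiff ℝ (N + 1) (lift φ)) (m : Fin 2) : ContDiff ℝ N (lift (gradK P.K m φ)) := by
  have e : lift (gradK P.K m φ) = fun y => ∑ j, P.K m j • lift (pd j φ) y := rfl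
  rw [e]
  exact ContDiff.sum fun j _ => (contDiff_lift_pd h j).const_smul (P.K m j)

theorem coeff_gradK {φ : Torus → EuclideanSpace ℝ (Fin n)} (h : ContDiff ℝ 1 (lift φ)) (m : Fin 2)
    (k : Fin 2 → ℤ) : mFourierCoeff (fun x => toCL n (gradK P.K m φ x)) k
      = (Complex.I * freq P k m) • mFourierCoeff (fun x => toCL n (φ x)) k := by
  have e : (fun x => toCL n (gradK P.K m φ x))
      = fun x => ∑ j, ((P.K m j : ℝ) : ℂ) • toCL n (pd j φ x) := by
    funext x
    rw [gradK, map_sum]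
    refine Finset.sum_congr rfl fun j _ => ?_
    rw [map_smul, Complex.coe_smul]
  have hc : ∀ j, Continuous fun x => toCL n (pd j φ x) := fun j =>
    (toCL n).continuous.comp (continuous_pd h j)
  have hc' : ∀ j, Continuous fun x => ((P.K m j : ℝ) : ℂ) • toCL n (pd j φ x) := fun j =>
    Continuous.const_smul (hc j) ((P.K m j : ℝ) : ℂ)
  rw [e, coeff_finset_sum _ hc']
  simp only [coeff_smul, coeff_toCL_pd h, smul_smul, ← Finset.sum_smul, freq]
  congr 1
  push_cast
  rw [Finset.mul_sum]
  exact Finset.sum_congr rfl fun j _ => by ring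

theorem contDiff_lift_comp {F : EuclideanSpace ℝ (Fin n) → EuclideanSpace ℝ (Fin n)}
    (hF : ContDiff ℝ ∞ F) : ContDiff ℝ 1 (lift fun x => F (P.U x)) :=
  (hF.of_le (by norm_cast)).comp (P.contDiff_U.of_le (by norm_num))

theorem contDiff_U_one : ContDiff ℝ 1 (lift P.U) := P.contDiff_U.of_le (by norm_num)

theorem coeff_profile (k : Fin 2 → ℤ) :
    (∑ m, (Complex.I * freq P k m) ^ 2) • mFourierCoeff (fun x => toCL n (P.U x)) k
      + (∑ m, (Complex.I * freq P k m) • mFourierCoeff (fun x => toCL n (P.G m (P.U x))) k)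
      + (∑ m, (P.c m : ℂ) * (Complex.I * freq P k m)) • mFourierCoeff (fun x => toCL n (P.U x)) k
      + mFourierCoeff (fun x => toCL n (P.f (P.U x))) k = 0 := by
  have hU := contDiff_U_one P
  have hK : ∀ m, ContDiff ℝ 1 (lift (gradK P.K m P.U)) := fun m =>
    contDiff_lift_gradK P (by simpa [one_add_one_eq_two] using P.contDiff_U) m
  have hG : ∀ m, ContDiff ℝ 1 (lift fun x => P.G m (P.U x)) := fun m =>
    contDiff_lift_comp P (P.smooth_G m)
  have hf : ContDiff ℝ 1 (lift fun x => P.f (P.U x)) := contDiff_lift_comp P P.smooth_f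
  have c1 : ∀ m, Continuous fun x => toCL n (gradK P.K m (gradK P.K m P.U) x) := fun m =>
    (toCL n).continuous.comp (continuous_of_lift
      (contDiff_lift_gradK (N := 0) P (by simpa using hK m) m).continuous)
  have c2 : ∀ m, Continuous fun x => toCL n (gradK P.K m (fun y => P.G m (P.U y)) x) := fun m =>
    (toCL n).continuous.comp (continuous_of_lift
      (contDiff_lift_gradK (N := 0) P (by simpa using hG m) m).continuous)
  have c3 : ∀ m, Continuous fun x => toCL n (gradK P.K m P.U x) := fun m => continuous_toCL (hK m)
  have c4 : Continuous fun x => toCL n (P.f (P.U x)) := continuous_toCL hf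
  have e : (fun x => (∑ m, toCL n (gradK P.K m (gradK P.K m P.U) x))
      + (∑ m, toCL n (gradK P.K m (fun y => P.G m (P.U y)) x))
      + (∑ m, (P.c m : ℂ) • toCL n (gradK P.K m P.U x)) + toCL n (P.f (P.U x))) = fun _ => 0 := by
    funext x
    have h := congrArg (toCL n) (P.profile x)
    simpa only [map_add, map_sum, map_zero, map_smul, ← Complex.coe_smul] using h
  have h0 := congrArg (fun φ => mFourierCoeff φ k) e
  have hz : mFourierCoeff (fun _ : Torus => (0 : EuclideanSpace ℂ (Fin n))) k = 0 := by
    simp [mFourierCoeff]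
  have c3' : ∀ m, Continuous fun x => (P.c m : ℂ) • toCL n (gradK P.K m P.U x) := fun m =>
    Continuous.const_smul (c3 m) (P.c m : ℂ)
  have i1 := integrable_of_continuous (continuous_finsetSum Finset.univ fun m _ => c1 m)
  have i2 := integrable_of_continuous (continuous_finsetSum Finset.univ fun m _ => c2 m)
  have i3 := integrable_of_continuous (continuous_finsetSum Finset.univ fun m _ => c3' m)
  have i12 : Integrable (fun x => (∑ m, toCL n (gradK P.K m (gradK P.K m P.U) x))
      + (∑ m, toCL n (gradK P.K m (fun y => P.G m (P.U y)) x))) torusMeasure := i1.add i2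
  have i123 : Integrable (fun x => (∑ m, toCL n (gradK P.K m (gradK P.K m P.U) x))
      + (∑ m, toCL n (gradK P.K m (fun y => P.G m (P.U y)) x))
      + (∑ m, (P.c m : ℂ) • toCL n (gradK P.K m P.U x))) torusMeasure := i12.add i3
  have i4 := integrable_of_continuous c4
  simp only [hz] at h0
  rw [coeff_add i123 i4, coeff_add i12 i3, coeff_add i1 i2,
    coeff_finset_sum _ c1, coeff_finset_sum _ c2, coeff_finset_sum _ c3'] at h0
  simp only [coeff_smul, coeff_gradK P (hK _), coeff_gradK P (hG _), coeff_gradK P hU, smul_smul,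
    ← Finset.sum_smul, ← sq] at h0
  exact h0

/-- The class in `L²` of the function `∂ⱼU`. -/
def waveMode (j : Fin 2) : L2 n :=
  toL2 ⟨fun x => toCL n (pd j P.U x), (toCL n).continuous.comp (continuous_pd (contDiff_U_one P) j)⟩

theorem coeFn_waveMode (j : Fin 2) :
    waveMode P j =ᵐ[torusMeasure] fun x => toC (pd j P.U x) := coeFn_toL2 _

theorem coeff_waveMode (j : Fin 2) (k : Fin 2 → ℤ) : mFourierCoeff (waveMode P j) k
      = (2 * Real.pi * Complex.I * k j) • mFourierCoeff (fun x => toCL n (P.U x)) k := by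
  rw [waveMode, coeff_toL2]
  exact coeff_toCL_pd (contDiff_U_one P) j k

theorem coeff_dC_waveMode {F : EuclideanSpace ℝ (Fin n) → EuclideanSpace ℝ (Fin n)}
    (hF : ContDiff ℝ ∞ F) (j : Fin 2) (k : Fin 2 → ℤ) :
    mFourierCoeff (fun x => dC F (P.U x) (waveMode P j x)) k
      = (2 * Real.pi * Complex.I * k j) • mFourierCoeff (fun x => toCL n (F (P.U x))) k := by
  rw [← coeff_toCL_pd (contDiff_lift_comp P hF)]
  refine coeff_congr ?_ k
  filter_upwards [coeFn_waveMode P j] with x hx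
  rw [hx, dC_toC, pd_comp (contDiff_U_one P) (hF.of_le (by norm_cast)), toCL_apply]

theorem shift_zero : shift P 0 = 0 := by
  funext m
  simp [shift]

/-- The `j`-th derivative of the profile equation, taken on Fourier coefficients: multiplication by
`2iπ kⱼ` makes sense although `U` is only `C²`, whereas the equation contains second derivatives. -/
theorem blochCoeff_waveMode (j : Fin 2) (k : Fin 2 → ℤ) : blochCoeff P 0 (waveMode P j) k = 0 := by
  have h := coeff_profile P k
  simp only [blochCoeff, symb_eq, shift_zero, Pi.zero_apply, add_zero, coeff_waveMode,
    coeff_dC_waveMode P (P.smooth_G _), coeff_dC_waveMode P P.smooth_f]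
  simp only [smul_comm _ (2 * Real.pi * Complex.I * k j : ℂ), ← Finset.smul_sum, ← smul_add]
  rw [h, smul_zero]

theorem waveMode_mem_graph (j : Fin 2) : (waveMode P j, 0) ∈ (bloch P 0).graph := by
  rw [mem_graph_bloch_iff_coeff]
  intro k
  rw [blochCoeff_waveMode, coeff_coe_zero]

/-- A relation in `L²` between continuous functions holds at every point, and its real and imaginary
parts are relations between the real functions `∂ⱼU`. -/
theorem linearIndependent_waveMode : LinearIndependent ℂ (waveMode P) := by
  rw [Fintype.linearIndependent_iff]
  intro g hg
  have hc : ∀ j, Continuous fun x => toCL n (pd j P.U x) := fun j =>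
    (toCL n).continuous.comp (continuous_pd (contDiff_U_one P) j)
  have h1 : toL2 (∑ j, g j • (⟨fun x => toCL n (pd j P.U x), hc j⟩ : C(Torus, EuclideanSpace ℂ (Fin n)))) = 0 := by
    rw [← hg]
    simp only [toL2, waveMode, map_sum, map_smul]
  have h2 : (∑ j, g j • (⟨fun x => toCL n (pd j P.U x), hc j⟩ : C(Torus, EuclideanSpace ℂ (Fin n)))) = 0 :=
    ContinuousMap.toLp_injective (p := 2) (𝕜 := ℂ) torusMeasure (h1.trans (map_zero _).symm)
  have h3 : ∀ x a, ∑ j, g j * ((pd j P.U x a : ℝ) : ℂ) = 0 := by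
    intro x a
    have := congrArg (fun φ : C(Torus, EuclideanSpace ℂ (Fin n)) => φ x a) h2
    simpa [toCL_apply, toC] using this
  have hli := Fintype.linearIndependent_iff.1 P.genuinely_two_dim
  intro j
  refine Complex.ext (hli (fun j => (g j).re) ?_ j) (hli (fun j => (g j).im) ?_ j)
  · funext x
    ext a
    have := congrArg Complex.re (h3 x a)
    simpa using this
  · funext x
    ext a
    have := congrArg Complex.im (h3 x a)
    simpa using this

/-- The constant functions in the directions of the conserved components. -/
def constMode (j : Fin r) : L2 n := toL2 (mode 0 (EuclideanSpace.single (Fin.castLE P.r_le j) 1))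

theorem coeFn_constMode (j : Fin r) : constMode P j =ᵐ[torusMeasure]
    fun _ => EuclideanSpace.single (Fin.castLE P.r_le j) 1 := by
  filter_upwards [coeFn_toL2 (mode 0 (EuclideanSpace.single (Fin.castLE P.r_le j) (1 : ℂ)))] with x hx
  rw [constMode, hx]
  change mFourier 0 x • EuclideanSpace.single (Fin.castLE P.r_le j) (1 : ℂ) = _
  rw [mFourier_zero, ContinuousMap.one_apply, one_smul]

theorem inner_constMode (j : Fin r) (V : L2 n) :
    inner ℂ (constMode P j) V = mFourierCoeff V 0 (Fin.castLE P.r_le j) := by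
  rw [constMode, inner_mode, EuclideanSpace.inner_single_left]; simp

theorem inner_constMode_waveMode (j : Fin r) (l : Fin 2) :
    inner ℂ (constMode P j) (waveMode P l) = 0 := by
  rw [inner_constMode, coeff_waveMode]; simp

theorem inner_constMode_constMode (j l : Fin r) :
    inner ℂ (constMode P j) (constMode P l) = if j = l then 1 else 0 := by
  rw [inner_constMode, constMode, coeff_toL2, coeff_mode]
  simp [Fin.ext_iff]

theorem coeff_dC_conservative (V : L2 n) (k : Fin 2 → ℤ) (j : Fin r) :
    mFourierCoeff (fun x => dC P.f (P.U x) (V x)) k (Fin.castLE P.r_le j) = 0 := by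
  have h0 : ∀ u v, dC P.f u v (Fin.castLE P.r_le j) = 0 := by
    intro u v
    change ∑ b, ((fderiv ℝ P.f u (EuclideanSpace.single b 1) (Fin.castLE P.r_le j) : ℝ) : ℂ) * v b = 0
    refine Finset.sum_eq_zero fun b _ => ?_
    have h1 : HasFDerivAt (fun u => P.f u (Fin.castLE P.r_le j))
        ((EuclideanSpace.proj (Fin.castLE P.r_le j)).comp (fderiv ℝ P.f u)) u :=
      (EuclideanSpace.proj (𝕜 := ℝ) (Fin.castLE P.r_le j)).hasFDerivAt.comp u
        ((P.smooth_f.differentiable (by simp)) u).hasFDerivAt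
    have h2 : (fun u => P.f u (Fin.castLE P.r_le j)) = fun _ => 0 :=
      funext fun u => P.conservative u _ j.2
    rw [h2] at h1
    have h3 := congrArg (fun T => T (EuclideanSpace.single b (1 : ℝ))) (h1.unique (hasFDerivAt_const 0 u))
    have h4 : fderiv ℝ P.f u (EuclideanSpace.single b (1 : ℝ)) (Fin.castLE P.r_le j) = 0 := h3
    rw [h4]
    simp
  let p : EuclideanSpace ℂ (Fin n) →L[ℂ] ℂ := EuclideanSpace.proj (Fin.castLE P.r_le j)
  have h := p.integral_comp_comm (integrable_mFourier (integrable_dC P P.smooth_f V) k)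
  refine h.symm.trans ?_
  refine integral_eq_zero_of_ae (Eventually.of_forall fun x => ?_)
  change mFourier (-k) x * dC P.f (P.U x) (V x) (Fin.castLE P.r_le j) = 0
  rw [h0, mul_zero]

/-- The mean value of a conserved component of `L_ξ V`. -/
theorem inner_constMode_of_mem_graph {ξ : EuclideanSpace ℝ (Fin 2)} {V W : L2 n}
    (h : (V, W) ∈ (bloch P ξ).graph) (j : Fin r) :
    inner ℂ (constMode P j) W = (∑ m, (Complex.I * shift P ξ m) ^ 2) * inner ℂ (constMode P j) V
      + (∑ m, (Complex.I * shift P ξ m) * inner ℂ (constMode P j) (jacOp P (P.smooth_G m) V))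
      + (∑ m, (P.c m : ℂ) * (Complex.I * shift P ξ m)) * inner ℂ (constMode P j) V := by
  rw [mem_graph_bloch_iff_coeff] at h
  simp only [inner_constMode, coeff_jacOp]
  rw [h 0, blochCoeff]
  have hf : ∀ m, freq P 0 m = 0 := fun m => by simp [freq]
  simp only [symb_eq, hf, Complex.ofReal_zero, zero_add, PiLp.add_apply, PiLp.smul_apply, smul_eq_mul,
    coeff_dC_conservative, add_zero, Fin.sum_univ_two]

end Modes

/-! ### Dual bases in the range of an adjoint projection. -/

section Duality

variable {E : Type*} [NormedAddCommGroup E] [InnerProductSpace ℂ E] [CompleteSpace E]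

/-- A basis of the range of a projection has a dual basis in the range of the adjoint. -/
theorem exists_dual_basis {p : E →L[ℂ] E} (hp : p * p = p) {ι : Type*} [Fintype ι] [DecidableEq ι]
    {q : ι → E} (hli : LinearIndependent ℂ q)
    (hq : Submodule.span ℂ (range q) = LinearMap.range (p : E →ₗ[ℂ] E)) :
    ∃ w : ι → E, (∀ a b, inner ℂ (w a) (q b) = if a = b then 1 else 0) ∧ ∀ a, star p (w a) = w a := by
  have hmem : ∀ v, p v ∈ Submodule.span ℂ (range q) := fun v => by rw [hq]; exact ⟨v, rfl⟩
  have hfix : ∀ v, p (p v) = p v := fun v => by rw [← mul_apply_eq_comp, hp]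
  let B := Module.Basis.span hli
  have hfin : FiniteDimensional ℂ (Submodule.span ℂ (range q)) := B.finiteDimensional_of_finite
  let φ : ι → E →L[ℂ] ℂ := fun a =>
    (LinearMap.toContinuousLinearMap (B.coord a)).comp (p.codRestrict _ hmem)
  have hφ : ∀ a v, φ a (p v) = φ a v := fun a v => by
    change B.coord a ⟨p (p v), _⟩ = B.coord a ⟨p v, _⟩
    simp only [hfix]
  have hpq : ∀ b, p (q b) = q b := fun b => by
    obtain ⟨v, hv⟩ : q b ∈ LinearMap.range (p : E →ₗ[ℂ] E) :=
      hq ▸ Submodule.subset_span (mem_range_self b)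
    rw [← hv]
    exact hfix v
  refine ⟨fun a => (InnerProductSpace.toDual ℂ E).symm (φ a), fun a b => ?_, fun a => ?_⟩
  · rw [InnerProductSpace.toDual_symm_apply]
    have e : p.codRestrict _ hmem (q b) = B b := by
      refine Subtype.ext ?_
      rw [Module.Basis.span_apply]
      exact hpq b
    change B.coord a (p.codRestrict _ hmem (q b)) = _
    rw [e, Module.Basis.coord_apply, Module.Basis.repr_self, Finsupp.single_apply]
    simp only [eq_comm]
  · refine ext_inner_right ℂ fun v => ?_
    rw [ContinuousLinearMap.star_eq_adjoint, ContinuousLinearMap.adjoint_inner_left,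
      InnerProductSpace.toDual_symm_apply, InnerProductSpace.toDual_symm_apply, hφ]

theorem eq_zero_of_inner_eq_zero {p : E →L[ℂ] E} {ι : Type*} {q : ι → E}
    (hq : Submodule.span ℂ (range q) = LinearMap.range (p : E →ₗ[ℂ] E)) {y : E} (hy : star p y = y)
    (h : ∀ b, inner ℂ y (q b) = 0) : y = 0 := by
  refine ext_inner_right ℂ fun v => ?_
  rw [inner_zero_left, ← hy, ContinuousLinearMap.star_eq_adjoint, ContinuousLinearMap.adjoint_inner_left]
  have hv : p v ∈ Submodule.span ℂ (range q) := by rw [hq]; exact ⟨v, rfl⟩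
  refine Submodule.span_induction ?_ ?_ ?_ ?_ hv
  · rintro _ ⟨b, rfl⟩
    exact h b
  · exact inner_zero_right _
  · intro x z _ _ hx hz
    rw [inner_add_right, hx, hz, add_zero]
  · intro c x _ hx
    rw [inner_smul_right, hx, mul_zero]

theorem span_dual_eq_range {p : E →L[ℂ] E} (hp : p * p = p) {ι : Type*} [Fintype ι] [DecidableEq ι]
    {q w : ι → E} (hq : Submodule.span ℂ (range q) = LinearMap.range (p : E →ₗ[ℂ] E))
    (hqw : ∀ a b, inner ℂ (w a) (q b) = if a = b then 1 else 0) (hw : ∀ a, star p (w a) = w a) :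
    Submodule.span ℂ (range w) = LinearMap.range (star p : E →L[ℂ] E).toLinearMap := by
  refine le_antisymm (Submodule.span_le.2 ?_) ?_
  · rintro _ ⟨a, rfl⟩
    exact ⟨w a, hw a⟩
  · rintro _ ⟨v, rfl⟩
    have hfix : star p (star p v) = star p v := by rw [← mul_apply_eq_comp, ← star_mul, hp]
    have h : star p v - ∑ a, (starRingEnd ℂ) (inner ℂ (star p v) (q a)) • w a = 0 := by
      refine eq_zero_of_inner_eq_zero hq ?_ fun b => ?_
      · simp only [map_sub, map_sum, map_smul, hw, hfix]
      · simp [hqw]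
    rw [ContinuousLinearMap.coe_coe, sub_eq_zero.1 h]
    exact sum_mem fun a _ => Submodule.smul_mem _ _ (Submodule.subset_span (mem_range_self a))

end Duality

/-! ### Existence of critical bases. -/

section Existence

variable {n r : ℕ} (P : PeriodicWave n r)

/-- Dual bases of the critical spaces at `ξ = 0`, given a splitting of the regularized operator. -/
theorem exists_bases_at_zero {p ρ A : L2 n →L[ℂ] L2 n} (h : RieszSplitting A p ρ)
    (hrank : Module.finrank ℂ (LinearMap.range (p : L2 n →ₗ[ℂ] L2 n)) = r + 2)
    (hV : ∀ j, A (waveMode P j) = 0) (he : ∀ j, star A (constMode P j) = 0) :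
    ∃ q w : Fin 2 ⊕ Fin r → L2 n,
      Submodule.span ℂ (range q) = LinearMap.range (p : L2 n →ₗ[ℂ] L2 n) ∧
      Submodule.span ℂ (range w) = LinearMap.range (star p : L2 n →L[ℂ] L2 n).toLinearMap ∧
      (∀ a b, inner ℂ (w a) (q b) = if a = b then 1 else 0) ∧
      (∀ j, q (Sum.inl j) = waveMode P j) ∧ ∀ j, w (Sum.inr j) = constMode P j := by
  have fix : ∀ {A p ρ : L2 n →L[ℂ] L2 n}, RieszSplitting A p ρ → ∀ v, A v = 0 → p v = v := by
    intro A p ρ h v hv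
    have := congrArg (fun T : L2 n →L[ℂ] L2 n => T v) h.left_inv
    simp only [mul_apply_eq_comp, hv, map_zero, sub_apply, one_apply_eq_self] at this
    exact (sub_eq_zero.1 this.symm).symm
  have hpV : ∀ j, p (waveMode P j) = waveMode P j := fun j => fix h _ (hV j)
  have hpe : ∀ j, star p (constMode P j) = constMode P j := fun j => fix h.star _ (he j)
  have hpair : ∀ j v, inner ℂ (constMode P j) (p v) = inner ℂ (constMode P j) v := fun j v => by
    conv_rhs => rw [← hpe]
    rw [ContinuousLinearMap.star_eq_adjoint, ContinuousLinearMap.adjoint_inner_left]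
  -- The constants are projected to complete the kernel vectors `∂ⱼU`. As `p*` fixes them, their
  -- pairing with `p v` and with `v` agree; testing against them gives independence, because the
  -- `∂ⱼU` have mean zero.
  let q : Fin 2 ⊕ Fin r → L2 n := Sum.elim (waveMode P) fun j => p (constMode P j)
  have hli : LinearIndependent ℂ q := by
    rw [Fintype.linearIndependent_iff]
    intro g hg
    rw [Fintype.sum_sum_type] at hg
    simp only [q, Sum.elim_inl, Sum.elim_inr] at hg
    have h2 : ∀ j, g (Sum.inr j) = 0 := by
      intro j
      have := congrArg (fun v => inner ℂ (constMode P j) v) hg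
      simpa [inner_add_right, inner_sum, inner_smul_right, inner_constMode_waveMode, hpair,
        inner_constMode_constMode] using this
    have h1 := Fintype.linearIndependent_iff.1 (linearIndependent_waveMode P) (fun j => g (Sum.inl j))
      (by simpa [h2] using hg)
    rintro (j | j)
    · exact h1 j
    · exact h2 j
  have hfin : FiniteDimensional ℂ (LinearMap.range (p : L2 n →ₗ[ℂ] L2 n)) :=
    FiniteDimensional.of_finrank_pos (by omega)
  have hq : Submodule.span ℂ (range q) = LinearMap.range (p : L2 n →ₗ[ℂ] L2 n) := by
    refine Submodule.eq_of_le_of_finrank_eq (Submodule.span_le.2 ?_) ?_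
    · rintro _ ⟨j | j, rfl⟩
      · exact ⟨waveMode P j, hpV j⟩
      · exact ⟨constMode P j, rfl⟩
    · rw [finrank_span_eq_card hli, hrank]
      simp [add_comm]
  obtain ⟨w, hw, hpw⟩ := exists_dual_basis h.idem hli hq
  refine ⟨q, w, hq, span_dual_eq_range h.idem hq hw hpw, hw, fun j => rfl, fun j => ?_⟩
  rw [← sub_eq_zero]
  -- Duality determines a vector in the range of `p*`, and the constant `eⱼ` has the required
  -- pairings with `q`.
  refine eq_zero_of_inner_eq_zero hq (by rw [map_sub, hpw, hpe]) ?_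
  rintro (l | l)
  · rw [inner_sub_left, hw]
    simp [q, inner_constMode_waveMode]
  · rw [inner_sub_left, hw]
    simp [q, hpair, inner_constMode_constMode]

theorem contDiff_shift : ContDiff ℝ ω (shift P) := by
  have h : ∀ m, ContDiff ℝ ω fun ξ : EuclideanSpace ℝ (Fin 2) => ∑ j, P.K m j * ξ j := fun m =>
    ContDiff.sum fun j _ => contDiff_const.mul (EuclideanSpace.proj (𝕜 := ℝ) j).contDiff
  exact contDiff_pi.2 fun m => Complex.ofRealCLM.contDiff.comp (h m)

theorem exists_isCriticalBasis (hD1 : ConditionD1 P) :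
    ∃ δ > 0, ∃ ξ₀ > 0, ∃ Q Qt, IsCriticalBasis P δ ξ₀ Q Qt := by
  obtain ⟨s, hs1, hs⟩ : ∃ s : ℝ, 1 ≤ s ∧
      ‖jacOp P P.smooth_f‖ + ∑ m, (‖jacOp P (P.smooth_G m)‖ + ‖(P.c m : ℂ)‖) < s :=
    ⟨1 + (‖jacOp P P.smooth_f‖ + ∑ m, (‖jacOp P (P.smooth_G m)‖ + ‖(P.c m : ℂ)‖)),
      le_add_of_nonneg_right (by positivity), by linarith⟩
  have hs0 : 0 < s := by linarith
  have hu := isUnit_preOp_zero P hs1 hs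
  set z : ℝ := s ^ 2 with hz
  have hz0 : 0 < z := by positivity
  have hzc : (z : ℂ) ≠ 0 := by exact_mod_cast hz0.ne'
  let R : EuclideanSpace ℝ (Fin 2) → L2 n →L[ℂ] L2 n := fun ξ => resolventOp P s (shift P ξ)
  -- Eigenvalue `0` of `L_0` becomes eigenvalue `-z⁻¹` of the resolvent; the shift brings it back to
  -- `0`.
  let A : EuclideanSpace ℝ (Fin 2) → L2 n →L[ℂ] L2 n := fun ξ => R ξ + (z : ℂ)⁻¹ • 1
  have hsh : ContinuousAt (shift P) 0 := (contDiff_shift P).continuous.continuousAt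
  have hev : ∀ᶠ ξ in 𝓝 0, IsUnit (preOp (n := n) P s (shift P ξ)) := by
    have h0 := eventually_isUnit_preOp P hu
    rw [← shift_zero P] at h0
    exact hsh.eventually h0
  have hres : ∀ᶠ ξ in 𝓝 0, IsResolvent (bloch P ξ) z (R ξ) := by
    filter_upwards [hev] with ξ hξ using isResolvent_resolventOp P hs0 hξ
  have hA : ContDiffAt ℝ ω A 0 := by
    refine ContDiffAt.add ?_ contDiffAt_const
    have h1 := (contDiffAt_resolventOp P hu).restrict_scalars ℝ
    rw [← shift_zero P] at h1
    exact h1.comp (0 : EuclideanSpace ℝ (Fin 2)) (contDiff_shift P).contDiffAt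
  have hR0 : IsResolvent (bloch P 0) z (R 0) := hres.self_of_nhds
  have hA0 : A 0 = (z : ℂ)⁻¹ • 1 + R 0 := add_comm _ _
  have hX : genEigenspace (bloch P 0) 0
      = Module.End.maxGenEigenspace ((A 0 : L2 n →L[ℂ] L2 n) : Module.End ℂ (L2 n)) 0 := by
    rw [hR0.genEigenspace_eq (l := 0) (by exact hzc.symm),
      ← maxGenEigenspace_add_smul_one _ ((z : ℂ)⁻¹)]
    congr 1
    rw [zero_sub, inv_neg, neg_add_cancel]
  have hrank : Module.finrank ℂ (Module.End.maxGenEigenspace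
      ((A 0 : L2 n →L[ℂ] L2 n) : Module.End ℂ (L2 n)) 0) = r + 2 := hX ▸ hD1.2
  obtain ⟨p, ρ, hp, hpr⟩ := exists_rieszSplitting (isCompactOperator_resolventOp P hs0 (shift P 0))
    (inv_ne_zero hzc) (by
      change FiniteDimensional ℂ (Module.End.maxGenEigenspace
        (((z : ℂ)⁻¹ • 1 + R 0 : L2 n →L[ℂ] L2 n) : Module.End ℂ (L2 n)) 0)
      rw [← hA0]
      exact FiniteDimensional.of_finrank_pos (by omega))
  change RieszSplitting ((z : ℂ)⁻¹ • 1 + R 0) p ρ at hp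
  change _ = Module.End.maxGenEigenspace
        (((z : ℂ)⁻¹ • 1 + R 0 : L2 n →L[ℂ] L2 n) : Module.End ℂ (L2 n)) 0 at hpr
  rw [← hA0] at hp hpr
  have hV : ∀ j, A 0 (waveMode P j) = 0 := by
    intro j
    have h1 := (hR0 _ _).1 (waveMode_mem_graph P j)
    rw [zero_sub, map_neg, map_smul] at h1
    change R 0 (waveMode P j) + (z : ℂ)⁻¹ • waveMode P j = 0
    have h2 : (z : ℂ)⁻¹ • waveMode P j = -R 0 (waveMode P j) := by
      conv_lhs => rw [← h1]
      rw [smul_neg, smul_smul, inv_mul_cancel₀ hzc, one_smul]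
    rw [h2, add_neg_cancel]
  -- The conserved components of `L_0 V` have mean zero. Applied to `V = R 0 v`, where `L_0 V = v +
  -- z V`, this says that `eⱼ` is orthogonal to the range of `A 0`.
  have he : ∀ j, star (A 0) (constMode P j) = 0 := by
    intro j
    refine ext_inner_right ℂ fun v => ?_
    rw [ContinuousLinearMap.star_eq_adjoint, ContinuousLinearMap.adjoint_inner_left, inner_zero_left]
    have h1 : (R 0 v, v + (z : ℂ) • R 0 v) ∈ (bloch P 0).graph := by
      rw [hR0, add_sub_cancel_right]
    have h2 := inner_constMode_of_mem_graph P h1 j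
    simp only [shift_zero, Pi.zero_apply, mul_zero, zero_pow two_ne_zero, zero_mul,
      Finset.sum_const_zero, add_zero, inner_add_right, inner_smul_right] at h2
    change inner ℂ _ (R 0 v + (z : ℂ)⁻¹ • v) = 0
    rw [inner_add_right, inner_smul_right]
    field_simp
    linear_combination h2
  have hfin : FiniteDimensional ℂ (LinearMap.range (p : L2 n →ₗ[ℂ] L2 n)) :=
    FiniteDimensional.of_finrank_pos (by rw [hpr]; omega)
  obtain ⟨q, w, hq, hw, hqw, hqV, hwe⟩ := exists_bases_at_zero P hp (by rw [hpr, hrank]) hV he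
  obtain ⟨Q, W, hQ, hW, hQ0, hW0, ε₁, hε₁, hsp⟩ := exists_dual_spectral_family hA hp hq hw hqw
  -- The radius `δ` is chosen from `ε₁`, then `ε₂` from `δ`, so that the Möbius map sends the disk
  -- of radius `δ` into that of radius `ε₁`, and its inverse sends the disk of radius `ε₂` into that
  -- of radius `δ`.
  obtain ⟨δ, hδ0, hδz, hδε⟩ : ∃ δ > 0, δ ≤ z / 2 ∧ 2 * δ ≤ ε₁ * z ^ 2 :=
    ⟨min (z / 2) (ε₁ * z ^ 2 / 2), by positivity, min_le_left _ _, by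
      linarith [min_le_right (z / 2) (ε₁ * z ^ 2 / 2)]⟩
  obtain ⟨ε₂, hε₂, hεz, hεδ⟩ : ∃ ε₂ > 0, ε₂ ≤ 1 / (2 * z) ∧ 2 * z ^ 2 * ε₂ ≤ δ := by
    refine ⟨min (1 / (2 * z)) (δ / (2 * z ^ 2)), by positivity, min_le_left _ _, ?_⟩
    rw [← le_div_iff₀' (by positivity)]
    exact min_le_right _ _
  have hall : ∀ᶠ ξ in 𝓝 0, (∀ a, ContDiffAt ℝ ω (Q a) ξ) ∧ (∀ a, ContDiffAt ℝ ω (W a) ξ) ∧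
      Submodule.span ℂ (range fun a => Q a ξ) = criticalSpace (bloch P ξ) δ ∧
      Submodule.span ℂ (range fun a => W a ξ) = criticalSpace (bloch P ξ).adjoint δ ∧
      ∀ a b, inner ℂ (W a ξ) (Q b ξ) = if a = b then 1 else 0 := by
    have e1 := eventually_all.2 fun a => (hQ a).eventually (by simp)
    have e2 := eventually_all.2 fun a => (hW a).eventually (by simp)
    filter_upwards [e1, e2, hsp ε₂ hε₂, hres, hev] with ξ h1 h2 h3 h4 h5
    obtain ⟨⟨S, hS1, hS2, hS3⟩, ⟨S', hS1', hS2', hS3'⟩, hd⟩ := h3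
    refine ⟨h1, h2, ?_, ?_, hd⟩
    · rw [h4.criticalSpace_eq_range hz0 hS1 hS2 hδz hδε hεz hεδ, hS3]
    · have hadj := h4.adjoint (dense_domain_bloch P hs0 h5)
      have hst : star (A ξ) = star (R ξ) + (z : ℂ)⁻¹ • 1 := by
        simp [A]
      rw [hst] at hS1' hS2'
      rw [hadj.criticalSpace_eq_range hz0 hS1' hS2' hδz hδε hεz hεδ, hS3']
  obtain ⟨ξ₀, hξ₀, hball⟩ := Metric.eventually_nhds_iff_ball.1 hall
  refine ⟨δ, hδ0, ξ₀, hξ₀, Q, W, ⟨fun a ξ hξ => ?_, fun a ξ hξ => ?_, fun ξ hξ => (hball ξ hξ).2.2.1,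
    fun ξ hξ => (hball ξ hξ).2.2.2.1, fun ξ hξ => (hball ξ hξ).2.2.2.2, fun j => ?_, fun j => ?_⟩⟩
  · exact (((hball ξ hξ).1 a).of_le le_top).contDiffWithinAt
  · exact (((hball ξ hξ).2.1 a).of_le le_top).contDiffWithinAt
  · rw [hQ0, hqV]
    exact coeFn_waveMode P j
  · rw [hW0, hwe]
    exact coeFn_constMode P j

end Existence

/-! ### Hadamard's lemma with a parameter. -/

section Hadamard

variable {X F : Type*} [NormedAddCommGroup X] [NormedSpace ℝ X] [NormedAddCommGroup F] [NormedSpace ℝ F]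

/-- The integral over `[0, 1]` of a smooth function depends smoothly on a parameter. -/
theorem contDiff_integral_param {g : X → ℝ → F} (hg : ContDiff ℝ ∞ fun q : X × ℝ => g q.1 q.2) :
    ContDiff ℝ ∞ fun p => ∫ t in (0 : ℝ)..1, g p t := by
  -- The integral is the value at `0` of the convolution of the indicator of `(0, 1]` with `t ↦ χ t
  -- • g p (-t)`. The cutoff is `1` wherever the indicator charges and supplies the compact support.
  let χ : ContDiffBump (0 : ℝ) := ⟨1, 2, one_pos, one_lt_two⟩
  have h1 : ContDiff ℝ ∞ fun q : X × ℝ => χ q.2 • g q.1 (-q.2) :=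
    (χ.contDiff.comp contDiff_snd).smul (hg.comp (contDiff_fst.prodMk contDiff_snd.neg))
  have h2 : LocallyIntegrable (indicator (Ioc (0 : ℝ) 1) fun _ => (1 : ℝ)) volume :=
    ((integrable_indicator_iff measurableSet_Ioc).2
      (integrableOn_const (by simp) (by simp))).locallyIntegrable
  have h3 := contDiffOn_convolution_right_with_param_comp (n := ⊤) (μ := volume)
    (ContinuousLinearMap.lsmul ℝ ℝ : ℝ →L[ℝ] F →L[ℝ] F) (s := univ) (v := fun _ : X => (0 : ℝ)) contDiffOn_const
    (g := fun p t => χ t • g p (-t)) isOpen_univ (isCompact_closedBall (0 : ℝ) 2)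
    (fun p x _ hx => by
      have : χ x = 0 := χ.zero_of_le_dist (not_le.1 hx).le
      simp [this]) h2 h1.contDiffOn
  rw [contDiffOn_univ] at h3
  convert h3 using 2 with p
  rw [convolution_def, intervalIntegral.integral_of_le zero_le_one, ← integral_indicator measurableSet_Ioc]
  refine integral_congr_ae (Eventually.of_forall fun t => ?_)
  by_cases ht : t ∈ Ioc (0 : ℝ) 1
  · have : χ (-t) = 1 := χ.one_of_mem_closedBall (by
      rw [mem_closedBall_zero_iff, norm_neg, Real.norm_of_nonneg ht.1.le]
      exact ht.2)
    simp [ht, this]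
  · simp [ht]

/-- Hadamard's lemma: a smooth function that vanishes at `ρ = 0` is `ρ` times a smooth function. -/
theorem exists_eq_smul_of_eq_zero [CompleteSpace F] {H : ℝ × ℝ → F} (hH : ContDiff ℝ ∞ H) (h0 : ∀ θ, H (0, θ) = 0) :
    ∃ G : ℝ × ℝ → F, ContDiff ℝ ∞ G ∧ (∀ p, H p = p.1 • G p) ∧
      ∀ θ, G (0, θ) = fderiv ℝ H (0, θ) (1, 0) := by
  have hd : ContDiff ℝ ∞ fun p => fderiv ℝ H p (1, 0) :=
    (hH.fderiv_right (by simp)).clm_apply contDiff_const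
  -- The quotient is the mean of the radial derivative along the segment from `(0, θ)` to `(ρ, θ)`.
  refine ⟨fun p => ∫ t in (0 : ℝ)..1, fderiv ℝ H (t * p.1, p.2) (1, 0), ?_, fun p => ?_, fun θ => by simp⟩
  · exact contDiff_integral_param (g := fun (p : ℝ × ℝ) t => fderiv ℝ H (t * p.1, p.2) (1, 0))
      (hd.comp ((contDiff_snd.mul (contDiff_fst.comp contDiff_fst)).prodMk (contDiff_snd.comp contDiff_fst)))
  · have hder : ∀ t : ℝ, HasDerivAt (fun t : ℝ => H (t * p.1, p.2))
        (p.1 • fderiv ℝ H (t * p.1, p.2) (1, 0)) t := by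
      intro t
      have h1 : HasDerivAt (fun t : ℝ => (t * p.1, p.2)) (p.1, 0) t := by
        simpa using ((hasDerivAt_id t).mul_const p.1).prodMk (hasDerivAt_const t p.2)
      have h2 := ((hH.differentiable (by simp)) (t * p.1, p.2)).hasFDerivAt.comp_hasDerivAt t h1
      have e : ((p.1, 0) : ℝ × ℝ) = p.1 • (1, 0) := by simp
      rwa [e, map_smul] at h2
    have hcont : Continuous fun t : ℝ => p.1 • fderiv ℝ H (t * p.1, p.2) (1, 0) :=
      continuous_const.smul (hd.continuous.comp (by fun_prop))
    have h3 := intervalIntegral.integral_eq_sub_of_hasDerivAt (fun t _ => hder t)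
      (hcont.intervalIntegrable 0 1)
    rw [intervalIntegral.integral_smul] at h3
    rw [h3]
    simp [h0]

end Hadamard

/-! ### Division by `‖ξ‖` in polar coordinates. -/

section Polar

theorem contDiff_polar : ContDiff ℝ ∞ polar := by
  have h : ContDiff ℝ ∞ fun p : ℝ × ℝ => (![p.1 * Real.cos p.2, p.1 * Real.sin p.2] : Fin 2 → ℝ) := by
    refine contDiff_pi.2 fun i => ?_
    fin_cases i
    · exact contDiff_fst.mul (Real.contDiff_cos.comp contDiff_snd)
    · exact contDiff_fst.mul (Real.contDiff_sin.comp contDiff_snd)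
  exact (PiLp.continuousLinearEquiv 2 ℝ fun _ : Fin 2 => ℝ).symm.contDiff.comp h

theorem norm_polar (p : ℝ × ℝ) : ‖polar p‖ = |p.1| := by
  rw [EuclideanSpace.norm_eq, ← Real.sqrt_sq_eq_abs]
  congr 1
  simp only [polar, Fin.sum_univ_two, Real.norm_eq_abs, sq_abs, PiLp.toLp_apply, Matrix.cons_val_zero,
    Matrix.cons_val_one]
  linear_combination p.1 ^ 2 * Real.cos_sq_add_sin_sq p.2

theorem polar_zero (θ : ℝ) : polar (0, θ) = 0 := by
  rw [← norm_eq_zero, norm_polar, abs_zero]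

theorem polar_mem_ball {ξ₀ : ℝ} {p : ℝ × ℝ} (hp : p ∈ Ico 0 ξ₀ ×ˢ (univ : Set ℝ)) :
    polar p ∈ Metric.ball (0 : EuclideanSpace ℝ (Fin 2)) ξ₀ := by
  rw [mem_ball_zero_iff, norm_polar, abs_of_nonneg hp.1.1]
  exact hp.1.2

variable {ξ₀ : ℝ} {h : EuclideanSpace ℝ (Fin 2) → ℂ}

theorem contDiffOn_comp_polar (hh : ContDiffOn ℝ ∞ h (Metric.ball 0 ξ₀)) :
    ContDiffOn ℝ ∞ (fun p => h (polar p)) (Ico 0 ξ₀ ×ˢ univ) :=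
  hh.comp contDiff_polar.contDiffOn fun _ hp => polar_mem_ball hp

/-- If `h` is smooth and `o(‖ξ‖)` then `h / ‖ξ‖` is smooth in polar coordinates. -/
theorem contDiffOn_div_polar (hh : ContDiffOn ℝ ∞ h (Metric.ball 0 ξ₀)) (h0 : h 0 = 0)
    (h1 : HasFDerivAt h (0 : EuclideanSpace ℝ (Fin 2) →L[ℝ] ℂ) 0) :
    ContDiffOn ℝ ∞ (fun p : ℝ × ℝ => (p.1 : ℂ)⁻¹ * h (polar p)) (Ico 0 ξ₀ ×ˢ univ) := by
  rintro ⟨ρ, θ⟩ hp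
  have hξ₀ : 0 < ξ₀ := hp.1.1.trans_lt hp.1.2
  rcases hp.1.1.eq_or_lt with hρ | hρ
  · simp only at hρ
    subst hρ
    -- The cutoff makes the function smooth on the whole plane without changing it near `0`, as
    -- Hadamard's lemma requires.
    let χ : ContDiffBump (0 : EuclideanSpace ℝ (Fin 2)) := ⟨ξ₀ / 4, ξ₀ / 2, by linarith, by linarith⟩
    let k : EuclideanSpace ℝ (Fin 2) → ℂ := fun ξ => χ ξ • h ξ
    have hk : ContDiff ℝ ∞ k := by
      refine contDiff_iff_contDiffAt.2 fun ξ => ?_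
      by_cases hξ : ξ ∈ tsupport k
      swap
      · exact contDiffAt_const.congr_of_eventuallyEq (notMem_tsupport_iff_eventuallyEq.1 hξ)
      have hξ' : ξ ∈ Metric.ball (0 : EuclideanSpace ℝ (Fin 2)) ξ₀ := by
        have h2 := tsupport_smul_subset_left χ h hξ
        rw [χ.tsupport_eq] at h2
        exact Metric.closedBall_subset_ball (by change ξ₀ / 2 < ξ₀; linarith) h2
      exact χ.contDiff.contDiffAt.smul (hh.contDiffAt (Metric.isOpen_ball.mem_nhds hξ'))
    have hkh : k =ᶠ[𝓝 0] h := by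
      filter_upwards [χ.eventuallyEq_one] with ξ hξ
      simp only [k, hξ, Pi.one_apply, one_smul]
    obtain ⟨G, hG, hHG, hG0⟩ := exists_eq_smul_of_eq_zero (hk.comp contDiff_polar)
      (fun θ => by simp only [Function.comp_apply, polar_zero, hkh.eq_of_nhds, h0])
    -- The value at `ρ = 0` is a directional derivative of `h` at the origin, which vanishes. It
    -- thus agrees with the convention `0⁻¹ = 0` in the quotient.
    have hG0' : ∀ θ, G (0, θ) = 0 := by
      intro θ
      have h2 : HasFDerivAt k (0 : EuclideanSpace ℝ (Fin 2) →L[ℝ] ℂ) (polar (0, θ)) := by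
        rw [polar_zero]
        exact h1.congr_of_eventuallyEq hkh
      have h3 := (h2.comp (0, θ) ((contDiff_polar.differentiable (by simp)) (0, θ)).hasFDerivAt).fderiv
      rw [hG0, h3]
      simp
    refine (hG.contDiffAt.congr_of_eventuallyEq ?_).contDiffWithinAt
    have hpol : Tendsto polar (𝓝 (0, θ)) (𝓝 0) := by
      have := contDiff_polar.continuous.tendsto (0, θ)
      rwa [polar_zero] at this
    filter_upwards [hpol.eventually hkh] with p hp
    rw [← hp]
    have := hHG p
    simp only [Function.comp_apply] at this
    rw [this]
    by_cases hp1 : p.1 = 0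
    · have : p = (0, p.2) := Prod.ext hp1 rfl
      rw [this, hG0']
      simp
    · rw [Complex.real_smul, inv_mul_cancel_left₀ (Complex.ofReal_ne_zero.2 hp1)]
  · refine ContDiffWithinAt.mul ?_ (contDiffOn_comp_polar hh _ hp)
    refine ContDiffWithinAt.inv ?_ (Complex.ofReal_ne_zero.2 hρ.ne')
    exact (Complex.ofRealCLM.contDiff.comp contDiff_fst).contDiffWithinAt

end Polar

/-! ### Gram matrices and expansions in dual bases. -/

section Gram

variable {E : Type*} [NormedAddCommGroup E] [InnerProductSpace ℂ E] {ι : Type*} [Fintype ι] [DecidableEq ι]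

theorem det_gram_ne_zero {v : ι → E} (hv : LinearIndependent ℂ v) :
    (Matrix.of fun a b => inner ℂ (v a) (v b) : Matrix ι ι ℂ).det ≠ 0 := by
  intro h
  obtain ⟨c, hc, hc0⟩ := Matrix.exists_mulVec_eq_zero_iff.2 h
  refine hc (funext (Fintype.linearIndependent_iff.1 hv c ?_))
  rw [← inner_self_eq_zero (𝕜 := ℂ), sum_inner]
  refine Finset.sum_eq_zero fun a _ => ?_
  have := congrFun hc0 a
  simp only [Matrix.mulVec, dotProduct, Matrix.of_apply, Pi.zero_apply] at this
  rw [inner_smul_left, inner_sum]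
  simp only [inner_smul_right, mul_comm (c _), this, mul_zero]

theorem eq_sum_of_mem_span {q w : ι → E} (hqw : ∀ a b, inner ℂ (w a) (q b) = if a = b then 1 else 0)
    {v : E} (hv : v ∈ Submodule.span ℂ (range q)) : v = ∑ a, inner ℂ (w a) v • q a := by
  obtain ⟨c, rfl⟩ := (Submodule.mem_span_range_iff_exists_fun ℂ).1 hv
  simp [hqw]

omit [Fintype ι] in
theorem linearIndependent_of_dual {q w : ι → E}
    (hqw : ∀ a b, inner ℂ (w a) (q b) = if a = b then 1 else 0) : LinearIndependent ℂ q := by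
  rw [linearIndependent_iff']
  intro s c hc a ha
  have := congrArg (fun v => inner ℂ (w a) v) hc
  simpa [inner_sum, inner_smul_right, hqw, ha] using this

end Gram

theorem hasFDerivAt_mul_of_eq_zero {X : Type*} [NormedAddCommGroup X] [NormedSpace ℝ X] {u v : X → ℂ} {x : X}
    (hu : DifferentiableAt ℝ u x) (hv : DifferentiableAt ℝ v x) (hu0 : u x = 0) (hv0 : v x = 0) :
    HasFDerivAt (fun y => u y * v y) (0 : X →L[ℝ] ℂ) x := by
  have h := hu.hasFDerivAt.fun_mul hv.hasFDerivAt
  rw [hu0, hv0] at h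
  refine h.congr_fderiv (ContinuousLinearMap.ext fun y => ?_)
  change (0 : ℂ) * fderiv ℝ v x y + 0 * fderiv ℝ u x y = 0
  rw [zero_mul, zero_mul, add_zero]

/-! ### The critical matrix: smoothness and orders of vanishing of its blocks. -/

section Matrix

variable {n r : ℕ} {P : PeriodicWave n r} {δ ξ₀ : ℝ}
  {Q Qt : Fin 2 ⊕ Fin r → EuclideanSpace ℝ (Fin 2) → L2 n}

theorem contDiffOn_clm_apply (T : L2 n →L[ℂ] L2 n) {V : EuclideanSpace ℝ (Fin 2) → L2 n}
    {s : Set (EuclideanSpace ℝ (Fin 2))} (hV : ContDiffOn ℝ ∞ V s) :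
    ContDiffOn ℝ ∞ (fun ξ => T (V ξ)) s :=
  (T.restrictScalars ℝ).contDiff.comp_contDiffOn hV

theorem contDiff_shift_apply (P : PeriodicWave n r) (m : Fin 2) :
    ContDiff ℝ ∞ fun ξ => shift P ξ m :=
  (contDiff_pi.1 ((contDiff_shift P).of_le le_top)) m

theorem contDiffOn_preOp (P : PeriodicWave n r) (s : ℝ) {V : EuclideanSpace ℝ (Fin 2) → L2 n}
    {t : Set (EuclideanSpace ℝ (Fin 2))} (hV : ContDiffOn ℝ ∞ V t) :
    ContDiffOn ℝ ∞ (fun ξ => preOp P s (shift P ξ) (V ξ)) t := by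
  have hκ : ∀ m, ContDiffOn ℝ ∞ (fun ξ => shift P ξ m) t := fun m => (contDiff_shift_apply P m).contDiffOn
  have hG : ∀ m, ContDiffOn ℝ ∞ (fun ξ => jacOp P (P.smooth_G m) (V ξ)) t := fun m =>
    contDiffOn_clm_apply _ hV
  have hc : ∀ m, ContDiffOn ℝ ∞ (fun ξ => (P.c m : ℂ) • V ξ) t := fun m =>
    ContDiffOn.smul (f := fun _ => (P.c m : ℂ)) contDiffOn_const hV
  simp only [preOp_apply, Fin.sum_univ_two]
  have h1 : ∀ m, ContDiffOn ℝ ∞ (fun ξ => -(shift P ξ m ^ 2) • V ξ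
      + (Complex.I * shift P ξ m) • (jacOp P (P.smooth_G m) (V ξ) + (P.c m : ℂ) • V ξ)) t := fun m =>
    ((((hκ m).pow 2).neg).smul hV).add ((contDiffOn_const.mul (hκ m)).smul ((hG m).add (hc m)))
  have h2 : ∀ m, ContDiffOn ℝ ∞ (fun ξ => gradInvOp P s m ((2 * Complex.I * shift P ξ m) • V ξ
      + jacOp P (P.smooth_G m) (V ξ) + (P.c m : ℂ) • V ξ)) t := fun m =>
    contDiffOn_clm_apply _ ((((contDiffOn_const.mul (hκ m)).smul hV).add (hG m)).add (hc m))
  exact (hV.neg.add (contDiffOn_clm_apply _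
    ((contDiffOn_clm_apply _ hV).add ((h1 0).add (h1 1))))).add ((h2 0).add (h2 1))

namespace IsCriticalBasis

variable (h : IsCriticalBasis P δ ξ₀ Q Qt)

include h

/-- The critical space lies in the domain and is invariant, so `L_ξ Q_b` is a combination of the
`Q_a`; pairing with the dual family identifies the coefficients as a column of `D_ξ`. -/
theorem mem_graph {ξ : EuclideanSpace ℝ (Fin 2)} (hξ : ξ ∈ Metric.ball 0 ξ₀) (b : Fin 2 ⊕ Fin r) :
    (Q b ξ, ∑ a, critMatrix P Q Qt ξ a b • Q a ξ) ∈ (bloch P ξ).graph := by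
  have hb : Q b ξ ∈ criticalSpace (bloch P ξ) δ := by
    rw [← h.span_eq ξ hξ]
    exact Submodule.subset_span ⟨b, rfl⟩
  obtain ⟨w, hw, hg⟩ := exists_graph_of_mem_criticalSpace hb
  rw [← h.span_eq ξ hξ] at hw
  have e := eq_sum_of_mem_span (h.dual ξ hξ) hw
  simp only [critMatrix, Matrix.of_apply, applyOp_of_mem_graph hg, ← e]
  exact hg

/-- Smoothness of `Q` in `L²` says nothing directly about `L_ξ Q`, as `L_ξ` is unbounded. After
applying `M = (1 - (K∇)ᵀ(K∇))⁻¹`, however, `M L_ξ Q_b` is smooth and equals `∑ D_ab M Q_a`. This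
system is solved for `D` with the Gram matrix of the `M Q_a`, invertible because `M` is injective.
-/
theorem contDiffOn_critMatrix (a b : Fin 2 ⊕ Fin r) :
    ContDiffOn ℝ ∞ (fun ξ => critMatrix P Q Qt ξ a b) (Metric.ball 0 ξ₀) := by
  let M : L2 n →L[ℂ] L2 n := invOp P 1
  let Y : Fin 2 ⊕ Fin r → EuclideanSpace ℝ (Fin 2) → L2 n := fun b ξ =>
    preOp P 1 (shift P ξ) (Q b ξ) + M (Q b ξ)
  let g : EuclideanSpace ℝ (Fin 2) → Matrix (Fin 2 ⊕ Fin r) (Fin 2 ⊕ Fin r) ℂ := fun ξ =>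
    Matrix.of fun a b => inner ℂ (M (Q a ξ)) (M (Q b ξ))
  let N : EuclideanSpace ℝ (Fin 2) → Matrix (Fin 2 ⊕ Fin r) (Fin 2 ⊕ Fin r) ℂ := fun ξ =>
    Matrix.of fun a b => inner ℂ (M (Q a ξ)) (Y b ξ)
  have hM : ∀ b, ContDiffOn ℝ ∞ (fun ξ => M (Q b ξ)) (Metric.ball 0 ξ₀) := fun b =>
    contDiffOn_clm_apply M (h.smooth b)
  have hY : ∀ b, ContDiffOn ℝ ∞ (Y b) (Metric.ball 0 ξ₀) := fun b =>
    (contDiffOn_preOp P 1 (h.smooth b)).add (hM b)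
  have hg : ∀ ξ ∈ Metric.ball (0 : EuclideanSpace ℝ (Fin 2)) ξ₀, (g ξ).det ≠ 0 := fun ξ hξ =>
    det_gram_ne_zero ((linearIndependent_of_dual (h.dual ξ hξ)).map' (M : L2 n →ₗ[ℂ] L2 n)
      (LinearMap.ker_eq_bot.2 (injective_invOp P one_pos)))
  have hD : ∀ ξ ∈ Metric.ball (0 : EuclideanSpace ℝ (Fin 2)) ξ₀,
      critMatrix P Q Qt ξ = (g ξ)⁻¹ * N ξ := by
    intro ξ hξ
    have e : g ξ * critMatrix P Q Qt ξ = N ξ := by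
      ext c d
      have h1 := (mem_graph_bloch_iff P one_pos ξ _ _).1 (h.mem_graph hξ d)
      have h2 : Y d ξ = ∑ a, critMatrix P Q Qt ξ a d • M (Q a ξ) := by
        change preOp P 1 (shift P ξ) (Q d ξ) + M (Q d ξ) = _
        rw [← h1, map_sub, map_sum, Complex.ofReal_one, one_pow, one_smul]
        simp only [map_smul]
        exact sub_add_cancel _ _
      change ∑ a, g ξ c a * critMatrix P Q Qt ξ a d = inner ℂ (M (Q c ξ)) (Y d ξ)
      rw [h2, inner_sum]
      refine Finset.sum_congr rfl fun a _ => ?_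
      rw [inner_smul_right, mul_comm]
      rfl
    rw [← e, ← mul_assoc, Matrix.nonsing_inv_mul _ (isUnit_iff_ne_zero.2 (hg ξ hξ)), one_mul]
  intro ξ hξ
  have h1 : ContDiffWithinAt ℝ ∞ (fun ξ => ∑ c, (g ξ)⁻¹ a c * N ξ c b) (Metric.ball 0 ξ₀) ξ := by
    refine ContDiffWithinAt.sum fun c _ => ContDiffWithinAt.mul ?_ ?_
    · exact contDiffWithinAt_inv (fun a b => ((hM a).inner ℂ (hM b)) ξ hξ) (hg ξ hξ) a c
    · exact ((hM c).inner ℂ (hY b)) ξ hξ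
  refine h1.congr (fun η hη => ?_) ?_
  · rw [hD η hη, Matrix.mul_apply]
  · rw [hD ξ hξ, Matrix.mul_apply]

variable (hξ₀ : 0 < ξ₀)

theorem inl_at_zero (j : Fin 2) : Q (Sum.inl j) 0 = waveMode P j :=
  Lp.ext ((h.at_zero j).trans (coeFn_waveMode P j).symm)

theorem dual_inr_at_zero (j : Fin r) : Qt (Sum.inr j) 0 = constMode P j :=
  Lp.ext ((h.dual_at_zero j).trans (coeFn_constMode P j).symm)

theorem critMatrix_zero_inl (a : Fin 2 ⊕ Fin r) (j : Fin 2) :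
    critMatrix P Q Qt 0 a (Sum.inl j) = 0 := by
  rw [critMatrix, Matrix.of_apply, h.inl_at_zero, applyOp_of_mem_graph (waveMode_mem_graph P j),
    inner_zero_right]

include hξ₀

theorem critMatrix_zero_inr (j : Fin r) (b : Fin 2 ⊕ Fin r) :
    critMatrix P Q Qt 0 (Sum.inr j) b = 0 := by
  have h1 := h.mem_graph (Metric.mem_ball_self hξ₀) b
  have h2 := inner_constMode_of_mem_graph P h1 j
  rw [critMatrix, Matrix.of_apply, applyOp_of_mem_graph h1, h.dual_inr_at_zero, h2]
  simp [shift_zero]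

/-- The dual vector is the constant `eⱼ` only at `ξ = 0`, so the fixed `eⱼ` is used as test vector.
Pairing it with `L_ξ Q_l = ∑ D_al Q_a` gives `D_jl` as `⟨eⱼ, L_ξ Q_l⟩` plus the sum of `D_al (δ_ja -
⟨eⱼ, Q_a⟩)`. Every term, including those of the formula for conserved means, is a product of two
functions vanishing at `0`. -/
theorem hasFDerivAt_critMatrix (j : Fin r) (l : Fin 2) :
    HasFDerivAt (fun ξ => critMatrix P Q Qt ξ (Sum.inr j) (Sum.inl l))
      (0 : EuclideanSpace ℝ (Fin 2) →L[ℝ] ℂ) 0 := by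
  have hnhds : Metric.ball (0 : EuclideanSpace ℝ (Fin 2)) ξ₀ ∈ 𝓝 0 := Metric.ball_mem_nhds _ hξ₀
  have h0 := Metric.mem_ball_self (x := (0 : EuclideanSpace ℝ (Fin 2))) hξ₀
  let d : Fin 2 ⊕ Fin r → EuclideanSpace ℝ (Fin 2) → ℂ := fun a ξ => critMatrix P Q Qt ξ a (Sum.inl l)
  let c : Fin 2 ⊕ Fin r → EuclideanSpace ℝ (Fin 2) → ℂ := fun a ξ => inner ℂ (constMode P j) (Q a ξ)
  let e : Fin 2 → EuclideanSpace ℝ (Fin 2) → ℂ := fun m ξ =>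
    inner ℂ (constMode P j) (jacOp P (P.smooth_G m) (Q (Sum.inl l) ξ))
  let κ₁ : EuclideanSpace ℝ (Fin 2) → ℂ := fun ξ => ∑ m, (P.c m : ℂ) * (Complex.I * shift P ξ m)
  let κ₂ : EuclideanSpace ℝ (Fin 2) → ℂ := fun ξ => ∑ m, (Complex.I * shift P ξ m) ^ 2
  have hd : ∀ a, DifferentiableAt ℝ (d a) 0 := fun a =>
    ((h.contDiffOn_critMatrix a (Sum.inl l)).contDiffAt hnhds).differentiableAt (by simp)
  have hQ : ∀ a, ContDiffAt ℝ ∞ (Q a) 0 := fun a => (h.smooth a).contDiffAt hnhds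
  have hc : ∀ a, DifferentiableAt ℝ (c a) 0 := fun a =>
    (contDiffAt_const.inner ℂ (hQ a)).differentiableAt (by simp)
  have he : ∀ m, DifferentiableAt ℝ (e m) 0 := fun m =>
    (contDiffAt_const.inner ℂ ((contDiffOn_clm_apply (jacOp P (P.smooth_G m))
      (h.smooth (Sum.inl l))).contDiffAt hnhds)).differentiableAt (by simp)
  have hs : ∀ m, ContDiffAt ℝ ∞ (fun ξ => Complex.I * shift P ξ m) 0 := fun m =>
    contDiffAt_const.mul (contDiff_shift_apply P m).contDiffAt
  have hκ₁ : DifferentiableAt ℝ κ₁ 0 :=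
    (ContDiffAt.sum fun m _ => contDiffAt_const.mul (hs m)).differentiableAt (n := ∞) (by simp)
  have hκ₂ : DifferentiableAt ℝ κ₂ 0 :=
    (ContDiffAt.sum fun m _ => (hs m).pow 2).differentiableAt (n := ∞) (by simp)
  have hd0 : ∀ a, d a 0 = 0 := fun a => h.critMatrix_zero_inl a l
  have hc0 : ∀ a, c a 0 = if Sum.inr j = a then 1 else 0 := fun a => by
    rw [← h.dual 0 h0, h.dual_inr_at_zero]
  -- The function `DG_m(U) ∂_lU` is `∂_l (G_m(U))`, whose mean is zero.
  have he0 : ∀ m, e m 0 = 0 := fun m => by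
    change inner ℂ (constMode P j) (jacOp P (P.smooth_G m) (Q (Sum.inl l) 0)) = 0
    rw [h.inl_at_zero, inner_constMode, coeff_jacOp, coeff_dC_waveMode P (P.smooth_G m)]
    simp
  have hc1 : c (Sum.inl l) 0 = 0 := by rw [hc0, if_neg Sum.inr_ne_inl]
  have key : (fun ξ => d (Sum.inr j) ξ) =ᶠ[𝓝 0] fun ξ =>
      (∑ a, d a ξ * ((if Sum.inr j = a then 1 else 0) - c a ξ))
        + (κ₂ ξ * c (Sum.inl l) ξ + (∑ m, Complex.I * shift P ξ m * e m ξ) + κ₁ ξ * c (Sum.inl l) ξ) := by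
    filter_upwards [hnhds] with ξ hξ
    have h1 := inner_constMode_of_mem_graph P (h.mem_graph hξ (Sum.inl l)) j
    rw [inner_sum] at h1
    change _ = κ₂ ξ * c (Sum.inl l) ξ + (∑ m, Complex.I * shift P ξ m * e m ξ)
      + κ₁ ξ * c (Sum.inl l) ξ at h1
    rw [← h1, ← Finset.sum_add_distrib]
    have h2 : ∀ a, d a ξ * ((if Sum.inr j = a then 1 else 0) - c a ξ)
        + inner ℂ (constMode P j) (critMatrix P Q Qt ξ a (Sum.inl l) • Q a ξ)
        = if Sum.inr j = a then d a ξ else 0 := fun a => by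
      rw [inner_smul_right]
      change d a ξ * ((if Sum.inr j = a then 1 else 0) - c a ξ) + d a ξ * c a ξ = _
      split_ifs <;> ring
    simp only [h2]
    simp
  refine HasFDerivAt.congr_of_eventuallyEq ?_ key
  have t1 : HasFDerivAt (fun ξ => ∑ a, d a ξ * ((if Sum.inr j = a then 1 else 0) - c a ξ))
      (0 : EuclideanSpace ℝ (Fin 2) →L[ℝ] ℂ) 0 := by
    have := HasFDerivAt.fun_sum (u := Finset.univ) fun a _ =>
      hasFDerivAt_mul_of_eq_zero (hd a) ((differentiableAt_const _).sub (hc a)) (hd0 a)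
        (sub_eq_zero.2 (hc0 a).symm)
    simpa using this
  have t2 := hasFDerivAt_mul_of_eq_zero hκ₂ (hc (Sum.inl l)) (by simp [κ₂, shift_zero]) hc1
  have t4 := hasFDerivAt_mul_of_eq_zero hκ₁ (hc (Sum.inl l)) (by simp [κ₁, shift_zero]) hc1
  have t3 : HasFDerivAt (fun ξ => ∑ m, Complex.I * shift P ξ m * e m ξ)
      (0 : EuclideanSpace ℝ (Fin 2) →L[ℝ] ℂ) 0 := by
    have := HasFDerivAt.fun_sum (u := Finset.univ) fun m _ =>
      hasFDerivAt_mul_of_eq_zero ((hs m).differentiableAt (by simp)) (he m) (by simp [shift_zero]) (he0 m)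
    simpa using this
  have := t1.fun_add ((t2.fun_add t3).fun_add t4)
  rwa [add_zero, add_zero, add_zero] at this

omit h hξ₀ in
theorem scaling_eq_diagonal (r : ℕ) (ρ : ℝ) :
    scaling r ρ = Matrix.diagonal (Sum.elim (fun _ => (ρ : ℂ)) fun _ => 1) := by
  rw [scaling, ← Matrix.fromBlocks_diagonal]
  congr 1
  exact Matrix.smul_one_eq_diagonal _

omit h hξ₀ in
theorem rescaledMatrix_apply {ξ : EuclideanSpace ℝ (Fin 2)} (hξ : ξ ≠ 0) (a b : Fin 2 ⊕ Fin r) :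
    rescaledMatrix P Q Qt ξ a b = (Sum.elim (fun _ => (‖ξ‖ : ℂ)) (fun _ => 1) a : ℂ)
      * critMatrix P Q Qt ξ a b * (Sum.elim (fun _ => (‖ξ‖ : ℂ)) (fun _ => 1) b : ℂ)⁻¹ := by
  have hne : (‖ξ‖ : ℂ) ≠ 0 := by exact_mod_cast norm_ne_zero_iff.2 hξ
  have hinv : (scaling r ‖ξ‖)⁻¹ = Matrix.diagonal fun b => (Sum.elim (fun _ => (‖ξ‖ : ℂ)) (fun _ => 1) b : ℂ)⁻¹ := by
    refine Matrix.inv_eq_right_inv ?_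
    rw [scaling_eq_diagonal, Matrix.diagonal_mul_diagonal, ← Matrix.diagonal_one]
    congr 1
    funext b
    rcases b with b | b
    · exact mul_inv_cancel₀ hne
    · simp
  rw [rescaledMatrix, if_neg hξ, hinv, scaling_eq_diagonal, Matrix.mul_diagonal, Matrix.diagonal_mul]

/-- Block by block: for `ρ > 0` the entries are those of `D`, `ρ D`, `ρ⁻¹ D` and `D`. At `ρ = 0`
each of these formulas gives the imposed value `0`, by the vanishing of `D` in the diagonal blocks,
by the factor `ρ`, or by the convention `0⁻¹ = 0`. -/
theorem smoothInPolar : SmoothInPolar ξ₀ (rescaledMatrix P Q Qt) := by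
  have hD : ∀ a b, ContDiffOn ℝ ∞ (fun p => critMatrix P Q Qt (polar p) a b) (Ico 0 ξ₀ ×ˢ univ) :=
    fun a b => contDiffOn_comp_polar (h.contDiffOn_critMatrix a b)
  have hzero : ∀ p : ℝ × ℝ, p.1 = 0 → polar p = 0 := fun p hp => by
    rw [← norm_eq_zero, norm_polar, hp, abs_zero]
  have hne : ∀ p : ℝ × ℝ, p.1 ≠ 0 → polar p ≠ 0 := fun p hp => by
    rwa [← norm_ne_zero_iff, norm_polar, abs_ne_zero]
  have hnorm : ∀ p ∈ Ico 0 ξ₀ ×ˢ (univ : Set ℝ), ‖polar p‖ = p.1 := fun p hp => by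
    rw [norm_polar, abs_of_nonneg hp.1.1]
  have hr0 : ∀ p : ℝ × ℝ, p.1 = 0 → ∀ a b, rescaledMatrix P Q Qt (polar p) a b = 0 := fun p hp a b => by
    rw [rescaledMatrix, if_pos (hzero p hp), Matrix.zero_apply]
  rintro (a | a) (b | b)
  · refine (hD (Sum.inl a) (Sum.inl b)).congr fun p hp => ?_
    by_cases hp0 : p.1 = 0
    · rw [hr0 p hp0, hzero p hp0, h.critMatrix_zero_inl]
    · have hc : (p.1 : ℂ) ≠ 0 := by exact_mod_cast hp0
      rw [rescaledMatrix_apply (hne p hp0), hnorm p hp]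
      simp only [Sum.elim_inl]
      field_simp
  · refine ((Complex.ofRealCLM.contDiff.comp contDiff_fst).contDiffOn.mul
      (hD (Sum.inl a) (Sum.inr b))).congr fun p hp => ?_
    by_cases hp0 : p.1 = 0
    · rw [hr0 p hp0]
      simp [hp0]
    · rw [rescaledMatrix_apply (hne p hp0), hnorm p hp]
      simp
  · refine (contDiffOn_div_polar (h.contDiffOn_critMatrix (Sum.inr a) (Sum.inl b))
      (h.critMatrix_zero_inl _ _) (h.hasFDerivAt_critMatrix hξ₀ a b)).congr fun p hp => ?_
    by_cases hp0 : p.1 = 0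
    · rw [hr0 p hp0, hp0]
      simp
    · rw [rescaledMatrix_apply (hne p hp0), hnorm p hp]
      simp [mul_comm]
  · refine (hD (Sum.inr a) (Sum.inr b)).congr fun p hp => ?_
    by_cases hp0 : p.1 = 0
    · rw [hr0 p hp0, hzero p hp0, h.critMatrix_zero_inr hξ₀]
    · rw [rescaledMatrix_apply (hne p hp0)]
      simp

end IsCriticalBasis

end Matrix

end BlochWave

end

theorem proposition2p3 {n r : ℕ} (P : BlochWave.PeriodicWave n r) (hD1 : BlochWave.ConditionD1 P) :
    (∃ δ > 0, ∃ ξ₀ > 0, ∃ Q Qt, BlochWave.IsCriticalBasis P δ ξ₀ Q Qt) ∧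
    ∀ δ > 0, ∀ ξ₀ > 0, ∀ Q Qt, BlochWave.IsCriticalBasis P δ ξ₀ Q Qt →
      BlochWave.SmoothInPolar ξ₀ (BlochWave.rescaledMatrix P Q Qt) := by
  refine ⟨BlochWave.exists_isCriticalBasis P hD1, fun δ _ ξ₀ hξ₀ Q Qt h => ?_⟩
  exact h.smoothInPolar hξ₀
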